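/- **Theorem.** For $s\in\mathbb C$ and $n\in\mathbb N$ put $\tau_s(n)=\sum_{n_1n_2=n}(n_1/n_2)^s$. For an integer $k\ge 2$, $t\in\mathbb R$, $v=it$ and real $z\neq 0,1$ let $$H_k(0,v;z)=\begin{cases}\dfrac{(-1)^k}{2}\,z^{1/2-k}\,I_1(1/z), & z>0,\\[2mm] \dfrac12(-z)^{1/2-k}I_2(-1/z), & z<0,\end{cases}$$ where, for $x>0$ and $1-2k<\Delta<-1$, $$I_1(x)=\frac1{2\pi i}\int_{\Re s=\Delta}\Gamma_k(s)\sin\Big(\frac{\pi s}2\Big)x^{s/2}\,ds,\qquad I_2(x)=\frac1{2\pi i}\int_{\Re s=\Delta}\Gamma_k(s)\,x^{s/2}\,ds,$$ $$\Gamma_k(s)=\frac{\Gamma(k-\frac12+\frac s2)}{\Gamma(k+\frac12-\frac s2)}\,\Gamma\Big(\frac12+v-\frac s2\Big)\Gamma\Big(\frac12-v-\frac s2\Big),$$ the integrals being limits as $R\to\infty$ of the integrals from $\Delta-iR$ to $\Delta+iR$. For positive integers $N,l,r$ define $$V_{N,1}(r)=\frac{\cos \pi v}{r^{-k+v}}\sum_{n\ge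 (1+r)/N}\frac{\tau_0(n)\tau_v(nN-r)}{(nN-r)^k}H_k\Big(0,v;\frac{-r}{nN-r}\Big),$$ $$V_{N,2}(r)=\frac{(-1)^k}{r^{-k+v}}\sum_{(1-r)/N\le n\le -1}\frac{\tau_0(|n|)\tau_v(nN+r)}{(nN+r)^k}H_k\Big(0,v;\frac{r}{nN+r}\Big),$$ $$V_{N,3}(r)=\frac{(-1)^k}{r^{-k+v}}\sum_{n\ge 1}\frac{\tau_0(n)\tau_v(nN+r)}{(nN+r)^k}H_k\Big(0,v;\frac{r}{nN+r}\Big),$$ $$V_N(l)=\frac{2(-1)^k}{l^{1/2-v}}\sum_{d\mid l}\sum_{r\mid d}\mu(d/r)\big(V_{N,1}(r)+V_{N,2}(r)+V_{N,3}(r)\big),$$ with $\mu$ the Möbius function. Let $T=3+|t|$. Then the series defining $V_{N,1}(r)$ and $V_{N,3}(r)$ converge absolutely, and for every $\epsilon>0$ there is a constant $C>0$ depending only on $\epsilon$ such that for all integers $k\ge 2$, $N\ge 1$, $l\ge 1$ and all $t\in\mathbb R$ $$|V_N(l)|\le C\cdot\begin{cases}(lkT^2)^{\epsilon}\,\dfrac{l^{1/2}(k+T)}{N},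 & l\ge N/(1+T^2),\\[3mm]\left(\dfrac{lT^2}{4(N-l)}\right)^{k}\dfrac{N^{\epsilon}}{l^{1/2}T}, & l<N/(1+T^2).\end{cases}$$ -/

import Mathlib

namespace SecondMoment

open Complex

/-- `τ_s(n) = ∑_{n₁ n₂ = n} (n₁ / n₂)^s`; in particular `τ_0(n)` is the number of divisors. -/
noncomputable def tau (s : ℂ) (n : ℕ) : ℂ :=
  ∑ p ∈ n.divisorsAntidiagonal, ((p.1 : ℂ) / (p.2 : ℂ)) ^ s

/-- `Γ(u, v, λ; s) =
Γ(λ - 1/2 + s/2) / Γ(λ + 1/2 - s/2) · Γ(1/2 - u + v - s/2) · Γ(1/2 - u - v - s/2)`. -/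
noncomputable def gammaKernel (u v lam s : ℂ) : ℂ :=
  Gamma (lam - 1 / 2 + s / 2) / Gamma (lam + 1 / 2 - s / 2) *
    Gamma (1 / 2 - u + v - s / 2) * Gamma (1 / 2 - u - v - s / 2)

/-- `(1 / (2πi)) ∫_{Re s = Δ} f(s) ds`, as the limit of the integrals over the segments
`Δ - iR, Δ + iR` for `R → ∞` (the integrals below need not converge absolutely). -/
noncomputable def lineIntegral (Δ : ℝ) (f : ℂ → ℂ) : ℂ :=
  Filter.limUnder Filter.atTop fun R : ℝ =>
    1 / (2 * (Real.pi : ℂ)) * ∫ y in (-R)..R, f ((Δ : ℂ) + (y : ℂ) * I)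

/-- An abscissa `Δ` with `1 - 2 Re λ < Δ < -1 - 2 Re u`: the midpoint of this interval, which is
non-empty for `Re λ > 1 + Re u`. The integrands below are holomorphic in the strip, and the
integrals do not depend on the choice of `Δ` in the interval. -/
noncomputable def abscissa (lam u : ℂ) : ℝ := -lam.re - u.re

/-- `I₁(x) = (1 / (2πi)) ∫_{Re s = Δ} Γ(u, v, λ; s) sin(π (u + s/2)) x^{s/2} ds`. -/
noncomputable def I₁ (lam u v : ℂ) (x : ℝ) : ℂ :=
  lineIntegral (abscissa lam u) fun s =>
    gammaKernel u v lam s * sin (Real.pi * (u + s / 2)) * (x : ℂ) ^ (s / 2)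

/-- `I₂(x) = (1 / (2πi)) ∫_{Re s = Δ} Γ(u, v, λ; s) x^{s/2} ds`. -/
noncomputable def I₂ (lam u v : ℂ) (x : ℝ) : ℂ :=
  lineIntegral (abscissa lam u) fun s => gammaKernel u v lam s * (x : ℂ) ^ (s / 2)

/-- The function `H_λ(u, v; z)` of a real argument `z ≠ 0`. -/
noncomputable def hypH (lam u v : ℂ) (z : ℝ) : ℂ :=
  if 0 < z then
    1 / (2 * cos (Real.pi * (lam - u))) * (z : ℂ) ^ (1 / 2 - lam) * I₁ lam u v (1 / z)
  else
    1 / 2 * ((-z : ℝ) : ℂ) ^ (1 / 2 - lam) * I₂ lam u v (-1 / z)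

/-- The `n`-th term, `n ≥ (1 + r) / N`, of the series in `V_{N,1}(r)`. -/
noncomputable def V₁term (k N : ℕ) (v : ℂ) (r n : ℕ) : ℂ :=
  if 1 + r ≤ n * N then
    tau 0 n * tau v (n * N - r) / ((n * N - r : ℕ) : ℂ) ^ k *
      hypH k 0 v (-(r : ℝ) / ((n : ℝ) * N - r))
  else 0

/-- `V_{N,1}(r) = cos(πv) r^{k-v} ∑_{n ≥ (1+r)/N} τ_0(n) τ_v(nN-r) (nN-r)^{-k} H_k(0,v;-r/(nN-r))`. -/
noncomputable def V₁ (k N : ℕ) (v : ℂ) (r : ℕ) : ℂ :=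
  cos (Real.pi * v) * (r : ℂ) ^ ((k : ℂ) - v) * ∑' n : ℕ, V₁term k N v r n

/-- `V_{N,2}(r) = (-1)^k r^{k-v}
  ∑_{(1-r)/N ≤ n ≤ -1} τ_0(|n|) τ_v(nN+r) (nN+r)^{-k} H_k(0,v;r/(nN+r))`,
written as a sum over `-n`, that is, over `1 ≤ n ≤ (r-1)/N`. -/
noncomputable def V₂ (k N : ℕ) (v : ℂ) (r : ℕ) : ℂ :=
  (-1) ^ k * (r : ℂ) ^ ((k : ℂ) - v) *
    ∑ n ∈ Finset.Icc 1 ((r - 1) / N),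
      tau 0 n * tau v (r - n * N) / ((r - n * N : ℕ) : ℂ) ^ k *
        hypH k 0 v ((r : ℝ) / ((r : ℝ) - n * N))

/-- The `n`-th term, `n ≥ 1`, of the series in `V_{N,3}(r)`. -/
noncomputable def V₃term (k N : ℕ) (v : ℂ) (r n : ℕ) : ℂ :=
  if 1 ≤ n then
    tau 0 n * tau v (n * N + r) / ((n * N + r : ℕ) : ℂ) ^ k *
      hypH k 0 v ((r : ℝ) / ((n : ℝ) * N + r))
  else 0

/-- `V_{N,3}(r) = (-1)^k r^{k-v} ∑_{n ≥ 1} τ_0(n) τ_v(nN+r) (nN+r)^{-k} H_k(0,v;r/(nN+r))`. -/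
noncomputable def V₃ (k N : ℕ) (v : ℂ) (r : ℕ) : ℂ :=
  (-1) ^ k * (r : ℂ) ^ ((k : ℂ) - v) * ∑' n : ℕ, V₃term k N v r n

/-- `V_N(l) = 2 (-1)^k l^{-(1/2-v)} ∑_{d ∣ l} ∑_{r ∣ d} μ(d/r) (V_{N,1}(r)+V_{N,2}(r)+V_{N,3}(r))`. -/
noncomputable def V (k N : ℕ) (v : ℂ) (l : ℕ) : ℂ :=
  2 * (-1) ^ k / (l : ℂ) ^ (1 / 2 - v) *
    ∑ d ∈ l.divisors, ∑ r ∈ d.divisors,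
      (ArithmeticFunction.moebius (d / r) : ℂ) * (V₁ k N v r + V₂ k N v r + V₃ k N v r)

end SecondMoment

open Filter Topology MeasureTheory

namespace SecondMoment

/-! Put w = s/2 and x = 1/|z|. In the three sums x = a/r with a = nN - r, r - nN, nN + r
respectively, and r^k a^(-k) x^(k-1/2) = x^(-1/2). So, up to divisor functions, a term is x^(-1/2)
|I₂(x)| cosh(πt) for `V₁`, and x^(-1/2) |I₁(x)| for `V₂` and `V₃` (`pow_mul_norm_term_le`). The
theorem thus reduces to bounds for I₁ and I₂ that are uniform in k and t, and these come from a
choice of the line of integration inside 1/2 - k < Re w < 1/2, where the integrand is holomorphic.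

For I₂, the two factors Γ(1/2 ± it - w) decay together like exp(-π max(|y|, |t|)), which pays for
cosh(πt). For I₁, the sine removes the exponential decay in y and leaves only 1/|y|. Multiplication
by 1 - x repairs this: since x · x^(w-1) = x^w, shifting one copy of the contour by 1 turns (1 - x)
I₁ into the integral of K(w) - K(w - 1), K being `sinKernel`. The functional equation of Γ makes the
leading terms of this difference cancel (`sinKernel_sub_mul`), and the integral converges absolutely
(`norm_I₁_le`). Dividing by |1 - x| = nN/r afterwards is what saves N in `V₂` and `V₃`.

For large l the line is Re w = 1/2 - δ, replaced by Re w = -1/2 - δ for I₂ at large x. Every term is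
then at most (k + T) (r/(nN))^(1+δ/2) up to small powers of r and T, and the sum over n converges.
For small l one has r ≤ l < N, so `V₂` is empty and 1/x ≤ l/((N - l) n). The line is pushed to the
left edge, Re w = 1/2 - k + ε for I₂ and 3/2 - k + ε for the difference. There Γ(k - ε ± it - iy) is
compared factor by factor with Γ(2k - ε - iy) (`pairRatio`), which yields (T²/4)^k / T.

Uniformity rests on `gammaNorm_le`, a comparison of |Γ| on two vertical lines with an explicit
constant. -/

/-! ### Moduli of Γ on vertical lines -/

/-- The modulus `|Γ(a + iy)|`. -/
noncomputable def gammaNorm (a y : ℝ) : ℝ := ‖Complex.Gamma (a + y * Complex.I)‖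

lemma gammaNorm_neg (a y : ℝ) : gammaNorm a (-y) = gammaNorm a y := by
  unfold gammaNorm
  rw [← Complex.norm_conj (Complex.Gamma (a + y * Complex.I)), ← Complex.Gamma_conj]
  simp

lemma gammaNorm_pos {a : ℝ} (ha : 0 < a) (y : ℝ) : 0 < gammaNorm a y := by
  unfold gammaNorm
  exact norm_pos_iff.mpr (Complex.Gamma_ne_zero_of_re_pos (by simpa using ha))

lemma norm_add_mul_I (a y : ℝ) : ‖(a + y * Complex.I : ℂ)‖ = √(a ^ 2 + y ^ 2) :=
  Complex.norm_add_mul_I a y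

lemma gammaNorm_add_one {a : ℝ} (ha : 0 < a) (y : ℝ) :
    gammaNorm (a + 1) y = √(a ^ 2 + y ^ 2) * gammaNorm a y := by
  unfold gammaNorm
  have h : (a + y * Complex.I : ℂ) ≠ 0 := by
    intro h; have := congrArg Complex.re h; simp at this; linarith
  rw [← norm_add_mul_I, ← norm_mul, ← Complex.Gamma_add_one _ h]
  push_cast; ring_nf

/-- On Re s = 1/2 the point 1 - s is the conjugate of s, so the reflection formula evaluates |Γ(s)|²
exactly. All exponential factors below come from this line. -/
lemma gammaNorm_half_sq (y : ℝ) : gammaNorm (1 / 2) y ^ 2 = Real.pi / Real.cosh (Real.pi * y) := by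
  have h := Complex.Gamma_mul_Gamma_one_sub ((1 / 2 : ℝ) + y * Complex.I)
  have h1 : (1 - ((1 / 2 : ℝ) + y * Complex.I) : ℂ) = (1 / 2 : ℝ) + (-y : ℝ) * Complex.I := by
    push_cast; ring
  have h2 : Complex.sin (Real.pi * ((1 / 2 : ℝ) + y * Complex.I)) = Real.cosh (Real.pi * y) := by
    rw [show (Real.pi * ((1 / 2 : ℝ) + y * Complex.I) : ℂ)
      = (Real.pi * y : ℝ) * Complex.I + Real.pi / 2 by push_cast; ring, Complex.sin_add_pi_div_two,
      Complex.cos_mul_I, Complex.ofReal_cosh]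
  rw [h1, h2] at h
  have h3 := congrArg norm h
  rw [norm_mul] at h3
  change gammaNorm (1 / 2) y * gammaNorm (1 / 2) (-y) = _ at h3
  rw [gammaNorm_neg, ← pow_two] at h3
  rw [h3, norm_div, Complex.norm_real, Complex.norm_real, Real.norm_of_nonneg Real.pi_pos.le,
    Real.norm_of_nonneg (Real.cosh_pos _).le]

lemma exp_abs_div_two_le_cosh (x : ℝ) : Real.exp |x| / 2 ≤ Real.cosh x := by
  rw [← Real.cosh_abs, Real.cosh_eq]
  have := Real.exp_pos (-|x|)
  linarith

lemma cosh_le_exp_abs (x : ℝ) : Real.cosh x ≤ Real.exp |x| := by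
  rw [← Real.cosh_abs, Real.cosh_eq]
  have : Real.exp (-|x|) ≤ Real.exp |x| := Real.exp_le_exp.mpr (by linarith [abs_nonneg x])
  linarith

lemma gammaNorm_half_le (y : ℝ) : gammaNorm (1 / 2) y ≤ 3 * Real.exp (-(Real.pi * |y|) / 2) := by
  refine le_of_sq_le_sq ?_ (by positivity)
  rw [gammaNorm_half_sq, mul_pow, ← Real.exp_nat_mul, div_le_iff₀ (Real.cosh_pos _)]
  have h := exp_abs_div_two_le_cosh (Real.pi * y)
  rw [abs_mul, abs_of_pos Real.pi_pos] at h
  have e : Real.exp ((2 : ℕ) * (-(Real.pi * |y|) / 2)) * Real.exp (Real.pi * |y|) = 1 := by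
    rw [← Real.exp_add]; simp; ring
  have h4 := Real.pi_le_four
  have hp := Real.exp_pos ((2 : ℕ) * (-(Real.pi * |y|) / 2))
  nlinarith [mul_le_mul_of_nonneg_left h hp.le]

lemma le_gammaNorm_half (y : ℝ) : Real.exp (-(Real.pi * |y|) / 2) ≤ gammaNorm (1 / 2) y := by
  refine le_of_sq_le_sq ?_ (gammaNorm_pos (by norm_num) y).le
  rw [gammaNorm_half_sq, ← Real.exp_nat_mul, le_div_iff₀ (Real.cosh_pos _)]
  have h := cosh_le_exp_abs (Real.pi * y)
  rw [abs_mul, abs_of_pos Real.pi_pos] at h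
  have e : Real.exp ((2 : ℕ) * (-(Real.pi * |y|) / 2)) * Real.exp (Real.pi * |y|) = 1 := by
    rw [← Real.exp_add]; simp; ring
  have hp := Real.exp_pos ((2 : ℕ) * (-(Real.pi * |y|) / 2))
  nlinarith [mul_le_mul_of_nonneg_left h hp.le, Real.pi_gt_three]

lemma convexOn_log_one_add_div_sq (y : ℝ) :
    ConvexOn ℝ (Set.Ioi 0) (fun x : ℝ => Real.log (1 + (y / x) ^ 2)) := by
  have hd : ∀ x ∈ Set.Ioi (0 : ℝ), HasDerivAt (fun x : ℝ => Real.log (1 + (y / x) ^ 2))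
      (-(2 * y ^ 2 / (x * (x ^ 2 + y ^ 2)))) x := by
    intro x hx
    have hx : 0 < x := hx
    have h1 : HasDerivAt (fun x : ℝ => y / x) (-y / x ^ 2) x := by
      simpa [div_eq_mul_inv] using (hasDerivAt_inv hx.ne').const_mul y
    have h2 : HasDerivAt (fun x : ℝ => 1 + (y / x) ^ 2) (2 * (y / x) * (-y / x ^ 2)) x := by
      simpa using (h1.fun_pow 2).const_add 1
    have h3 := h2.log (by positivity)
    convert h3 using 1
    have : 0 < x ^ 2 + y ^ 2 := by positivity
    field_simp
  refine MonotoneOn.convexOn_of_deriv (convex_Ioi 0)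
    (fun x hx => (hd x hx).continuousAt.continuousWithinAt) ?_ ?_
  · rw [interior_Ioi]; exact fun x hx => (hd x hx).differentiableAt.differentiableWithinAt
  · rw [interior_Ioi]
    intro a ha b hb hab
    rw [(hd a ha).deriv, (hd b hb).deriv]
    have ha : 0 < a := ha
    have hb : 0 < b := hb
    rw [neg_le_neg_iff]
    gcongr

/-- Convexity compares the secant slopes on [a, b] and [b, b + 1]. The unit step is chosen so that
the left side telescopes when a, b are replaced by a + j, b + j. -/
lemma log_one_add_div_sq_sub_le {a b : ℝ} (ha : 0 < a) (hab : a ≤ b) (y : ℝ) :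
    (b - a) * (Real.log (1 + (y / b) ^ 2) - Real.log (1 + (y / (b + 1)) ^ 2)) ≤
      Real.log (1 + (y / a) ^ 2) - Real.log (1 + (y / b) ^ 2) := by
  rcases hab.eq_or_lt with rfl | hlt
  · simp
  have h := (convexOn_log_one_add_div_sq y).slope_mono_adjacent (x := a) (y := b) (z := b + 1) ha
    (by simp; linarith) hlt (by linarith)
  rw [show b + 1 - b = 1 by ring, div_one, div_le_iff₀ (by linarith)] at h
  linarith

/-- In Euler's limit formula each factor |a + j + iy| is (a + j) √(1 + (y/(a+j))²), so |Γ(a +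
iy)|/Γ(a) becomes the exponential of a sum of values of one convex function. -/
lemma norm_GammaSeq {a : ℝ} (ha : 0 < a) (y : ℝ) {n : ℕ} (hn : n ≠ 0) :
    ‖Complex.GammaSeq (a + y * Complex.I) n‖ = Real.GammaSeq a n *
      Real.exp (-(∑ j ∈ Finset.range (n + 1), Real.log (1 + (y / (a + j)) ^ 2)) / 2) := by
  unfold Complex.GammaSeq Real.GammaSeq
  rw [norm_div, norm_mul, norm_prod, ← Complex.ofReal_natCast n,
    Complex.norm_cpow_eq_rpow_re_of_pos (by positivity), Complex.norm_natCast]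
  have h1 : ∀ j : ℕ, ‖(a + y * Complex.I + j : ℂ)‖
      = (a + j) * Real.exp (Real.log (1 + (y / (a + j)) ^ 2) / 2) := by
    intro j
    have hj : 0 < a + j := by positivity
    rw [show (a + y * Complex.I + j : ℂ) = ((a + j : ℝ) : ℂ) + y * Complex.I by push_cast; ring,
      norm_add_mul_I, Real.exp_half, Real.exp_log (by positivity)]
    nth_rw 2 [← Real.sqrt_sq hj.le]
    rw [← Real.sqrt_mul (by positivity)]
    congr 1
    field_simp
  simp_rw [h1]
  rw [Finset.prod_mul_distrib, ← Real.exp_sum, neg_div, Real.exp_neg, Finset.sum_div]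
  simp
  field_simp

/-- A sharp comparison of `|Γ|` on two vertical lines. -/
theorem gammaNorm_le {a b : ℝ} (ha : 0 < a) (hab : a ≤ b) (y : ℝ) :
    gammaNorm a y ≤
      Real.Gamma a / Real.Gamma b * (1 + (y / b) ^ 2) ^ (-(b - a) / 2) * gammaNorm b y := by
  have hb : 0 < b := ha.trans_le hab
  set φ : ℝ → ℝ := fun x => Real.log (1 + (y / x) ^ 2) with hφ
  have hseq : ∀ n : ℕ, n ≠ 0 → ‖Complex.GammaSeq (a + y * Complex.I) n‖ * Real.GammaSeq b n ≤
      Real.GammaSeq a n * ‖Complex.GammaSeq (b + y * Complex.I) n‖ *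
        Real.exp (-(b - a) * (φ b - φ (b + (n + 1 : ℕ))) / 2) := by
    intro n hn
    rw [norm_GammaSeq ha y hn, norm_GammaSeq hb y hn]
    have hpos : ∀ c : ℝ, 0 < c → 0 ≤ Real.GammaSeq c n := by
      intro c hc
      unfold Real.GammaSeq
      have : ∀ j ∈ Finset.range (n + 1), 0 ≤ c + j := fun j _ => by positivity
      have := Finset.prod_nonneg this
      positivity
    -- Summing the convexity inequality over j telescopes. The boundary term φ(b + n + 1) tends to
    -- 0, so only φ(b) survives in the limit and gives the power of 1 + (y/b)².
    have hs : (b - a) * (φ b - φ (b + (n + 1 : ℕ))) ≤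
        ∑ j ∈ Finset.range (n + 1), φ (a + j) - ∑ j ∈ Finset.range (n + 1), φ (b + j) := by
      have := Finset.sum_range_sub' (fun j : ℕ => φ (b + j)) (n + 1)
      simp only [Nat.cast_zero, add_zero] at this
      rw [← this, Finset.mul_sum, ← Finset.sum_sub_distrib]
      refine Finset.sum_le_sum fun j _ => ?_
      have hj : (0 : ℝ) ≤ j := by positivity
      have := log_one_add_div_sq_sub_le (a := a + j) (b := b + j) (by linarith) (by linarith) y
      simp only [hφ]
      push_cast
      rw [show b + j - (a + j) = b - a by ring] at this
      rw [← add_assoc]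
      exact this
    have : Real.exp (-(∑ j ∈ Finset.range (n + 1), φ (a + j)) / 2) ≤
        Real.exp (-(∑ j ∈ Finset.range (n + 1), φ (b + j)) / 2) *
        Real.exp (-(b - a) * (φ b - φ (b + (n + 1 : ℕ))) / 2) := by
      rw [← Real.exp_add, Real.exp_le_exp]
      linarith
    have h2 := mul_le_mul_of_nonneg_left this (mul_nonneg (hpos a ha) (hpos b hb))
    simp only [hφ] at h2 ⊢
    linarith
  have hφ0 : Tendsto (fun n : ℕ => φ (b + (n + 1 : ℕ))) atTop (𝓝 0) := by
    have h1 : Tendsto (fun n : ℕ => b + ((n + 1 : ℕ) : ℝ)) atTop atTop :=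
      tendsto_atTop_add_const_left _ _
        (tendsto_natCast_atTop_atTop.comp (tendsto_add_atTop_nat 1))
    have h2 := (h1.const_div_atTop y).pow 2 |>.const_add 1
    have h3 := h2.log (by norm_num)
    simpa using h3
  have hlim := le_of_tendsto_of_tendsto
    (((Complex.GammaSeq_tendsto_Gamma (a + y * Complex.I)).norm).mul (Real.GammaSeq_tendsto_Gamma b))
    (((Real.GammaSeq_tendsto_Gamma a).mul
      ((Complex.GammaSeq_tendsto_Gamma (b + y * Complex.I)).norm)).mul
      ((Real.continuous_exp.tendsto _).comp
        (((hφ0.const_sub (φ b)).const_mul (-(b - a))).div_const 2)))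
    ((eventually_ne_atTop 0).mono hseq)
  have hΓ := Real.Gamma_pos_of_pos hb
  change gammaNorm a y * Real.Gamma b ≤ Real.Gamma a * gammaNorm b y * _ at hlim
  have he : Real.exp (-(b - a) * (φ b - 0) / 2) = (1 + (y / b) ^ 2) ^ (-(b - a) / 2) := by
    rw [Real.rpow_def_of_pos (by positivity)]
    congr 1; simp only [hφ]; ring
  rw [he] at hlim
  rw [div_mul_eq_mul_div, div_mul_eq_mul_div, le_div_iff₀ hΓ]
  linarith

lemma gammaNorm_le_of_le {a b : ℝ} (ha : 0 < a) (hab : a ≤ b) (y : ℝ) :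
    gammaNorm a y ≤ Real.Gamma a / Real.Gamma b * gammaNorm b y := by
  have hb : 0 < b := ha.trans_le hab
  have h1 := Real.Gamma_pos_of_pos ha
  have h2 := Real.Gamma_pos_of_pos hb
  refine (gammaNorm_le ha hab y).trans ?_
  have : (1 + (y / b) ^ 2) ^ (-(b - a) / 2) ≤ 1 :=
    Real.rpow_le_one_of_one_le_of_nonpos (by nlinarith [sq_nonneg (y / b)]) (by linarith)
  have h3 := (gammaNorm_pos hb y).le
  calc _ ≤ Real.Gamma a / Real.Gamma b * 1 * gammaNorm b y := by gcongr
    _ = _ := by ring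

lemma one_add_div_sq_rpow_le {b c : ℝ} (hb : 0 < b) (hc : 0 ≤ c) (y : ℝ) :
    (1 + (y / b) ^ 2) ^ (-c / 2) ≤ (2 * (1 + b)) ^ c * (1 + |y|) ^ (-c) := by
  have hD : 0 < 2 * (1 + b) := by positivity
  have hy : 0 < 1 + |y| := by positivity
  have h1 : ((1 + |y|) / (2 * (1 + b))) ^ 2 ≤ 1 + (y / b) ^ 2 := by
    rw [div_pow, div_le_iff₀ (by positivity)]
    have : y ^ 2 = (y / b) ^ 2 * b ^ 2 := by field_simp
    nlinarith [sq_nonneg (1 - |y|), sq_abs y, sq_nonneg (y / b), mul_nonneg (sq_nonneg (y / b)) hb.le]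
  calc (1 + (y / b) ^ 2) ^ (-c / 2) ≤ (((1 + |y|) / (2 * (1 + b))) ^ 2) ^ (-c / 2) :=
        Real.rpow_le_rpow_of_nonpos (by positivity) h1 (by linarith)
    _ = ((1 + |y|) / (2 * (1 + b))) ^ (-c) := by
        rw [← Real.rpow_natCast, ← Real.rpow_mul (by positivity)]
        congr 1; push_cast; ring
    _ = _ := by
        rw [Real.div_rpow hy.le hD.le, Real.rpow_neg hD.le]
        field_simp

lemma gammaNorm_nat_add_half_le (m : ℕ) (y : ℝ) :
    gammaNorm (m + 1 / 2) y ≤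
      3 * m.factorial * (1 + |y|) ^ m * Real.exp (-(Real.pi * |y|) / 2) := by
  induction m with
  | zero => simpa using gammaNorm_half_le y
  | succ m ih =>
    rw [show ((m + 1 : ℕ) : ℝ) + 1 / 2 = (m + 1 / 2) + 1 by push_cast; ring,
      gammaNorm_add_one (by positivity)]
    have h1 : √(((m : ℝ) + 1 / 2) ^ 2 + y ^ 2) ≤ (m + 1) * (1 + |y|) := by
      rw [Real.sqrt_le_left (by positivity)]
      have hm : (0 : ℝ) ≤ m := by positivity
      nlinarith [sq_abs y, abs_nonneg y, mul_nonneg hm (abs_nonneg y), mul_nonneg hm hm,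
        mul_nonneg (mul_nonneg hm (abs_nonneg y)) (abs_nonneg y),
        mul_nonneg (mul_nonneg hm hm) (abs_nonneg y), sq_nonneg ((m : ℝ) * y), mul_nonneg hm (sq_nonneg y)]
    calc _ ≤ ((m + 1) * (1 + |y|)) *
          (3 * m.factorial * (1 + |y|) ^ m * Real.exp (-(Real.pi * |y|) / 2)) := by
          have := (gammaNorm_pos (show (0 : ℝ) < m + 1 / 2 by positivity) y).le
          gcongr
      _ = _ := by rw [Nat.factorial_succ]; push_cast; ring

/-- Upper bound of Stirling type, uniform on vertical strips. -/
theorem exists_gammaNorm_le {a₀ : ℝ} (h₀ : 0 < a₀) (a₁ : ℝ) :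
    ∃ C : ℝ, 0 < C ∧ ∀ a ∈ Set.Icc a₀ a₁, ∀ y : ℝ,
      gammaNorm a y ≤ C * (1 + |y|) ^ (a - 1 / 2) * Real.exp (-(Real.pi * |y|) / 2) := by
  obtain ⟨M, hM⟩ := (isCompact_Icc (a := a₀) (b := a₁)).exists_bound_of_continuousOn
    (f := Real.Gamma) (fun a ha => (Real.differentiableOn_Gamma_Ioi.differentiableAt
      (Ioi_mem_nhds (h₀.trans_le ha.1))).continuousAt.continuousWithinAt)
  -- The reference line Re = m + 1/2 lies to the right of the strip; on it |Γ| is controlled by the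
  -- line Re = 1/2 and the functional equation.
  set m := ⌈a₁⌉₊
  set b : ℝ := m + 1 / 2 with hbdef
  have hb : 0 < b := by positivity
  have hΓb := Real.Gamma_pos_of_pos hb
  refine ⟨(|M| + 1) / Real.Gamma b * (2 * (1 + b)) ^ b * (3 * m.factorial), by positivity, ?_⟩
  intro a ha y
  have ha0 : 0 < a := h₀.trans_le ha.1
  have hab : a ≤ b := by
    have := Nat.le_ceil a₁
    have := ha.2
    simp only [hbdef, m]; linarith
  have hΓ : Real.Gamma a ≤ |M| + 1 := by
    have := hM a ha
    rw [Real.norm_of_nonneg (Real.Gamma_pos_of_pos ha0).le] at this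
    linarith [le_abs_self M]
  have h1 := one_add_div_sq_rpow_le hb (sub_nonneg.mpr hab) y
  have h2 := gammaNorm_nat_add_half_le m y
  have h3 : (2 * (1 + b)) ^ (b - a) ≤ (2 * (1 + b)) ^ b :=
    Real.rpow_le_rpow_of_exponent_le (by linarith) (by linarith)
  have hy : 0 < 1 + |y| := by positivity
  have h4 : (1 + |y|) ^ (-(b - a)) * (1 + |y|) ^ m = (1 + |y|) ^ (a - 1 / 2) := by
    rw [← Real.rpow_natCast, ← Real.rpow_add hy]
    congr 1; simp only [hbdef]; ring
  calc gammaNorm a y ≤ _ := gammaNorm_le ha0 hab y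
    _ ≤ (|M| + 1) / Real.Gamma b * ((2 * (1 + b)) ^ b * (1 + |y|) ^ (-(b - a))) *
        (3 * m.factorial * (1 + |y|) ^ m * Real.exp (-(Real.pi * |y|) / 2)) := by
        have := (gammaNorm_pos hb y).le
        have := (Real.Gamma_pos_of_pos ha0).le
        gcongr
        exact h1.trans (by gcongr)
    _ = _ := by rw [← h4]; ring

/-- Lower bound of Stirling type, uniform on vertical strips. -/
theorem exists_le_gammaNorm (a₁ : ℝ) :
    ∃ C : ℝ, 0 < C ∧ ∀ a ∈ Set.Icc (1 / 2) a₁, ∀ y : ℝ,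
      (1 + |y|) ^ (a - 1 / 2) * Real.exp (-(Real.pi * |y|) / 2) ≤ C * gammaNorm a y := by
  obtain ⟨M, hM⟩ := (isCompact_Icc (a := (1 / 2 : ℝ)) (b := a₁)).exists_bound_of_continuousOn
    (f := fun a => (Real.Gamma a)⁻¹) (fun a ha => by
      have h : (0 : ℝ) < a := lt_of_lt_of_le (by norm_num) ha.1
      exact ((Real.differentiableOn_Gamma_Ioi.differentiableAt
        (Ioi_mem_nhds h)).continuousAt.inv₀
          (Real.Gamma_pos_of_pos h).ne').continuousWithinAt)
  have hG := Real.Gamma_pos_of_pos (by norm_num : (0 : ℝ) < 1 / 2)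
  refine ⟨Real.Gamma (1 / 2) * (|M| + 1) * (2 * (1 + |a₁|)) ^ |a₁|, by positivity, ?_⟩
  intro a ha y
  have ha' : (1 / 2 : ℝ) ≤ a := ha.1
  have ha0 : 0 < a := by linarith
  have haa : a ≤ |a₁| := ha.2.trans (le_abs_self _)
  have hΓ : (Real.Gamma a)⁻¹ ≤ |M| + 1 := by
    have := hM a ha
    rw [Real.norm_of_nonneg (inv_pos.mpr (Real.Gamma_pos_of_pos ha0)).le] at this
    linarith [le_abs_self M]
  have h1 := one_add_div_sq_rpow_le ha0 (sub_nonneg.mpr ha') y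
  -- For the lower bound the comparison runs the other way, with Re = 1/2 as the left line.
  have h2 := (le_gammaNorm_half y).trans (gammaNorm_le (by norm_num) ha' y)
  have hy : 0 < 1 + |y| := by positivity
  have h3 : (2 * (1 + a)) ^ (a - 1 / 2) ≤ (2 * (1 + |a₁|)) ^ |a₁| :=
    calc (2 * (1 + a)) ^ (a - 1 / 2) ≤ (2 * (1 + |a₁|)) ^ (a - 1 / 2) := by
          gcongr
      _ ≤ _ := Real.rpow_le_rpow_of_exponent_le (by linarith [abs_nonneg a₁]) (by linarith)
  have hg := (gammaNorm_pos ha0 y).le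
  have hi := (inv_pos.mpr (Real.Gamma_pos_of_pos ha0)).le
  calc _ ≤ (1 + |y|) ^ (a - 1 / 2) * (Real.Gamma (1 / 2) / Real.Gamma a *
        (1 + (y / a) ^ 2) ^ (-(a - 1 / 2) / 2) * gammaNorm a y) := by gcongr
    _ ≤ (1 + |y|) ^ (a - 1 / 2) * (Real.Gamma (1 / 2) * (|M| + 1) *
        ((2 * (1 + |a₁|)) ^ |a₁| * (1 + |y|) ^ (-(a - 1 / 2))) * gammaNorm a y) := by
        rw [div_eq_mul_inv (Real.Gamma (1 / 2))]
        gcongr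
        exact h1.trans (by gcongr)
    _ = ((1 + |y|) ^ (a - 1 / 2) * (1 + |y|) ^ (-(a - 1 / 2))) *
        (Real.Gamma (1 / 2) * (|M| + 1) * (2 * (1 + |a₁|)) ^ |a₁| * gammaNorm a y) := by ring
    _ = _ := by rw [← Real.rpow_add hy]; simp

/-- Peetre's inequality: 1 + |u + s| ≤ (1 + |s|)(1 + |u|), applied to y itself when p ≥ 0 and to (y
+ t) - t when p ≤ 0. -/
lemma one_add_abs_add_rpow_le (y t p : ℝ) :
    (1 + |y + t|) ^ p ≤ (1 + |t|) ^ |p| * (1 + |y|) ^ p := by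
  have key : ∀ u s : ℝ, 1 + |u + s| ≤ (1 + |s|) * (1 + |u|) := by
    intro u s
    nlinarith [abs_add_le u s, mul_nonneg (abs_nonneg u) (abs_nonneg s)]
  rcases le_total 0 p with hp | hp
  · rw [abs_of_nonneg hp, ← Real.mul_rpow (by positivity) (by positivity)]
    exact Real.rpow_le_rpow (by positivity) (key y t) hp
  · have h := key (y + t) (-t)
    rw [abs_neg, show y + t + -t = y by ring] at h
    have h2 := Real.rpow_le_rpow_of_nonpos (by positivity) h hp
    rw [Real.mul_rpow (by positivity) (by positivity)] at h2
    rw [abs_of_nonpos hp, Real.rpow_neg (by positivity), ← div_eq_inv_mul,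
      le_div_iff₀ (by positivity)]
    linarith

/-! ### The kernel in the variable w = s/2: holomorphy and decay -/

/-- The kernel `Γ(k - 1/2 + w) Γ(1/2 + it - w) Γ(1/2 - it - w) / Γ(k + 1/2 - w)`. -/
noncomputable def kernel (k : ℕ) (t : ℝ) (w : ℂ) : ℂ :=
  Complex.Gamma (k - 1 / 2 + w) / Complex.Gamma (k + 1 / 2 - w) *
    Complex.Gamma (1 / 2 + t * Complex.I - w) * Complex.Gamma (1 / 2 - t * Complex.I - w)

/-- The kernel multiplied by `sin(πw)`. -/
noncomputable def sinKernel (k : ℕ) (t : ℝ) (w : ℂ) : ℂ :=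
  kernel k t w * Complex.sin (Real.pi * w)

lemma norm_kernel (k : ℕ) (t σ y : ℝ) :
    ‖kernel k t (σ + y * Complex.I)‖ = gammaNorm (k - 1 / 2 + σ) y / gammaNorm (k + 1 / 2 - σ) y *
      gammaNorm (1 / 2 - σ) (y - t) * gammaNorm (1 / 2 - σ) (y + t) := by
  rw [← gammaNorm_neg (k + 1 / 2 - σ) y, ← gammaNorm_neg _ (y - t), ← gammaNorm_neg _ (y + t)]
  unfold kernel gammaNorm
  rw [norm_mul, norm_mul, norm_div]
  push_cast
  ring_nf

lemma norm_sin_le (σ y : ℝ) :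
    ‖Complex.sin (Real.pi * (σ + y * Complex.I))‖ ≤ Real.exp (Real.pi * |y|) := by
  rw [Complex.sin]
  have e1 : ∀ z : ℂ, ‖Complex.exp z‖ = Real.exp z.re := Complex.norm_exp
  rw [norm_div, norm_mul, Complex.norm_I, mul_one]
  have h := norm_sub_le (Complex.exp (-(Real.pi * (σ + y * Complex.I)) * Complex.I))
    (Complex.exp (Real.pi * (σ + y * Complex.I) * Complex.I))
  rw [e1, e1] at h
  simp at h
  have h1 : Real.exp (Real.pi * y) ≤ Real.exp (Real.pi * |y|) :=
    Real.exp_le_exp.mpr (by gcongr; exact le_abs_self y)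
  have h2 : Real.exp (-(Real.pi * y)) ≤ Real.exp (Real.pi * |y|) :=
    Real.exp_le_exp.mpr (by nlinarith [neg_abs_le y, Real.pi_pos])
  simp
  linarith

lemma differentiableAt_kernel {k : ℕ} (t : ℝ) {w : ℂ} (h1 : 1 / 2 - (k : ℝ) < w.re)
    (h2 : w.re < 1 / 2) : DifferentiableAt ℂ (kernel k t) w := by
  have hk : (0 : ℝ) ≤ k := by positivity
  have hG : ∀ s : ℂ, 0 < s.re → DifferentiableAt ℂ Complex.Gamma s := fun s hs =>
    Complex.differentiableAt_Gamma s fun m hm => by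
      have := congrArg Complex.re hm
      simp at this
      have hm : (0 : ℝ) ≤ m := by positivity
      linarith
  unfold kernel
  refine DifferentiableAt.mul (DifferentiableAt.mul (DifferentiableAt.div ?_ ?_ ?_) ?_) ?_
  · exact (hG _ (by simp; linarith)).comp w (by fun_prop)
  · exact (hG _ (by simp; linarith)).comp w (by fun_prop)
  · exact Complex.Gamma_ne_zero_of_re_pos (by simp; linarith)
  · exact (hG _ (by simp; linarith)).comp w (by fun_prop)
  · exact (hG _ (by simp; linarith)).comp w (by fun_prop)

lemma differentiableAt_sinKernel {k : ℕ} (t : ℝ) {w : ℂ} (h1 : 1 / 2 - (k : ℝ) < w.re)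
    (h2 : w.re < 1 / 2) : DifferentiableAt ℂ (sinKernel k t) w :=
  (differentiableAt_kernel t h1 h2).mul (by fun_prop)

/-- The exponents of 1 + |y| are 2σ - 1 from the quotient and -σ from each remaining factor, so they
add up to -1 on every line. The constant depends on k and t, which is harmless: the bound only
serves to move contours. -/
theorem exists_norm_kernel_le {k : ℕ} (hk : 1 ≤ k) (t : ℝ) {σ₀ σ₁ : ℝ} (h₀ : 1 / 2 - (k : ℝ) < σ₀)
    (h₁ : σ₁ < 1 / 2) : ∃ C : ℝ, 0 < C ∧ ∀ σ ∈ Set.Icc σ₀ σ₁, ∀ y : ℝ,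
      ‖kernel k t (σ + y * Complex.I)‖ ≤ C * (1 + |y|)⁻¹ * Real.exp (-(Real.pi * |y|)) := by
  have hk' : (1 : ℝ) ≤ k := by exact_mod_cast hk
  obtain ⟨C₁, hC₁, H₁⟩ := exists_gammaNorm_le (a₀ := k - 1 / 2 + σ₀) (by linarith) (k - 1 / 2 + σ₁)
  obtain ⟨C₂, hC₂, H₂⟩ := exists_le_gammaNorm (k + 1 / 2 - σ₀)
  obtain ⟨C₃, hC₃, H₃⟩ := exists_gammaNorm_le (a₀ := 1 / 2 - σ₁) (by linarith) (1 / 2 - σ₀)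
  set P : ℝ := (1 + |t|) ^ (k : ℝ)
  refine ⟨C₁ * C₂ * (C₃ * P) * (C₃ * P), by positivity, ?_⟩
  intro σ hσ y
  obtain ⟨hσ0, hσ1⟩ := hσ
  rw [norm_kernel]
  have hy : 0 < 1 + |y| := by positivity
  have g1 := H₁ (k - 1 / 2 + σ) ⟨by linarith, by linarith⟩ y
  have g2 := H₂ (k + 1 / 2 - σ) ⟨by linarith, by linarith⟩ y
  have hs : |σ| ≤ k := abs_le.mpr ⟨by linarith, by linarith⟩
  have g3 : ∀ s : ℝ, |s| = |t| → gammaNorm (1 / 2 - σ) (y + s) ≤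
      C₃ * P * (1 + |y|) ^ (-σ) * Real.exp (-(Real.pi * |y + s|) / 2) := by
    intro s hst
    have h := H₃ (1 / 2 - σ) ⟨by linarith, by linarith⟩ (y + s)
    rw [show 1 / 2 - σ - 1 / 2 = -σ by ring] at h
    have h2 := one_add_abs_add_rpow_le y s (-σ)
    rw [abs_neg, hst] at h2
    have h3 : (1 + |t|) ^ |σ| ≤ P :=
      Real.rpow_le_rpow_of_exponent_le (by linarith [abs_nonneg t]) hs
    calc _ ≤ _ := h
      _ ≤ C₃ * (P * (1 + |y|) ^ (-σ)) * Real.exp (-(Real.pi * |y + s|) / 2) := by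
        gcongr
        exact h2.trans (by gcongr)
      _ = _ := by ring
  have g3a := g3 (-t) (abs_neg t)
  have g3b := g3 t rfl
  rw [← sub_eq_add_neg] at g3a
  have hd : 0 < gammaNorm (k + 1 / 2 - σ) y := gammaNorm_pos (by linarith) y
  have g12 : gammaNorm (k - 1 / 2 + σ) y / gammaNorm (k + 1 / 2 - σ) y ≤
      C₁ * C₂ * (1 + |y|) ^ (2 * σ - 1) := by
    rw [div_le_iff₀ hd]
    calc _ ≤ _ := g1
      _ = C₁ * (1 + |y|) ^ (2 * σ - 1) *
          ((1 + |y|) ^ (k + 1 / 2 - σ - 1 / 2) * Real.exp (-(Real.pi * |y|) / 2)) := by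
          rw [show (k - 1 / 2 + σ - 1 / 2 : ℝ) = (2 * σ - 1) + (k + 1 / 2 - σ - 1 / 2) by ring,
            Real.rpow_add hy]
          ring
      _ ≤ C₁ * (1 + |y|) ^ (2 * σ - 1) * (C₂ * gammaNorm (k + 1 / 2 - σ) y) := by gcongr
      _ = _ := by ring
  have hexp : Real.exp (-(Real.pi * |y - t|) / 2) * Real.exp (-(Real.pi * |y + t|) / 2) ≤
      Real.exp (-(Real.pi * |y|)) := by
    rw [← Real.exp_add, Real.exp_le_exp]
    have : |y - t| + |y + t| ≥ 2 * |y| := by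
      have := abs_add_le (y - t) (y + t)
      rw [show y - t + (y + t) = 2 * y by ring, abs_mul, abs_two] at this
      exact this
    nlinarith [Real.pi_pos]
  have hpow : (1 + |y|) ^ (2 * σ - 1) * (1 + |y|) ^ (-σ) * (1 + |y|) ^ (-σ) = (1 + |y|)⁻¹ := by
    rw [← Real.rpow_add hy, ← Real.rpow_add hy, ← Real.rpow_neg_one]
    congr 1; ring
  have n1 := (gammaNorm_pos (show 0 < 1 / 2 - σ by linarith) (y - t)).le
  have n2 := (gammaNorm_pos (show 0 < 1 / 2 - σ by linarith) (y + t)).le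
  calc _ ≤ C₁ * C₂ * (1 + |y|) ^ (2 * σ - 1) *
        (C₃ * P * (1 + |y|) ^ (-σ) * Real.exp (-(Real.pi * |y - t|) / 2)) *
        (C₃ * P * (1 + |y|) ^ (-σ) * Real.exp (-(Real.pi * |y + t|) / 2)) := by gcongr
    _ = C₁ * C₂ * (C₃ * P) * (C₃ * P) *
        ((1 + |y|) ^ (2 * σ - 1) * (1 + |y|) ^ (-σ) * (1 + |y|) ^ (-σ)) *
        (Real.exp (-(Real.pi * |y - t|) / 2) * Real.exp (-(Real.pi * |y + t|) / 2)) := by ring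
    _ ≤ _ := by rw [hpow]; gcongr

/-- The sine cancels the exponential decay exactly. What remains makes the horizontal sides of a
rectangle vanish, but does not give absolute convergence on a vertical line. -/
theorem exists_norm_sinKernel_le {k : ℕ} (hk : 1 ≤ k) (t : ℝ) {σ₀ σ₁ : ℝ}
    (h₀ : 1 / 2 - (k : ℝ) < σ₀) (h₁ : σ₁ < 1 / 2) : ∃ C : ℝ, 0 < C ∧ ∀ σ ∈ Set.Icc σ₀ σ₁, ∀ y : ℝ,
      ‖sinKernel k t (σ + y * Complex.I)‖ ≤ C * (1 + |y|)⁻¹ := by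
  obtain ⟨C, hC, H⟩ := exists_norm_kernel_le hk t h₀ h₁
  refine ⟨C, hC, fun σ hσ y => ?_⟩
  rw [sinKernel, norm_mul]
  calc _ ≤ C * (1 + |y|)⁻¹ * Real.exp (-(Real.pi * |y|)) * Real.exp (Real.pi * |y|) := by
        gcongr
        · exact H σ hσ y
        · exact norm_sin_le σ y
    _ = _ := by rw [mul_assoc, ← Real.exp_add]; simp

/-! ### Contour shifts and bounds of I₁, I₂ by absolute integrals -/

/-- Moving a symmetric vertical segment inside a strip of holomorphy in which `F` tends to `0`. -/
theorem tendsto_sub_vertical_integral {F : ℂ → ℂ} {σ₀ σ₁ : ℝ} {B : ℝ → ℝ}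
    (hF : ∀ w : ℂ, w.re ∈ Set.uIcc σ₀ σ₁ → DifferentiableAt ℂ F w)
    (hB : Tendsto B atTop (𝓝 0))
    (hFB : ∀ σ ∈ Set.uIcc σ₀ σ₁, ∀ y : ℝ, ‖F (σ + y * Complex.I)‖ ≤ B |y|) :
    Tendsto (fun R : ℝ => (∫ y in (-R)..R, F (σ₀ + y * Complex.I)) -
      ∫ y in (-R)..R, F (σ₁ + y * Complex.I)) atTop (𝓝 0) := by
  have hlim : Tendsto (fun R => 2 * (B R * |σ₁ - σ₀|)) atTop (𝓝 0) := by
    simpa using (hB.mul_const |σ₁ - σ₀|).const_mul 2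
  refine squeeze_zero_norm' ?_ hlim
  filter_upwards [eventually_ge_atTop 0] with R hR
  have h := Complex.integral_boundary_rect_eq_zero_of_differentiableOn F
    (σ₀ + (-R : ℝ) * Complex.I) (σ₁ + R * Complex.I)
    (fun w hw => (hF w (by simpa using hw.1)).differentiableWithinAt)
  have him (a b : ℝ) : (a + b * Complex.I : ℂ).im = b := by simp
  have hre (a b : ℝ) : (a + b * Complex.I : ℂ).re = a := by simp
  simp only [him, hre] at h
  have hside : ∀ c : ℝ, |c| = R → ‖∫ x in σ₀..σ₁, F (x + c * Complex.I)‖ ≤ B R * |σ₁ - σ₀| := by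
    intro c hc
    refine intervalIntegral.norm_integral_le_of_norm_le_const fun x hx => ?_
    rw [← hc]
    exact hFB x (Set.uIoc_subset_uIcc hx) c
  have h1 := hside (-R) (by rw [abs_neg, abs_of_nonneg hR])
  have h2 := hside R (abs_of_nonneg hR)
  -- Cauchy's theorem on the rectangle: the difference of the vertical sides equals, up to i, the
  -- difference of the horizontal ones.
  have h3 : Complex.I * ((∫ y in (-R)..R, F (σ₀ + y * Complex.I)) -
      ∫ y in (-R)..R, F (σ₁ + y * Complex.I)) =
      (∫ x in σ₀..σ₁, F (x + (-R : ℝ) * Complex.I)) - ∫ x in σ₀..σ₁, F (x + R * Complex.I) := by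
    simp only [smul_eq_mul] at h
    linear_combination -h
  have h4 := congrArg norm h3
  rw [norm_mul, Complex.norm_I, one_mul] at h4
  rw [h4]
  linarith [norm_sub_le (∫ x in σ₀..σ₁, F (x + (-R : ℝ) * Complex.I))
    (∫ x in σ₀..σ₁, F (x + R * Complex.I))]

/-- The substitution s = 2w halves the abscissa and turns 1/(2π) into 1/π. -/
lemma lineIntegral_eq {Δ : ℝ} {f F : ℂ → ℂ} {L : ℂ} (hf : ∀ s, f s = F (s / 2))
    (hL : Tendsto (fun R : ℝ => ∫ y in (-R)..R, F ((Δ / 2 : ℝ) + y * Complex.I)) atTop (𝓝 L)) :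
    lineIntegral Δ f = 1 / Real.pi * L := by
  unfold lineIntegral
  refine Tendsto.limUnder_eq ?_
  have h1 : ∀ R : ℝ, (∫ y in (-R)..R, f (Δ + y * Complex.I)) =
      2 * ∫ y in (-(R / 2))..(R / 2), F ((Δ / 2 : ℝ) + y * Complex.I) := by
    intro R
    have := intervalIntegral.integral_comp_div (a := -R) (b := R)
      (fun y : ℝ => F ((Δ / 2 : ℝ) + y * Complex.I)) (two_ne_zero)
    rw [neg_div] at this
    rw [Complex.real_smul] at this
    push_cast at this ⊢
    rw [← this]
    refine intervalIntegral.integral_congr fun y _ => ?_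
    simp only [hf]
    congr 1; ring
  simp_rw [h1]
  have h2 := (hL.comp (tendsto_id.atTop_div_const (two_pos (α := ℝ)))).const_mul
    (1 / (Real.pi : ℂ))
  refine h2.congr fun R => ?_
  simp only [Function.comp, id]
  have hpi : (Real.pi : ℂ) ≠ 0 := by exact_mod_cast Real.pi_ne_zero
  have alg : ∀ a : ℂ, 1 / (Real.pi : ℂ) * a = 1 / (2 * Real.pi) * (2 * a) := by
    intro a; field_simp
  exact alg _

lemma norm_ofReal_cpow {x : ℝ} (hx : 0 < x) (σ y : ℝ) :
    ‖(x : ℂ) ^ (σ + y * Complex.I : ℂ)‖ = x ^ σ := by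
  rw [Complex.norm_cpow_eq_rpow_re_of_pos hx]; simp

lemma differentiable_ofReal_cpow {x : ℝ} (hx : 0 < x) :
    Differentiable ℂ fun w : ℂ => (x : ℂ) ^ w := fun w =>
  (differentiableAt_id).const_cpow (Or.inl (by exact_mod_cast hx.ne'))

lemma exists_rpow_le_of_mem_uIcc {x : ℝ} (hx : 0 < x) (σ₀ σ₁ : ℝ) :
    ∃ C : ℝ, 0 < C ∧ ∀ σ ∈ Set.uIcc σ₀ σ₁, x ^ σ ≤ C := by
  obtain ⟨M, hM⟩ := (isCompact_uIcc (a := σ₀) (b := σ₁)).exists_bound_of_continuousOn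
    (f := fun σ : ℝ => x ^ σ)
    (fun σ _ => (Real.continuousAt_const_rpow hx.ne').continuousWithinAt)
  refine ⟨|M| + 1, by positivity, fun σ hσ => ?_⟩
  have := hM σ hσ
  rw [Real.norm_eq_abs] at this
  linarith [le_abs_self M, le_abs_self (x ^ σ)]

lemma tendsto_mul_inv_one_add (C : ℝ) :
    Tendsto (fun R : ℝ => C * (1 + R)⁻¹) atTop (𝓝 0) := by
  simpa using (tendsto_inv_atTop_zero.comp
    (tendsto_atTop_add_const_left atTop (1 : ℝ) tendsto_id)).const_mul C

lemma tendsto_sub_sinKernel {k : ℕ} (hk : 1 ≤ k) (t : ℝ) {x : ℝ} (hx : 0 < x) {σ₀ σ₁ : ℝ}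
    (h0 : 1 / 2 - (k : ℝ) < σ₀) (h0' : σ₀ < 1 / 2) (h1 : 1 / 2 - (k : ℝ) < σ₁) (h1' : σ₁ < 1 / 2) :
    Tendsto (fun R : ℝ =>
      (∫ y in (-R)..R, sinKernel k t (σ₀ + y * Complex.I) * (x : ℂ) ^ (σ₀ + y * Complex.I)) -
      ∫ y in (-R)..R, sinKernel k t (σ₁ + y * Complex.I) * (x : ℂ) ^ (σ₁ + y * Complex.I))
      atTop (𝓝 0) := by
  obtain ⟨C, hC, H⟩ := exists_norm_sinKernel_le hk t (σ₀ := min σ₀ σ₁) (σ₁ := max σ₀ σ₁)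
    (lt_min h0 h1) (max_lt h0' h1')
  obtain ⟨M, hM, HM⟩ := exists_rpow_le_of_mem_uIcc hx σ₀ σ₁
  refine tendsto_sub_vertical_integral
    (F := fun w => sinKernel k t w * (x : ℂ) ^ w) (B := fun R => C * M * (1 + R)⁻¹)
    (fun w hw => ?_) (tendsto_mul_inv_one_add _) (fun σ hσ y => ?_)
  · have := hw.1
    have := hw.2
    exact (differentiableAt_sinKernel t (lt_of_lt_of_le (lt_min h0 h1) hw.1)
      (lt_of_le_of_lt hw.2 (max_lt h0' h1'))).mul (differentiable_ofReal_cpow hx w)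
  · rw [norm_mul, norm_ofReal_cpow hx]
    calc _ ≤ C * (1 + |y|)⁻¹ * M := by
          gcongr
          · exact H σ hσ y
          · exact HM σ hσ
      _ = _ := by ring

lemma tendsto_sub_kernel {k : ℕ} (hk : 1 ≤ k) (t : ℝ) {x : ℝ} (hx : 0 < x) {σ₀ σ₁ : ℝ}
    (h0 : 1 / 2 - (k : ℝ) < σ₀) (h0' : σ₀ < 1 / 2) (h1 : 1 / 2 - (k : ℝ) < σ₁) (h1' : σ₁ < 1 / 2) :
    Tendsto (fun R : ℝ =>
      (∫ y in (-R)..R, kernel k t (σ₀ + y * Complex.I) * (x : ℂ) ^ (σ₀ + y * Complex.I)) -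
      ∫ y in (-R)..R, kernel k t (σ₁ + y * Complex.I) * (x : ℂ) ^ (σ₁ + y * Complex.I))
      atTop (𝓝 0) := by
  obtain ⟨C, hC, H⟩ := exists_norm_kernel_le hk t (σ₀ := min σ₀ σ₁) (σ₁ := max σ₀ σ₁)
    (lt_min h0 h1) (max_lt h0' h1')
  obtain ⟨M, hM, HM⟩ := exists_rpow_le_of_mem_uIcc hx σ₀ σ₁
  refine tendsto_sub_vertical_integral
    (F := fun w => kernel k t w * (x : ℂ) ^ w) (B := fun R => C * M * (1 + R)⁻¹)
    (fun w hw => ?_) (tendsto_mul_inv_one_add _) (fun σ hσ y => ?_)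
  · exact (differentiableAt_kernel t (lt_of_lt_of_le (lt_min h0 h1) hw.1)
      (lt_of_le_of_lt hw.2 (max_lt h0' h1'))).mul (differentiable_ofReal_cpow hx w)
  · rw [norm_mul, norm_ofReal_cpow hx]
    have hexp : Real.exp (-(Real.pi * |y|)) ≤ 1 :=
      Real.exp_le_one_iff.mpr (by have := Real.pi_pos; have := abs_nonneg y; nlinarith)
    calc _ ≤ C * (1 + |y|)⁻¹ * 1 * M := by
          gcongr
          · exact (H σ hσ y).trans (by gcongr)
          · exact HM σ hσ
      _ = _ := by ring

lemma norm_integral_mul_cpow_le {f : ℂ → ℂ} {x σ : ℝ} (hx : 0 < x) {g : ℝ → ℝ}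
    (hg : Integrable g) (hb : ∀ y : ℝ, ‖f (σ + y * Complex.I)‖ ≤ g y) :
    ‖∫ y : ℝ, f (σ + y * Complex.I) * (x : ℂ) ^ (σ + y * Complex.I : ℂ)‖ ≤ x ^ σ * ∫ y, g y := by
  rw [← integral_const_mul]
  refine norm_integral_le_of_norm_le (hg.const_mul _) (Eventually.of_forall fun y => ?_)
  rw [norm_mul, norm_ofReal_cpow hx, mul_comm]
  have := hb y
  gcongr

lemma integrable_mul_cpow {f : ℂ → ℂ} {x σ : ℝ} (hx : 0 < x) {g : ℝ → ℝ}
    (hg : Integrable g) (hb : ∀ y : ℝ, ‖f (σ + y * Complex.I)‖ ≤ g y)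
    (hf : ∀ w : ℂ, w.re = σ → DifferentiableAt ℂ f w) :
    Integrable fun y : ℝ => f (σ + y * Complex.I) * (x : ℂ) ^ (σ + y * Complex.I : ℂ) := by
  refine (hg.const_mul (x ^ σ)).mono' ?_ (Eventually.of_forall fun y => ?_)
  · refine Continuous.aestronglyMeasurable ?_
    rw [continuous_iff_continuousAt]
    intro y
    have h1 : ContinuousAt (fun w : ℂ => f w * (x : ℂ) ^ w) (σ + y * Complex.I) :=
      ((hf _ (by simp)).mul (differentiable_ofReal_cpow hx _)).continuousAt
    exact h1.comp (f := fun y : ℝ => (σ + y * Complex.I : ℂ)) (by fun_prop)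
  · rw [norm_mul, norm_ofReal_cpow hx, mul_comm]
    have := hb y
    gcongr

/-- The defining line is Re w = -k/2. Any σ in the strip may replace it, so the best σ can be chosen
according to the size of x. -/
theorem norm_I₂_le {k : ℕ} (hk : 2 ≤ k) (t : ℝ) {x : ℝ} (hx : 0 < x) {σ : ℝ}
    (h1 : 1 / 2 - (k : ℝ) < σ) (h2 : σ < 1 / 2) {g : ℝ → ℝ} (hg : Integrable g)
    (hb : ∀ y : ℝ, ‖kernel k t (σ + y * Complex.I)‖ ≤ g y) :
    ‖I₂ k 0 (t * Complex.I) x‖ ≤ x ^ σ * ∫ y, g y := by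
  have hk' : (2 : ℝ) ≤ k := by exact_mod_cast hk
  set L := ∫ y : ℝ, kernel k t (σ + y * Complex.I) * (x : ℂ) ^ (σ + y * Complex.I : ℂ) with hL
  have hLn : ‖L‖ ≤ x ^ σ * ∫ y, g y := norm_integral_mul_cpow_le hx hg hb
  have hI := integrable_mul_cpow hx hg hb
    fun w hw => differentiableAt_kernel t (by rw [hw]; exact h1) (by rw [hw]; exact h2)
  have hT := (tendsto_sub_kernel (k := k) (by lia) t hx (σ₀ := -k / 2) (σ₁ := σ) (by linarith)
    (by linarith) h1 h2).add
    (intervalIntegral_tendsto_integral hI tendsto_neg_atTop_atBot tendsto_id)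
  rw [zero_add] at hT
  have hab : abscissa k 0 = -k := by simp [abscissa]
  have heq : I₂ k 0 (t * Complex.I) x = 1 / Real.pi * L := by
    unfold I₂
    rw [hab]
    refine lineIntegral_eq (F := fun w => kernel k t w * (x : ℂ) ^ w) (fun s => ?_) ?_
    · simp only [gammaKernel, kernel, sub_zero]
    · refine hT.congr fun R => ?_
      simp
  rw [heq, norm_mul]
  have : ‖(1 / Real.pi : ℂ)‖ ≤ 1 := by
    rw [norm_div, norm_one, Complex.norm_real, Real.norm_of_nonneg Real.pi_pos.le,
      div_le_one Real.pi_pos]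
    linarith [Real.pi_gt_three]
  nlinarith [norm_nonneg L]

/-- The integral J over Re w = -k/2 is moved once to σ and once to σ - 1, giving (1 - x) J = ∫_σ - x
∫_(σ-1). Since x · x^(w-1) = x^w, the right side is one integral of K(w) - K(w - 1). The lower bound
3/2 - k on σ keeps σ - 1 in the strip. -/
theorem norm_I₁_le {k : ℕ} (hk : 2 ≤ k) (t : ℝ) {x : ℝ} (hx : 0 < x) (hx1 : x ≠ 1) {σ : ℝ}
    (h1 : 3 / 2 - (k : ℝ) < σ) (h2 : σ < 1 / 2) {g : ℝ → ℝ} (hg : Integrable g)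
    (hb : ∀ y : ℝ,
      ‖sinKernel k t (σ + y * Complex.I) - sinKernel k t (σ + y * Complex.I - 1)‖ ≤ g y) :
    |1 - x| * ‖I₁ k 0 (t * Complex.I) x‖ ≤ x ^ σ * ∫ y, g y := by
  have hk' : (2 : ℝ) ≤ k := by exact_mod_cast hk
  set D : ℂ → ℂ := fun w => sinKernel k t w - sinKernel k t (w - 1) with hD
  set L := ∫ y : ℝ, D (σ + y * Complex.I) * (x : ℂ) ^ (σ + y * Complex.I : ℂ) with hL
  have hLn : ‖L‖ ≤ x ^ σ * ∫ y, g y := norm_integral_mul_cpow_le hx hg hb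
  have hDd : ∀ w : ℂ, w.re = σ → DifferentiableAt ℂ D w := by
    intro w hw
    refine (differentiableAt_sinKernel t (by rw [hw]; linarith) (by rw [hw]; exact h2)).sub ?_
    exact (differentiableAt_sinKernel (k := k) t (w := w - 1) (by simp; linarith)
      (by simp; linarith)).comp w (f := fun w => w - 1) (by fun_prop)
  have hI := integrable_mul_cpow hx hg hb hDd
  have hT := intervalIntegral_tendsto_integral hI tendsto_neg_atTop_atBot tendsto_id
  have hxC : (1 - x : ℂ) ≠ 0 := by
    intro h
    exact hx1 (by exact_mod_cast (sub_eq_zero.mp h).symm)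
  have hA := tendsto_sub_sinKernel (k := k) (by lia) t hx (σ₀ := -k / 2) (σ₁ := σ) (by linarith)
    (by linarith) (by linarith) h2
  have hB := tendsto_sub_sinKernel (k := k) (by lia) t hx (σ₀ := -k / 2) (σ₁ := σ - 1) (by linarith)
    (by linarith) (by linarith) (by linarith)
  have hlim := ((hA.sub (hB.const_mul (x : ℂ))).add hT).const_mul ((1 - x : ℂ)⁻¹)
  have hcont : ∀ c : ℝ, 1 / 2 - (k : ℝ) < c → c < 1 / 2 → ∀ R : ℝ, IntervalIntegrable
      (fun y : ℝ => sinKernel k t (c + y * Complex.I) * (x : ℂ) ^ (c + y * Complex.I : ℂ))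
      volume (-R) R := by
    intro c hc hc' R
    refine Continuous.intervalIntegrable ?_ _ _
    rw [continuous_iff_continuousAt]
    intro y
    have h1 : ContinuousAt (fun w : ℂ => sinKernel k t w * (x : ℂ) ^ w) (c + y * Complex.I) :=
      ((differentiableAt_sinKernel t (by simpa using hc) (by simpa using hc')).mul
        (differentiable_ofReal_cpow hx _)).continuousAt
    exact h1.comp (f := fun y : ℝ => (c + y * Complex.I : ℂ)) (by fun_prop)
  have hab : abscissa k 0 = -k := by simp [abscissa]
  have heq : I₁ k 0 (t * Complex.I) x = 1 / Real.pi * ((1 - x : ℂ)⁻¹ * L) := by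
    unfold I₁
    rw [hab]
    refine lineIntegral_eq (F := fun w => sinKernel k t w * (x : ℂ) ^ w) (fun s => ?_) ?_
    · simp only [gammaKernel, kernel, sinKernel, sub_zero, zero_add]
    · rw [mul_zero, sub_zero, zero_add] at hlim
      refine hlim.congr fun R => ?_
      have hshift : (∫ y in (-R)..R, D (σ + y * Complex.I) * (x : ℂ) ^ (σ + y * Complex.I : ℂ)) =
          (∫ y in (-R)..R,
            sinKernel k t (σ + y * Complex.I) * (x : ℂ) ^ (σ + y * Complex.I : ℂ)) -
          x * ∫ y in (-R)..R, sinKernel k t ((σ - 1 : ℝ) + y * Complex.I) *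
            (x : ℂ) ^ ((σ - 1 : ℝ) + y * Complex.I : ℂ) := by
        rw [← intervalIntegral.integral_const_mul, ← intervalIntegral.integral_sub
          (hcont σ (by linarith) h2 R) ((hcont (σ - 1) (by linarith) (by linarith) R).const_mul _)]
        refine intervalIntegral.integral_congr fun y _ => ?_
        simp only [hD]
        have e1 : ((σ - 1 : ℝ) + y * Complex.I : ℂ) = σ + y * Complex.I - 1 := by
          push_cast; ring
        have hxc : (x : ℂ) ≠ 0 := by exact_mod_cast hx.ne'
        rw [e1, Complex.cpow_sub _ _ hxc, Complex.cpow_one]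
        field_simp
      simp only [id]
      rw [hshift]
      -- Here a, b, c are the truncated integrals over Re w = -k/2, σ, σ - 1; this identity holds
      -- for each R, before any limit is taken.
      have alg : ∀ a b c : ℂ, (1 - x : ℂ)⁻¹ * (a - b - x * (a - c) + (b - x * c)) = a := by
        intro a b c
        field_simp
        ring
      exact alg _ _ _
  rw [heq, norm_mul, norm_mul, norm_inv]
  have e : ‖(1 - x : ℂ)‖ = |1 - x| := by
    rw [← Complex.ofReal_one, ← Complex.ofReal_sub, Complex.norm_real, Real.norm_eq_abs]
  have hpos : 0 < |1 - x| := abs_pos.mpr (sub_ne_zero.mpr hx1.symm)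
  have : ‖(1 / Real.pi : ℂ)‖ ≤ 1 := by
    rw [norm_div, norm_one, Complex.norm_real, Real.norm_of_nonneg Real.pi_pos.le,
      div_le_one Real.pi_pos]
    linarith [Real.pi_gt_three]
  rw [e]
  calc _ = ‖(1 / Real.pi : ℂ)‖ * ‖L‖ := by field_simp
    _ ≤ ‖L‖ := by nlinarith [norm_nonneg L]
    _ ≤ _ := hLn

/-! ### Kernel estimates uniform in k and t on Re w = 1/2 - δ and Re w = -1/2 - δ -/

lemma abs_sub_add_abs_add (y t : ℝ) : |y - t| + |y + t| = 2 * max |y| |t| := by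
  rcases abs_cases y with ⟨h1, _⟩ | ⟨h1, _⟩ <;> rcases abs_cases t with ⟨h2, _⟩ | ⟨h2, _⟩ <;>
  rcases abs_cases (y - t) with ⟨h3, _⟩ | ⟨h3, _⟩ <;>
  rcases abs_cases (y + t) with ⟨h4, _⟩ | ⟨h4, _⟩ <;>
  rw [h1, h2, h3, h4] <;> rcases max_cases y t with _ | _ <;> grind

lemma one_add_abs_mul_le (y t : ℝ) :
    (1 + |y - t|) * (1 + |y + t|) ≤ (1 + max |y| |t|) ^ 2 := by
  have h1 := abs_sub_add_abs_add y t
  nlinarith [sq_nonneg (|y - t| - |y + t|), sq_nonneg (|y - t| + |y + t|)]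

lemma one_add_abs_le_mul (y t : ℝ) : 1 + |y| ≤ (1 + |y - t|) * (1 + |y + t|) := by
  have h1 := abs_sub_add_abs_add y t
  have h2 := le_max_left |y| |t|
  nlinarith [mul_nonneg (abs_nonneg (y - t)) (abs_nonneg (y + t)), abs_nonneg y]

lemma one_add_sq_le_two_mul_exp {s : ℝ} (hs : 0 ≤ s) : (1 + s) ^ 2 ≤ 2 * Real.exp s := by
  have := Real.quadratic_le_exp_of_nonneg hs
  nlinarith

/-- The exponents π|y - t|/2 and π|y + t|/2 add up to π max(|y|, |t|). The exponential is therefore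
constant for |y| ≤ |t|, where it exactly compensates cosh(πt). -/
lemma exists_gammaNorm_mul_le {a : ℝ} (ha : 0 < a) :
    ∃ C : ℝ, 0 < C ∧ ∀ y t : ℝ, gammaNorm a (y - t) * gammaNorm a (y + t) ≤
      C * ((1 + |y - t|) * (1 + |y + t|)) ^ (a - 1 / 2) * Real.exp (-(Real.pi * max |y| |t|)) := by
  obtain ⟨C, hC, H⟩ := exists_gammaNorm_le ha a
  refine ⟨C * C, by positivity, fun y t => ?_⟩
  have h1 := H a ⟨le_rfl, le_rfl⟩ (y - t)
  have h2 := H a ⟨le_rfl, le_rfl⟩ (y + t)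
  have n2 := (gammaNorm_pos ha (y + t)).le
  calc _ ≤ (C * (1 + |y - t|) ^ (a - 1 / 2) * Real.exp (-(Real.pi * |y - t|) / 2)) *
        (C * (1 + |y + t|) ^ (a - 1 / 2) * Real.exp (-(Real.pi * |y + t|) / 2)) := by gcongr
    _ = C * C * ((1 + |y - t|) ^ (a - 1 / 2) * (1 + |y + t|) ^ (a - 1 / 2)) *
        (Real.exp (-(Real.pi * |y - t|) / 2) * Real.exp (-(Real.pi * |y + t|) / 2)) := by ring
    _ = _ := by
        rw [← Real.mul_rpow (by positivity) (by positivity), ← Real.exp_add]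
        congr 2
        linear_combination (-Real.pi / 2) * abs_sub_add_abs_add y t

/-- The plateau |y| ≤ |t| with exponential tails is dominated by a Cauchy profile of width T = 3 +
|t|, whose integral is a multiple of T. -/
lemma exp_neg_max_sub_le (y t : ℝ) :
    Real.exp (-(max |y| |t| - |t|)) ≤ 2 * (1 + (y / (3 + |t|)) ^ 2)⁻¹ := by
  set s := max |y| |t| - |t| with hs
  have hs0 : 0 ≤ s := sub_nonneg.mpr (le_max_right _ _)
  have hy : |y| ≤ |t| + s := by rw [hs]; linarith [le_max_left |y| |t|]
  have hT : 0 < 3 + |t| := by positivity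
  have h1 : (y / (3 + |t|)) ^ 2 ≤ (1 + s) ^ 2 := by
    rw [← sq_abs, abs_div, abs_of_pos hT]
    gcongr
    rw [div_le_iff₀ hT]
    nlinarith [abs_nonneg t]
  rw [Real.exp_neg, ← div_eq_mul_inv, inv_le_comm₀ (Real.exp_pos _) (by positivity), inv_div,
    div_le_iff₀ two_pos]
  have := Real.quadratic_le_exp_of_nonneg hs0
  nlinarith

lemma inv_one_add_div_sq_le {S : ℝ} (hS : 1 ≤ S) (y : ℝ) :
    (1 + (y / S) ^ 2)⁻¹ ≤ S ^ 2 * (1 + y ^ 2)⁻¹ := by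
  rw [← div_eq_mul_inv, inv_le_comm₀ (by positivity) (by positivity), inv_div,
    div_le_iff₀ (by positivity), add_mul, div_pow, div_mul_cancel₀ _ (by positivity)]
  nlinarith

/-- Γ is increasing from 2 on, but k - δ may lie below 2. The comparison is made one unit to the
right and brought back by the functional equation. -/
lemma Gamma_ratio_le_two {k δ : ℝ} (hk : 2 ≤ k) (hδ : 0 ≤ δ) (hδ' : δ ≤ 1 / 4) :
    Real.Gamma (k - δ) / Real.Gamma (k + δ) ≤ 2 := by
  rw [div_le_iff₀ (Real.Gamma_pos_of_pos (by linarith))]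
  have h := Real.Gamma_strictMonoOn_Ici.monotoneOn (a := k - δ + 1) (b := k + δ + 1)
    (by simp; linarith) (by simp; linarith) (by linarith)
  rw [Real.Gamma_add_one (by linarith), Real.Gamma_add_one (by linarith)] at h
  have h1 := Real.Gamma_pos_of_pos (show 0 < k + δ by linarith)
  have h2 := Real.Gamma_pos_of_pos (show 0 < k - δ by linarith)
  have h3 : k + δ ≤ 2 * (k - δ) := by linarith
  have h4 : (k - δ) * Real.Gamma (k - δ) ≤ (k - δ) * (2 * Real.Gamma (k + δ)) := by nlinarith
  exact le_of_mul_le_mul_left h4 (by linarith)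

/-- The kernel on `Re w = 1/2 - δ`. -/
lemma exists_norm_kernel_right_le {δ : ℝ} (hδ : 0 < δ) (hδ' : δ ≤ 1 / 4) :
    ∃ C : ℝ, 0 < C ∧ ∀ k : ℕ, 2 ≤ k → ∀ t y : ℝ,
      ‖kernel k t ((1 / 2 - δ : ℝ) + y * Complex.I)‖ ≤
        C * ((1 + |y - t|) * (1 + |y + t|)) ^ (δ - 1 / 2) *
          Real.exp (-(Real.pi * max |y| |t|)) := by
  obtain ⟨C, hC, H⟩ := exists_gammaNorm_mul_le hδ
  refine ⟨2 * C, by positivity, fun k hk t y => ?_⟩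
  have hk' : (2 : ℝ) ≤ k := by exact_mod_cast hk
  rw [norm_kernel, show (k - 1 / 2 + (1 / 2 - δ) : ℝ) = k - δ by ring,
    show (k + 1 / 2 - (1 / 2 - δ) : ℝ) = k + δ by ring, show 1 / 2 - (1 / 2 - δ) = δ by ring,
    mul_assoc, mul_assoc 2, mul_assoc 2]
  have h1 : gammaNorm (k - δ) y / gammaNorm (k + δ) y ≤ 2 := by
    have hp := gammaNorm_pos (show 0 < k + δ by linarith) y
    rw [div_le_iff₀ hp]
    have := gammaNorm_le_of_le (show 0 < k - δ by linarith) (show k - δ ≤ k + δ by linarith) y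
    have := mul_le_mul_of_nonneg_right (Gamma_ratio_le_two hk' hδ.le hδ') hp.le
    linarith
  have h2 := H y t
  have n1 := (gammaNorm_pos hδ (y - t)).le
  have n2 := (gammaNorm_pos hδ (y + t)).le
  gcongr

lemma exists_cosh_mul_norm_kernel_right_le {δ : ℝ} (hδ : 0 < δ) (hδ' : δ ≤ 1 / 4) :
    ∃ C : ℝ, 0 < C ∧ ∀ k : ℕ, 2 ≤ k → ∀ t y : ℝ,
      Real.cosh (Real.pi * t) * ‖kernel k t ((1 / 2 - δ : ℝ) + y * Complex.I)‖ ≤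
        C * (1 + (y / (3 + |t|)) ^ 2)⁻¹ := by
  obtain ⟨C, hC, H⟩ := exists_norm_kernel_right_le hδ hδ'
  refine ⟨2 * C, by positivity, fun k hk t y => ?_⟩
  have hc := cosh_le_exp_abs (Real.pi * t)
  rw [abs_mul, abs_of_pos Real.pi_pos] at hc
  have hP : ((1 + |y - t|) * (1 + |y + t|)) ^ (δ - 1 / 2) ≤ 1 :=
    Real.rpow_le_one_of_one_le_of_nonpos
      (by linarith [one_add_abs_le_mul y t, abs_nonneg y]) (by linarith)
  have hs0 : 0 ≤ max |y| |t| - |t| := sub_nonneg.mpr (le_max_right _ _)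
  calc _ ≤ Real.exp (Real.pi * |t|) * (C * 1 * Real.exp (-(Real.pi * max |y| |t|))) := by
        gcongr
        exact (H k hk t y).trans (by gcongr)
    _ = C * Real.exp (-(Real.pi * (max |y| |t| - |t|))) := by
        rw [show -(Real.pi * (max |y| |t| - |t|)) = Real.pi * |t| + -(Real.pi * max |y| |t|) by ring,
          Real.exp_add]
        ring
    _ ≤ C * Real.exp (-(max |y| |t| - |t|)) := by
        gcongr
        nlinarith [Real.pi_gt_three]
    _ ≤ C * (2 * (1 + (y / (3 + |t|)) ^ 2)⁻¹) := by
        gcongr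
        exact exp_neg_max_sub_le y t
    _ = _ := by ring

/-- The kernel on `Re w = -1/2 - δ`. -/
lemma exists_cosh_mul_norm_kernel_left_le {δ : ℝ} (hδ : 0 < δ) (hδ' : δ ≤ 1 / 4) :
    ∃ C : ℝ, 0 < C ∧ ∀ k : ℕ, 2 ≤ k → ∀ t y : ℝ,
      Real.cosh (Real.pi * t) * ‖kernel k t ((-1 / 2 - δ : ℝ) + y * Complex.I)‖ ≤
        C * (3 + |t|) ^ (1 + 2 * δ) * (1 + y ^ 2)⁻¹ := by
  obtain ⟨C, hC, H⟩ := exists_gammaNorm_mul_le (show 0 < 1 + δ by linarith)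
  refine ⟨2 * C * 2, by positivity, fun k hk t y => ?_⟩
  have hk' : (2 : ℝ) ≤ k := by exact_mod_cast hk
  rw [norm_kernel, show (k - 1 / 2 + (-1 / 2 - δ) : ℝ) = k - 1 - δ by ring,
    show (k + 1 / 2 - (-1 / 2 - δ) : ℝ) = k + 1 + δ by ring,
    show 1 / 2 - (-1 / 2 - δ) = 1 + δ by ring]
  have hc := cosh_le_exp_abs (Real.pi * t)
  rw [abs_mul, abs_of_pos Real.pi_pos] at hc
  -- The real parts differ by 2 + 2δ. Two steps of the functional equation produce the decay 1/(1 +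
  -- y²), and monotonicity in the real part covers the remaining 2δ.
  have h1 : gammaNorm (k - 1 - δ) y / gammaNorm (k + 1 + δ) y ≤ 2 * (1 + y ^ 2)⁻¹ := by
    have hp := gammaNorm_pos (show 0 < k + 1 + δ by linarith) y
    have hp0 := gammaNorm_pos (show 0 < k - 1 - δ by linarith) y
    have e1 := gammaNorm_add_one (show 0 < k - 1 - δ by linarith) y
    have e2 := gammaNorm_add_one (show 0 < k - δ by linarith) y
    rw [show (k - 1 - δ + 1 : ℝ) = k - δ by ring] at e1
    have hm := gammaNorm_le_of_le (show 0 < k - δ + 1 by linarith)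
      (show k - δ + 1 ≤ k + 1 + δ by linarith) y
    have hΓ : Real.Gamma (k - δ + 1) / Real.Gamma (k + 1 + δ) ≤ 1 := by
      rw [div_le_one (Real.Gamma_pos_of_pos (by linarith))]
      exact Real.Gamma_strictMonoOn_Ici.monotoneOn (by simp; linarith) (by simp; linarith)
        (by linarith)
    have hm2 : gammaNorm (k - δ + 1) y ≤ gammaNorm (k + 1 + δ) y :=
      hm.trans (mul_le_of_le_one_left hp.le hΓ)
    rw [e2, e1, ← mul_assoc] at hm2
    have hsq : (1 + y ^ 2) / 2 ≤ √((k - δ) ^ 2 + y ^ 2) * √((k - 1 - δ) ^ 2 + y ^ 2) := by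
      rw [← Real.sqrt_mul (by positivity)]
      refine Real.le_sqrt_of_sq_le ?_
      have a1 : 1 + y ^ 2 ≤ (k - δ) ^ 2 + y ^ 2 := by nlinarith
      have a2 : 1 / 2 + y ^ 2 ≤ (k - 1 - δ) ^ 2 + y ^ 2 := by nlinarith
      calc ((1 + y ^ 2) / 2) ^ 2 ≤ (1 + y ^ 2) * (1 / 2 + y ^ 2) := by nlinarith [sq_nonneg y]
        _ ≤ _ := by gcongr
    rw [div_le_iff₀ hp, mul_assoc, mul_comm _ (gammaNorm _ _), ← div_eq_mul_inv, ← mul_div_assoc,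
      le_div_iff₀ (by positivity)]
    nlinarith [mul_le_mul_of_nonneg_right hsq hp0.le]
  have h2 := H y t
  set m := max |y| |t| with hm
  have hs0 : 0 ≤ m - |t| := sub_nonneg.mpr (le_max_right _ _)
  have hT : 0 < 3 + |t| := by positivity
  have hm0 : 0 ≤ m := (abs_nonneg y).trans (le_max_left _ _)
  -- Writing 1 + m ≤ T (1 + (m - |t|)) isolates the power of T; the excess m - |t| is absorbed by
  -- the exponential in `hexp`.
  have hP : ((1 + |y - t|) * (1 + |y + t|)) ^ (1 + δ - 1 / 2) ≤
      (3 + |t|) ^ (1 + 2 * δ) * (1 + (m - |t|)) ^ 2 := by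
    calc _ ≤ ((1 + m) ^ 2) ^ (1 + δ - 1 / 2) := by
          gcongr
          · linarith
          · exact one_add_abs_mul_le y t
      _ = (1 + m) ^ (1 + 2 * δ) := by
          rw [← Real.rpow_natCast, ← Real.rpow_mul (by positivity)]
          congr 1; push_cast; ring
      _ ≤ ((3 + |t|) * (1 + (m - |t|))) ^ (1 + 2 * δ) := by
          gcongr
          nlinarith [abs_nonneg t]
      _ = (3 + |t|) ^ (1 + 2 * δ) * (1 + (m - |t|)) ^ (1 + 2 * δ) :=
          Real.mul_rpow (by positivity) (by positivity)
      _ ≤ _ := by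
          gcongr
          rw [← Real.rpow_natCast]
          exact Real.rpow_le_rpow_of_exponent_le (by linarith) (by push_cast; linarith)
  have n1 := (gammaNorm_pos (show 0 < 1 + δ by linarith) (y - t)).le
  have n2 := (gammaNorm_pos (show 0 < 1 + δ by linarith) (y + t)).le
  have n0 := (div_pos (gammaNorm_pos (show 0 < k - 1 - δ by linarith) y)
    (gammaNorm_pos (show 0 < k + 1 + δ by linarith) y)).le
  have hexp : Real.exp (Real.pi * |t|) * Real.exp (-(Real.pi * m)) * (1 + (m - |t|)) ^ 2 ≤ 2 := by
    rw [← Real.exp_add]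
    have e1 : Real.exp (Real.pi * |t| + -(Real.pi * m)) ≤ Real.exp (-(m - |t|)) :=
      Real.exp_le_exp.mpr (by nlinarith [Real.pi_gt_three])
    calc _ ≤ Real.exp (-(m - |t|)) * (2 * Real.exp (m - |t|)) := by
          gcongr
          exact one_add_sq_le_two_mul_exp hs0
      _ = 2 := by rw [Real.exp_neg]; field_simp
  calc _ = Real.cosh (Real.pi * t) * ((gammaNorm (k - 1 - δ) y / gammaNorm (k + 1 + δ) y) *
        (gammaNorm (1 + δ) (y - t) * gammaNorm (1 + δ) (y + t))) := by ring
    _ ≤ Real.exp (Real.pi * |t|) * ((2 * (1 + y ^ 2)⁻¹) *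
        (C * ((3 + |t|) ^ (1 + 2 * δ) * (1 + (m - |t|)) ^ 2) * Real.exp (-(Real.pi * m)))) :=
        mul_le_mul hc (mul_le_mul h1 (h2.trans (by gcongr)) (by positivity) (by positivity))
          (by positivity) (by positivity)
    _ = 2 * C * (3 + |t|) ^ (1 + 2 * δ) * (1 + y ^ 2)⁻¹ *
        (Real.exp (Real.pi * |t|) * Real.exp (-(Real.pi * m)) * (1 + (m - |t|)) ^ 2) := by ring
    _ ≤ 2 * C * (3 + |t|) ^ (1 + 2 * δ) * (1 + y ^ 2)⁻¹ * 2 := by gcongr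
    _ = _ := by ring

/-! ### The difference of the sine kernel under w ↦ w - 1 -/

/-- Each of the four Γ-factors changes by one linear factor, and sin(π(w - 1)) = -sin(πw) supplies
the sign. -/
lemma sinKernel_sub_one_mul {k : ℕ} (t : ℝ) {w : ℂ} (h1 : 3 / 2 - (k : ℝ) < w.re)
    (h2 : w.re < 1 / 2) :
    sinKernel k t (w - 1) * ((k - 3 / 2 + w) * (k + 1 / 2 - w)) =
      -(sinKernel k t w * ((1 / 2 - w) ^ 2 + t ^ 2)) := by
  have hk : (0 : ℝ) ≤ k := by positivity
  have ne : ∀ s : ℂ, 0 < s.re → s ≠ 0 := by rintro s hs rfl; simp at hs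
  have a1 : Complex.Gamma (k - 1 / 2 + w) = (k - 3 / 2 + w) * Complex.Gamma (k - 3 / 2 + w) := by
    rw [← Complex.Gamma_add_one _ (ne _ (by simp; linarith))]; ring_nf
  have a2 : Complex.Gamma (k + 3 / 2 - w) = (k + 1 / 2 - w) * Complex.Gamma (k + 1 / 2 - w) := by
    rw [← Complex.Gamma_add_one _ (ne _ (by simp; linarith))]; ring_nf
  have a3 : Complex.Gamma (3 / 2 + t * Complex.I - w) =
      (1 / 2 + t * Complex.I - w) * Complex.Gamma (1 / 2 + t * Complex.I - w) := by
    rw [← Complex.Gamma_add_one _ (ne _ (by simp; linarith))]; ring_nf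
  have a4 : Complex.Gamma (3 / 2 - t * Complex.I - w) =
      (1 / 2 - t * Complex.I - w) * Complex.Gamma (1 / 2 - t * Complex.I - w) := by
    rw [← Complex.Gamma_add_one _ (ne _ (by simp; linarith))]; ring_nf
  have n2 : Complex.Gamma (k + 1 / 2 - w) ≠ 0 :=
    Complex.Gamma_ne_zero_of_re_pos (by simp; linarith)
  have n3 : (k + 1 / 2 - w : ℂ) ≠ 0 := ne _ (by simp; linarith)
  have hs : Complex.sin (Real.pi * (w - 1)) = -Complex.sin (Real.pi * w) := by
    rw [mul_sub, mul_one, Complex.sin_sub_pi]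
  have hI : ((1 / 2 - w) ^ 2 + t ^ 2 : ℂ) =
      (1 / 2 + t * Complex.I - w) * (1 / 2 - t * Complex.I - w) := by
    linear_combination (t : ℂ) ^ 2 * Complex.I_sq
  unfold sinKernel kernel
  rw [hs, hI, show (k - 1 / 2 + (w - 1) : ℂ) = k - 3 / 2 + w by ring,
    show (k + 1 / 2 - (w - 1) : ℂ) = k + 3 / 2 - w by ring,
    show (1 / 2 + t * Complex.I - (w - 1) : ℂ) = 3 / 2 + t * Complex.I - w by ring,
    show (1 / 2 - t * Complex.I - (w - 1) : ℂ) = 3 / 2 - t * Complex.I - w by ring,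
    a1, a2, a3, a4, div_mul_eq_mul_div, div_mul_eq_mul_div, div_mul_eq_mul_div, div_mul_eq_mul_div,
    div_mul_eq_mul_div, div_mul_eq_mul_div, div_mul_eq_mul_div, div_mul_eq_mul_div, ← neg_div,
    div_eq_div_iff (mul_ne_zero n3 n2) n2]
  ring

/-- The w² terms of (k - 3/2 + w)(k + 1/2 - w) and (1/2 - w)² + t² cancel in their sum. The
difference is thus K(w) times a linear polynomial over a quadratic one, which gains the factor 1/|y|
needed for absolute convergence. -/
lemma sinKernel_sub_mul {k : ℕ} (t : ℝ) {w : ℂ} (h1 : 3 / 2 - (k : ℝ) < w.re)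
    (h2 : w.re < 1 / 2) :
    (sinKernel k t w - sinKernel k t (w - 1)) * ((k - 3 / 2 + w) * (k + 1 / 2 - w)) =
      sinKernel k t w * (w + k ^ 2 - k - 1 / 2 + t ^ 2) := by
  linear_combination -sinKernel_sub_one_mul t h1 h2

/-- The same difference expressed through K(w - 1); this form serves near the left edge, where the
estimate is available on the shifted line. -/
lemma sinKernel_sub_mul' {k : ℕ} (t : ℝ) {w : ℂ} (h1 : 3 / 2 - (k : ℝ) < w.re)
    (h2 : w.re < 1 / 2) :
    (sinKernel k t w - sinKernel k t (w - 1)) * ((1 / 2 - w) ^ 2 + t ^ 2) =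
      -(sinKernel k t (w - 1) * (w + k ^ 2 - k - 1 / 2 + t ^ 2)) := by
  linear_combination sinKernel_sub_one_mul t h1 h2

lemma norm_numerator_le {k : ℕ} (t σ y : ℝ) (h1 : 0 ≤ σ + k ^ 2 - k - 1 / 2)
    (h2 : σ + k ^ 2 - k - 1 / 2 ≤ k ^ 2) :
    ‖((σ + y * Complex.I) + k ^ 2 - k - 1 / 2 + t ^ 2 : ℂ)‖ ≤ |y| + k ^ 2 + t ^ 2 := by
  rw [show ((σ + y * Complex.I) + k ^ 2 - k - 1 / 2 + t ^ 2 : ℂ) =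
    ((σ + k ^ 2 - k - 1 / 2 + t ^ 2 : ℝ) : ℂ) + y * Complex.I by push_cast; ring]
  refine (norm_add_le _ _).trans ?_
  rw [norm_mul, Complex.norm_I, mul_one, Complex.norm_real, Complex.norm_real, Real.norm_eq_abs,
    Real.norm_eq_abs, abs_of_nonneg (by nlinarith [sq_nonneg t])]
  linarith

lemma sq_le_two_mul_exp {s : ℝ} (hs : 0 ≤ s) : 1 + s ^ 2 ≤ 2 * Real.exp s := by
  have := one_add_sq_le_two_mul_exp hs
  nlinarith

/-- The quotient is large only when |y| is below |t|, and then exp(-s) with s = |t| - |y| pays,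
because t² ≤ 2y² + 2s². The resulting Cauchy profile of width k + T integrates to π(k + T), the
factor in the theorem. -/
lemma ratio_mul_exp_le {k t y : ℝ} (hk : 2 ≤ k) :
    (k ^ 2 + t ^ 2) / (k ^ 2 + y ^ 2) * Real.exp (-(max |y| |t| - |y|)) ≤
      20 * (1 + (y / (k + (3 + |t|))) ^ 2)⁻¹ := by
  set s := max |y| |t| - |y| with hs
  have hs0 : 0 ≤ s := sub_nonneg.mpr (le_max_left _ _)
  have ht : |t| ≤ |y| + s := by rw [hs]; linarith [le_max_right |y| |t|]
  set S := k + (3 + |t|) with hS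
  have hS0 : 0 < S := by positivity
  have e1 : (1 + (y / S) ^ 2)⁻¹ = S ^ 2 / (S ^ 2 + y ^ 2) := by field_simp
  have hE := sq_le_two_mul_exp hs0
  have hE1 := Real.exp_pos s
  have ht2 : t ^ 2 ≤ 2 * y ^ 2 + 2 * s ^ 2 := by
    rw [← sq_abs t, ← sq_abs y]
    nlinarith [abs_nonneg t, abs_nonneg y, sq_nonneg (|y| - s)]
  have hSy : S ^ 2 + y ^ 2 ≤ 20 * (k ^ 2 + y ^ 2) * Real.exp s := by
    have h1 : S ^ 2 ≤ 10 * k ^ 2 + 3 * t ^ 2 := by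
      rw [hS, ← sq_abs t]
      nlinarith [sq_nonneg (k - |t|), sq_nonneg (|t| - 3), sq_nonneg (k - 3)]
    have h2 : S ^ 2 + y ^ 2 ≤ 10 * (k ^ 2 + y ^ 2) * (1 + s ^ 2) := by
      nlinarith [sq_nonneg y, sq_nonneg s, mul_nonneg (sq_nonneg y) (sq_nonneg s),
        mul_nonneg (by nlinarith : (0 : ℝ) ≤ k ^ 2 - 4) (sq_nonneg s)]
    nlinarith [mul_le_mul_of_nonneg_left hE (show 0 ≤ 10 * (k ^ 2 + y ^ 2) by positivity)]
  have hkS : k ^ 2 + t ^ 2 ≤ S ^ 2 := by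
    rw [hS, ← sq_abs t]
    nlinarith [abs_nonneg t]
  rw [e1, Real.exp_neg, ← div_eq_mul_inv, div_div, ← mul_div_assoc,
    div_le_div_iff₀ (by positivity) (by positivity)]
  calc (k ^ 2 + t ^ 2) * (S ^ 2 + y ^ 2) ≤ S ^ 2 * (20 * (k ^ 2 + y ^ 2) * Real.exp s) := by gcongr
    _ = _ := by ring

lemma one_add_abs_sq_le (y : ℝ) : (1 + |y|) ^ 2 ≤ 2 * (1 + y ^ 2) := by
  rw [← sq_abs y]
  nlinarith [sq_nonneg (1 - |y|)]

/-- The difference of `sinKernel` on `Re w = 1/2 - δ`. -/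
lemma exists_norm_sinKernel_sub_right_le {δ : ℝ} (hδ : 0 < δ) (hδ' : δ ≤ 1 / 4) :
    ∃ C : ℝ, 0 < C ∧ ∀ k : ℕ, 2 ≤ k → ∀ t y : ℝ,
      ‖sinKernel k t ((1 / 2 - δ : ℝ) + y * Complex.I) -
        sinKernel k t ((1 / 2 - δ : ℝ) + y * Complex.I - 1)‖ ≤
        C * ((1 + (y / (k + (3 + |t|))) ^ 2)⁻¹ + (1 + |y|) ^ (-(5 / 4) : ℝ)) := by
  obtain ⟨C, hC, H⟩ := exists_norm_kernel_right_le hδ hδ'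
  refine ⟨8 * C * 20, by positivity, fun k hk t y => ?_⟩
  have hk' : (2 : ℝ) ≤ k := by exact_mod_cast hk
  set w : ℂ := (1 / 2 - δ : ℝ) + y * Complex.I with hw
  have hwre : w.re = 1 / 2 - δ := by simp [hw]
  have hrel := congrArg norm (sinKernel_sub_mul (k := k) t (w := w) (by rw [hwre]; linarith)
    (by rw [hwre]; linarith))
  rw [norm_mul, norm_mul (sinKernel k t w)] at hrel
  have hN : ‖(w + k ^ 2 - k - 1 / 2 + t ^ 2 : ℂ)‖ ≤ |y| + k ^ 2 + t ^ 2 :=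
    norm_numerator_le t (1 / 2 - δ) y (by nlinarith) (by nlinarith)
  -- The tight case is k = 2, δ = 1/4, where (k - 1 - δ)² = 9/16 against k²/8 = 1/2.
  have hD : ((k : ℝ) ^ 2 + y ^ 2) / 8 ≤ ‖((k - 3 / 2 + w) * (k + 1 / 2 - w) : ℂ)‖ := by
    rw [norm_mul, show (k - 3 / 2 + w : ℂ) = ((k - 1 - δ : ℝ) : ℂ) + y * Complex.I by
      rw [hw]; push_cast; ring, show (k + 1 / 2 - w : ℂ) = ((k + δ : ℝ) : ℂ) + (-y : ℝ) * Complex.I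
      by rw [hw]; push_cast; ring, norm_add_mul_I, norm_add_mul_I, ← Real.sqrt_mul (by positivity)]
    refine Real.le_sqrt_of_sq_le ?_
    have a1 : ((k : ℝ) ^ 2 + y ^ 2) / 8 ≤ (k - 1 - δ) ^ 2 + y ^ 2 := by
      nlinarith [sq_nonneg y]
    have a2 : ((k : ℝ) ^ 2 + y ^ 2) / 8 ≤ (k + δ) ^ 2 + (-y) ^ 2 := by
      nlinarith [sq_nonneg y]
    rw [pow_two]
    gcongr
  set s := max |y| |t| - |y| with hs
  have hs0 : 0 ≤ s := sub_nonneg.mpr (le_max_left _ _)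
  set P := (1 + |y - t|) * (1 + |y + t|) with hP
  have hP1 : 1 + |y| ≤ P := one_add_abs_le_mul y t
  have hPy : P ^ (δ - 1 / 2) ≤ (1 + |y|) ^ (δ - 1 / 2) :=
    Real.rpow_le_rpow_of_nonpos (by positivity) hP1 (by linarith)
  have hPy1 : (1 + |y|) ^ (δ - 1 / 2) ≤ 1 :=
    Real.rpow_le_one_of_one_le_of_nonpos (by linarith [abs_nonneg y]) (by linarith)
  have hK : ‖sinKernel k t w‖ ≤ C * (1 + |y|) ^ (δ - 1 / 2) * Real.exp (-s) := by
    rw [sinKernel, norm_mul]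
    calc _ ≤ (C * P ^ (δ - 1 / 2) * Real.exp (-(Real.pi * max |y| |t|))) *
          Real.exp (Real.pi * |y|) := by
          gcongr
          · exact H k hk t y
          · exact norm_sin_le _ y
      _ = C * P ^ (δ - 1 / 2) * Real.exp (-(Real.pi * s)) := by
          rw [mul_assoc, ← Real.exp_add]; congr 2; rw [hs]; ring
      _ ≤ _ := by
          gcongr
          nlinarith [Real.pi_gt_three]
  have hpos : 0 < ((k : ℝ) ^ 2 + y ^ 2) / 8 := by positivity
  have hmain : ‖sinKernel k t w - sinKernel k t (w - 1)‖ ≤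
      (C * (1 + |y|) ^ (δ - 1 / 2) * Real.exp (-s)) * (|y| + k ^ 2 + t ^ 2) /
        (((k : ℝ) ^ 2 + y ^ 2) / 8) := by
    rw [le_div_iff₀ hpos]
    calc _ ≤ ‖sinKernel k t w - sinKernel k t (w - 1)‖ *
          ‖((k - 3 / 2 + w) * (k + 1 / 2 - w) : ℂ)‖ := by gcongr
      _ = _ := hrel
      _ ≤ _ := by gcongr
  have hr := ratio_mul_exp_le (k := k) (t := t) (y := y) hk'
  rw [← hs] at hr
  have hes : Real.exp (-s) ≤ 1 := Real.exp_le_one_iff.mpr (by linarith)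
  -- The term |y| of the numerator leaves 1/(1 + |y|), and the kernel supplies a further exponent δ
  -- - 1/2 ≤ -1/4; together -5/4, which is integrable.
  have h2 : |y| / ((k : ℝ) ^ 2 + y ^ 2) * (1 + |y|) ^ (δ - 1 / 2) ≤
      2 * (1 + |y|) ^ (-(5 / 4) : ℝ) := by
    have hy : 0 < 1 + |y| := by positivity
    have b1 : |y| / ((k : ℝ) ^ 2 + y ^ 2) ≤ 2 * (1 + |y|) ^ (-1 : ℝ) := by
      rw [Real.rpow_neg_one, ← div_eq_mul_inv, div_le_div_iff₀ (by positivity) hy]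
      nlinarith [one_add_abs_sq_le y, abs_nonneg y]
    calc _ ≤ 2 * (1 + |y|) ^ (-1 : ℝ) * (1 + |y|) ^ (-(1 / 4) : ℝ) := by
          gcongr
          · linarith [abs_nonneg y]
          · linarith
      _ = _ := by rw [mul_assoc, ← Real.rpow_add hy]; norm_num
  calc _ ≤ _ := hmain
    _ = 8 * C * ((1 + |y|) ^ (δ - 1 / 2) *
          ((k ^ 2 + t ^ 2) / (k ^ 2 + y ^ 2) * Real.exp (-s)) +
          |y| / (k ^ 2 + y ^ 2) * (1 + |y|) ^ (δ - 1 / 2) * Real.exp (-s)) := by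
        field_simp; ring
    _ ≤ 8 * C * (1 * (20 * (1 + (y / (k + (3 + |t|))) ^ 2)⁻¹) +
          2 * (1 + |y|) ^ (-(5 / 4) : ℝ) * 1) := by
        gcongr
    _ ≤ _ := by
        have : 0 ≤ (1 + |y|) ^ (-(5 / 4) : ℝ) := by positivity
        nlinarith [mul_nonneg hC.le this]

/-! ### Kernel estimates at the left edge of the strip -/

/-- The quotient of `|(j + 1 + i(y - t)) (j + 1 + i(y + t))|` by
`|(2j + 1 + iy) (2j + 2 + iy)|`. -/
noncomputable def pairRatio (t y : ℝ) (j : ℕ) : ℝ :=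
  √((j + 1) ^ 2 + (y - t) ^ 2) * √((j + 1) ^ 2 + (y + t) ^ 2) /
    (√((2 * j + 1) ^ 2 + y ^ 2) * √((2 * j + 2) ^ 2 + y ^ 2))

lemma pairRatio_nonneg (t y : ℝ) (j : ℕ) : 0 ≤ pairRatio t y j := by
  unfold pairRatio; positivity

lemma pairRatio_le {t y B : ℝ} {j : ℕ} (hB : 0 ≤ B)
    (h : ((j + 1) ^ 2 + (y - t) ^ 2) * ((j + 1) ^ 2 + (y + t) ^ 2) ≤
      B ^ 2 * (((2 * j + 1) ^ 2 + y ^ 2) * ((2 * j + 2) ^ 2 + y ^ 2))) :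
    pairRatio t y j ≤ B := by
  unfold pairRatio
  rw [div_le_iff₀ (by positivity), ← Real.sqrt_mul (by positivity), ← Real.sqrt_mul (by positivity)]
  calc _ ≤ √(B ^ 2 * (((2 * j + 1) ^ 2 + y ^ 2) * ((2 * j + 2) ^ 2 + y ^ 2))) :=
        Real.sqrt_le_sqrt h
    _ = _ := by rw [Real.sqrt_mul (by positivity), Real.sqrt_sq hB]

/-- The factor j = 0 is kept apart with its dependence on y: its T² is present only for y of size at
most T, and this also provides decay in y. -/
lemma pairRatio_zero_le (t y : ℝ) :
    pairRatio t y 0 ≤ 1 + (3 + |t|) ^ 2 * (1 + y ^ 2)⁻¹ := by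
  refine pairRatio_le (by positivity) ?_
  set T := 3 + |t| with hT
  have hT2 : t ^ 2 ≤ T ^ 2 := by rw [← sq_abs t, hT]; gcongr; linarith
  have e : (1 + T ^ 2 * (1 + y ^ 2)⁻¹) ^ 2 * (1 + y ^ 2) ^ 2 = (1 + y ^ 2 + T ^ 2) ^ 2 := by
    field_simp
  have h1 : (1 + y ^ 2 + T ^ 2) ^ 2 ≤ (1 + T ^ 2 * (1 + y ^ 2)⁻¹) ^ 2 *
      ((1 + y ^ 2) * (4 + y ^ 2)) := by
    rw [← e, pow_two (1 + y ^ 2)]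
    gcongr
    norm_num
  norm_num
  refine le_trans ?_ h1
  have h0 := sq_nonneg t
  nlinarith [sq_nonneg y, mul_nonneg (sq_nonneg y) (sq_nonneg t), mul_nonneg (sq_nonneg y) (sq_nonneg T),
    mul_le_mul hT2 hT2 h0 (sq_nonneg T)]

/-- The bound T²/8, rather than the T²/4 of the theorem, leaves a spare factor 2^(-k) that later
absorbs powers of k. For j ≥ 1 the denominators are large enough for this: 2j + 1 ≥ (3/2)(j + 1). -/
lemma pairRatio_succ_le (t y : ℝ) {j : ℕ} (hj : 1 ≤ j) :
    pairRatio t y j ≤ (3 + |t|) ^ 2 / 8 := by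
  refine pairRatio_le (by positivity) ?_
  have hj' : (2 : ℝ) ≤ j + 1 := by
    have : (1 : ℝ) ≤ j := by exact_mod_cast hj
    linarith
  set a : ℝ := j + 1 with ha
  have e1 : (2 * j + 1 : ℝ) = 2 * a - 1 := by rw [ha]; ring
  have e2 : (2 * j + 2 : ℝ) = 2 * a := by rw [ha]; ring
  rw [e1, e2]
  have hA : 4 ≤ a ^ 2 := by nlinarith
  have hT : (9 + t ^ 2) / 8 ≤ (3 + |t|) ^ 2 / 8 := by
    rw [← sq_abs t]; nlinarith [abs_nonneg t]
  have hden : (9 / 4 * a ^ 2 + y ^ 2) * (4 * a ^ 2 + y ^ 2) ≤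
      ((2 * a - 1) ^ 2 + y ^ 2) * ((2 * a) ^ 2 + y ^ 2) := by
    gcongr
    · nlinarith
    · nlinarith
  refine le_trans ?_ (mul_le_mul (pow_le_pow_left₀ (by positivity) hT 2) hden (by positivity)
    (by positivity))
  have e3 : (a ^ 2 + (y - t) ^ 2) * (a ^ 2 + (y + t) ^ 2) =
      (a ^ 2 + y ^ 2) ^ 2 + 2 * t ^ 2 * a ^ 2 - 2 * t ^ 2 * y ^ 2 + t ^ 2 * t ^ 2 := by ring
  rw [e3]
  generalize a ^ 2 = A at *
  have hY := sq_nonneg y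
  generalize y ^ 2 = Y at *
  have hU := sq_nonneg t
  generalize t ^ 2 = U at *
  have p1 : 0 ≤ U * U * (A ^ 2 - 16) := by
    have : 0 ≤ A ^ 2 - 16 := by nlinarith
    positivity
  have p2 : 0 ≤ U * A * (A - 4) := by
    have : 0 ≤ A - 4 := by linarith
    have : 0 ≤ A := by linarith
    positivity
  have hA0 : 0 ≤ A := by linarith
  have p3 : 0 ≤ A * Y := by positivity
  have p4 : 0 ≤ U * Y := by positivity
  have p5 : 0 ≤ U * A * Y := by positivity
  have p6 : 0 ≤ U * Y * Y := by positivity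
  have p7 : 0 ≤ U * U * A * Y := by positivity
  have p8 : 0 ≤ U * U * Y * Y := by positivity
  nlinarith [sq_nonneg A, sq_nonneg Y]

lemma prod_pairRatio_le (t y : ℝ) (n : ℕ) :
    ∏ j ∈ Finset.range (n + 1), pairRatio t y j ≤
      (1 + (3 + |t|) ^ 2 * (1 + y ^ 2)⁻¹) * ((3 + |t|) ^ 2 / 8) ^ n := by
  induction n with
  | zero => simpa using pairRatio_zero_le t y
  | succ n ih =>
    rw [Finset.prod_range_succ, pow_succ _ n, ← mul_assoc]
    have h1 := pairRatio_succ_le t y (j := n + 1) (by lia)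
    have := pairRatio_nonneg t y (n + 1)
    gcongr

/-- The functional equation is applied n times, and each real part j + 1 - ε is rounded up to j + 1,
matching the numerators of `pairRatio`. -/
lemma gammaNorm_nat_add_le {ε : ℝ} (h0 : 0 < ε) (h1 : ε < 1) (n : ℕ) (u : ℝ) :
    gammaNorm (n + (1 - ε)) u ≤
      (∏ j ∈ Finset.range n, √((j + 1) ^ 2 + u ^ 2)) * gammaNorm (1 - ε) u := by
  induction n with
  | zero => simp
  | succ n ih =>
    have hn : (0 : ℝ) ≤ n := by positivity
    rw [show ((n + 1 : ℕ) : ℝ) + (1 - ε) = n + (1 - ε) + 1 by push_cast; ring,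
      gammaNorm_add_one (by linarith), Finset.prod_range_succ]
    have hp := (gammaNorm_pos (show 0 < n + (1 - ε) by linarith) u).le
    calc _ ≤ √((n + 1) ^ 2 + u ^ 2) *
          ((∏ j ∈ Finset.range n, √((j + 1) ^ 2 + u ^ 2)) * gammaNorm (1 - ε) u) := by
          gcongr
          linarith
      _ = _ := by ring

/-- After the first step from ε to 1 + ε, the 2n remaining factors are grouped in pairs and ε is
dropped from each, matching the denominators of `pairRatio`. -/
lemma le_gammaNorm_odd_add {ε : ℝ} (h0 : 0 < ε) (n : ℕ) (y : ℝ) :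
    gammaNorm ε y * √(ε ^ 2 + y ^ 2) *
      (∏ j ∈ Finset.range n, (√((2 * j + 1) ^ 2 + y ^ 2) * √((2 * j + 2) ^ 2 + y ^ 2))) ≤
      gammaNorm (2 * n + 1 + ε) y := by
  induction n with
  | zero => simp [add_comm 1 ε, gammaNorm_add_one h0, mul_comm]
  | succ n ih =>
    rw [show 2 * ((n + 1 : ℕ) : ℝ) + 1 + ε = 2 * n + 1 + ε + 1 + 1 by push_cast; ring,
      gammaNorm_add_one (by positivity), gammaNorm_add_one (by positivity),
      Finset.prod_range_succ]
    have hp := (gammaNorm_pos h0 y).le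
    have hpr : 0 ≤ ∏ j ∈ Finset.range n,
        (√((2 * (j : ℝ) + 1) ^ 2 + y ^ 2) * √((2 * (j : ℝ) + 2) ^ 2 + y ^ 2)) :=
      Finset.prod_nonneg fun _ _ => by positivity
    calc _ = √((2 * n + 2) ^ 2 + y ^ 2) * (√((2 * n + 1) ^ 2 + y ^ 2) *
          (gammaNorm ε y * √(ε ^ 2 + y ^ 2) * (∏ j ∈ Finset.range n,
            (√((2 * j + 1) ^ 2 + y ^ 2) * √((2 * j + 2) ^ 2 + y ^ 2))))) := by ring
      _ ≤ _ := by
          have s1 : (2 * n + 2 : ℝ) ≤ 2 * n + 1 + ε + 1 := by linarith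
          have s2 : (2 * n + 1 : ℝ) ≤ 2 * n + 1 + ε := by linarith
          exact mul_le_mul (Real.sqrt_le_sqrt (by gcongr))
            (mul_le_mul (Real.sqrt_le_sqrt (by gcongr)) ih (by positivity) (by positivity))
            (by positivity) (by positivity)

/-- The kernel on `Re w = 1/2 - k + ε`. -/
lemma exists_norm_kernel_edge_le {ε : ℝ} (hε : 0 < ε) (hε' : ε ≤ 1 / 8) :
    ∃ C : ℝ, 0 < C ∧ ∀ k : ℕ, 2 ≤ k → ∀ t y : ℝ,
      ‖kernel k t ((1 / 2 - k + ε : ℝ) + y * Complex.I)‖ ≤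
        C * (1 + |y|)⁻¹ * (1 + (y / (2 * k - ε)) ^ 2) ^ (-(1 - 2 * ε) / 2) *
          ((1 + (3 + |t|) ^ 2 * (1 + y ^ 2)⁻¹) * ((3 + |t|) ^ 2 / 8) ^ (k - 2)) *
          (((1 + |y - t|) * (1 + |y + t|)) ^ (1 / 2 - ε) *
            Real.exp (-(Real.pi * max |y| |t|))) := by
  obtain ⟨C, hC, H⟩ := exists_gammaNorm_mul_le (show 0 < 1 - ε by linarith)
  refine ⟨2 / ε * C, by positivity, fun k hk t y => ?_⟩
  obtain ⟨n, rfl⟩ : ∃ n, k = n + 2 := ⟨k - 2, by lia⟩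
  have hn : (0 : ℝ) ≤ n := by positivity
  rw [norm_kernel]
  set k : ℝ := ((n + 2 : ℕ) : ℝ) with hk
  have hkn : k = n + 2 := by rw [hk]; push_cast; ring
  have hk2 : 2 ≤ k := by linarith
  rw [show k - 1 / 2 + (1 / 2 - k + ε) = ε by ring,
    show k + 1 / 2 - (1 / 2 - k + ε) = 2 * k - ε by ring,
    show 1 / 2 - (1 / 2 - k + ε) = k - ε by ring, Nat.add_sub_cancel]
  set q := (1 + (y / (2 * k - ε)) ^ 2) ^ (-(1 - 2 * ε) / 2) with hq
  have hq0 : 0 < q := by rw [hq]; positivity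
  set D := ∏ j ∈ Finset.range (n + 1),
    (√((2 * (j : ℝ) + 1) ^ 2 + y ^ 2) * √((2 * (j : ℝ) + 2) ^ 2 + y ^ 2)) with hD
  have hD0 : 0 < D := Finset.prod_pos fun _ _ => by positivity
  have hb := gammaNorm_pos (show 0 < 2 * k - ε by linarith) y
  -- From ε to 2k - ε in two stages: 2k - 1 steps of the functional equation reach 2k - 1 + ε, then
  -- `gammaNorm_le` bridges the remaining 1 - 2ε and produces q.
  have hratio : gammaNorm ε y / gammaNorm (2 * k - ε) y ≤ 2 / ε * (1 + |y|)⁻¹ * q / D := by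
    have l1 := le_gammaNorm_odd_add hε (n + 1) y
    rw [← hD, show 2 * ((n + 1 : ℕ) : ℝ) + 1 + ε = 2 * k - 1 + ε by rw [hkn]; push_cast; ring] at l1
    have l2 := gammaNorm_le (show 0 < 2 * k - 1 + ε by linarith)
      (show 2 * k - 1 + ε ≤ 2 * k - ε by linarith) y
    rw [show 2 * k - ε - (2 * k - 1 + ε) = 1 - 2 * ε by ring, ← hq] at l2
    have hΓ : Real.Gamma (2 * k - 1 + ε) / Real.Gamma (2 * k - ε) ≤ 1 := by
      rw [div_le_one (Real.Gamma_pos_of_pos (by linarith))]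
      exact Real.Gamma_strictMonoOn_Ici.monotoneOn (by simp; linarith) (by simp; linarith)
        (by linarith)
    have l3 : gammaNorm ε y * √(ε ^ 2 + y ^ 2) * D ≤ q * gammaNorm (2 * k - ε) y := by
      calc _ ≤ _ := l1
        _ ≤ _ := l2
        _ ≤ 1 * q * gammaNorm (2 * k - ε) y := by gcongr
        _ = _ := by ring
    have l4 : ε / 2 * (1 + |y|) ≤ √(ε ^ 2 + y ^ 2) := by
      refine Real.le_sqrt_of_sq_le ?_
      rw [← sq_abs y]
      nlinarith [abs_nonneg y, sq_nonneg (ε - |y|), mul_nonneg hε.le (abs_nonneg y),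
        mul_nonneg (by linarith : 0 ≤ 1 - ε) (sq_nonneg |y|), sq_nonneg (ε * |y|),
        mul_nonneg (mul_nonneg hε.le (by linarith : 0 ≤ 1 - ε)) (sq_nonneg |y|),
        sq_nonneg (ε * (1 - |y|))]
    have l5 : gammaNorm ε y * (ε / 2 * (1 + |y|)) * D ≤ q * gammaNorm (2 * k - ε) y := by
      refine le_trans ?_ l3
      have := (gammaNorm_pos hε y).le
      gcongr
    rw [div_le_div_iff₀ hb hD0]
    have hy : 0 < 1 + |y| := by positivity
    have e : gammaNorm ε y * D = 2 / ε * (1 + |y|)⁻¹ * (gammaNorm ε y * (ε / 2 * (1 + |y|)) * D) := by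
      field_simp
    rw [e, mul_assoc _ q]
    gcongr
  have hnum : gammaNorm (k - ε) (y - t) * gammaNorm (k - ε) (y + t) ≤
      (∏ j ∈ Finset.range (n + 1), pairRatio t y j) * D *
      (gammaNorm (1 - ε) (y - t) * gammaNorm (1 - ε) (y + t)) := by
    have m1 := gammaNorm_nat_add_le hε (by linarith) (n + 1) (y - t)
    have m2 := gammaNorm_nat_add_le hε (by linarith) (n + 1) (y + t)
    rw [show ((n + 1 : ℕ) : ℝ) + (1 - ε) = k - ε by rw [hkn]; push_cast; ring] at m1 m2
    have n1 := (gammaNorm_pos (show 0 < 1 - ε by linarith) (y - t)).le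
    have n3 := (gammaNorm_pos (show 0 < k - ε by linarith) (y + t)).le
    have hpr : 0 ≤ ∏ j ∈ Finset.range (n + 1), √(((j : ℝ) + 1) ^ 2 + (y - t) ^ 2) :=
      Finset.prod_nonneg fun _ _ => by positivity
    have hprod : (∏ j ∈ Finset.range (n + 1), pairRatio t y j) * D =
        (∏ j ∈ Finset.range (n + 1), √(((j : ℝ) + 1) ^ 2 + (y - t) ^ 2)) *
        ∏ j ∈ Finset.range (n + 1), √(((j : ℝ) + 1) ^ 2 + (y + t) ^ 2) := by
      rw [hD, ← Finset.prod_mul_distrib, ← Finset.prod_mul_distrib]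
      refine Finset.prod_congr rfl fun j _ => ?_
      unfold pairRatio
      field_simp
    calc _ ≤ _ := mul_le_mul m1 m2 n3 (by positivity)
      _ = _ := by rw [hprod]; ring
  have hR := prod_pairRatio_le t y n
  have hR0 : 0 ≤ ∏ j ∈ Finset.range (n + 1), pairRatio t y j :=
    Finset.prod_nonneg fun j _ => pairRatio_nonneg t y j
  have hH := H y t
  rw [show 1 - ε - 1 / 2 = 1 / 2 - ε by ring] at hH
  have n1 := (gammaNorm_pos (show 0 < 1 - ε by linarith) (y - t)).le
  have n2 := (gammaNorm_pos (show 0 < 1 - ε by linarith) (y + t)).le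
  have n3 := (gammaNorm_pos (show 0 < k - ε by linarith) (y - t)).le
  have n4 := (gammaNorm_pos (show 0 < k - ε by linarith) (y + t)).le
  rw [mul_assoc]
  calc _ ≤ (2 / ε * (1 + |y|)⁻¹ * q / D) *
        ((∏ j ∈ Finset.range (n + 1), pairRatio t y j) * D *
          (gammaNorm (1 - ε) (y - t) * gammaNorm (1 - ε) (y + t))) :=
        mul_le_mul hratio hnum (by positivity) (by positivity)
    _ = 2 / ε * (1 + |y|)⁻¹ * q * (∏ j ∈ Finset.range (n + 1), pairRatio t y j) *
          (gammaNorm (1 - ε) (y - t) * gammaNorm (1 - ε) (y + t)) := by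
        field_simp
    _ ≤ 2 / ε * (1 + |y|)⁻¹ * q *
          ((1 + (3 + |t|) ^ 2 * (1 + y ^ 2)⁻¹) * ((3 + |t|) ^ 2 / 8) ^ n) *
          (C * ((1 + |y - t|) * (1 + |y + t|)) ^ (1 / 2 - ε) *
            Real.exp (-(Real.pi * max |y| |t|))) :=
        mul_le_mul (by gcongr) hH (by positivity) (by positivity)
    _ = _ := by ring

lemma exists_cosh_mul_norm_kernel_edge_le {ε : ℝ} (hε : 0 < ε) (hε' : ε ≤ 1 / 8) :
    ∃ C : ℝ, 0 < C ∧ ∀ k : ℕ, 2 ≤ k → ∀ t y : ℝ,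
      Real.cosh (Real.pi * t) * ‖kernel k t ((1 / 2 - k + ε : ℝ) + y * Complex.I)‖ ≤
        C * (((3 + |t|) ^ 2 / 4) ^ k / (3 + |t|)) * (1 + y ^ 2)⁻¹ := by
  obtain ⟨C, hC, H⟩ := exists_norm_kernel_edge_le hε hε'
  refine ⟨C * (3 * 16), by positivity, fun k hk t y => ?_⟩
  have hk' : (2 : ℝ) ≤ k := by exact_mod_cast hk
  set T := 3 + |t| with hTdef
  have hT : 3 ≤ T := by rw [hTdef]; linarith [abs_nonneg t]
  have hc := cosh_le_exp_abs (Real.pi * t)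
  rw [abs_mul, abs_of_pos Real.pi_pos] at hc
  set m := max |y| |t| with hm
  have hs0 : 0 ≤ m - |t| := sub_nonneg.mpr (le_max_right _ _)
  have hm0 : 0 ≤ m := (abs_nonneg y).trans (le_max_left _ _)
  have hq : (1 + (y / (2 * k - ε)) ^ 2) ^ (-(1 - 2 * ε) / 2) ≤ 1 :=
    Real.rpow_le_one_of_one_le_of_nonpos (by nlinarith [sq_nonneg (y / (2 * k - ε))]) (by linarith)
  have hy : (1 + |y|)⁻¹ ≤ 1 := inv_le_one_of_one_le₀ (by linarith [abs_nonneg y])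
  have hP : ((1 + |y - t|) * (1 + |y + t|)) ^ (1 / 2 - ε) ≤ T * (1 + (m - |t|)) := by
    calc _ ≤ ((1 + m) ^ 2) ^ (1 / 2 - ε) := by
          gcongr
          · linarith
          · exact one_add_abs_mul_le y t
      _ ≤ ((1 + m) ^ 2) ^ (1 / 2 : ℝ) :=
          Real.rpow_le_rpow_of_exponent_le (by nlinarith) (by linarith)
      _ = 1 + m := by rw [← Real.sqrt_eq_rpow, Real.sqrt_sq (by linarith)]
      _ ≤ _ := by nlinarith [abs_nonneg t]
  have hexp : Real.exp (Real.pi * |t|) * Real.exp (-(Real.pi * m)) * (1 + (m - |t|)) ≤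
      Real.exp (-(m - |t|)) := by
    rw [← Real.exp_add]
    calc _ ≤ Real.exp (Real.pi * |t| + -(Real.pi * m)) * Real.exp (m - |t|) := by
          gcongr
          linarith [Real.add_one_le_exp (m - |t|)]
      _ ≤ _ := by
          rw [← Real.exp_add, Real.exp_le_exp]
          nlinarith [Real.pi_gt_three]
  have he1 : Real.exp (-(m - |t|)) ≤ 1 := Real.exp_le_one_iff.mpr (by linarith)
  have hsum : (1 + T ^ 2 * (1 + y ^ 2)⁻¹) * Real.exp (-(m - |t|)) ≤ 3 * T ^ 2 * (1 + y ^ 2)⁻¹ := by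
    have h1 := exp_neg_max_sub_le y t
    have h2 := inv_one_add_div_sq_le (S := T) (by linarith) y
    rw [← hm, ← hTdef] at h1
    have h3 : T ^ 2 * (1 + y ^ 2)⁻¹ * Real.exp (-(m - |t|)) ≤ T ^ 2 * (1 + y ^ 2)⁻¹ :=
      mul_le_of_le_one_right (by positivity) he1
    nlinarith
  -- One T comes from the product of Γ(1 - ε + i(y ± t)) and two from the pair j = 0; since (T²/4)^2
  -- contains T^4, the quotient keeps 1/T.
  have hpow : (T ^ 2 / 8) ^ (k - 2) * T ^ 3 ≤ 16 * ((T ^ 2 / 4) ^ k / T) := by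
    obtain ⟨n, rfl⟩ : ∃ n, k = n + 2 := ⟨k - 2, by lia⟩
    rw [Nat.add_sub_cancel]
    calc _ ≤ (T ^ 2 / 4) ^ n * T ^ 3 := by
          gcongr
          norm_num
      _ = _ := by rw [pow_add]; field_simp; norm_num
  calc _ ≤ Real.exp (Real.pi * |t|) * (C * 1 * 1 *
        ((1 + T ^ 2 * (1 + y ^ 2)⁻¹) * (T ^ 2 / 8) ^ (k - 2)) *
        (T * (1 + (m - |t|)) * Real.exp (-(Real.pi * m)))) := by
        gcongr
        exact (H k hk t y).trans (by gcongr)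
    _ = C * (1 + T ^ 2 * (1 + y ^ 2)⁻¹) * (T ^ 2 / 8) ^ (k - 2) * T *
        (Real.exp (Real.pi * |t|) * Real.exp (-(Real.pi * m)) * (1 + (m - |t|))) := by ring
    _ ≤ C * (1 + T ^ 2 * (1 + y ^ 2)⁻¹) * (T ^ 2 / 8) ^ (k - 2) * T * Real.exp (-(m - |t|)) := by
        gcongr
    _ = C * (T ^ 2 / 8) ^ (k - 2) * T * ((1 + T ^ 2 * (1 + y ^ 2)⁻¹) * Real.exp (-(m - |t|))) := by
        ring
    _ ≤ C * (T ^ 2 / 8) ^ (k - 2) * T * (3 * T ^ 2 * (1 + y ^ 2)⁻¹) := by gcongr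
    _ = C * 3 * (1 + y ^ 2)⁻¹ * ((T ^ 2 / 8) ^ (k - 2) * T ^ 3) := by ring
    _ ≤ C * 3 * (1 + y ^ 2)⁻¹ * (16 * ((T ^ 2 / 4) ^ k / T)) := by gcongr
    _ = _ := by ring

lemma exists_pow_mul_half_pow_le (p : ℕ) :
    ∃ M : ℝ, 0 < M ∧ ∀ n : ℕ, (n : ℝ) ^ p * (1 / 2) ^ n ≤ M := by
  have h := tendsto_pow_const_mul_const_pow_of_abs_lt_one p (r := (1 / 2 : ℝ))
    (by rw [abs_of_pos] <;> norm_num)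
  obtain ⟨M, hM⟩ := h.bddAbove_range
  refine ⟨|M| + 1, by positivity, fun n => ?_⟩
  have := hM ⟨n, rfl⟩
  simp only at this
  linarith [le_abs_self M]

lemma one_add_abs_half_le {a u : ℝ} (ha : 3 / 4 ≤ a) : (1 + |u|) / 2 ≤ √(a ^ 2 + u ^ 2) := by
  refine Real.le_sqrt_of_sq_le ?_
  rw [← sq_abs u]
  nlinarith [sq_nonneg (1 - |u|), abs_nonneg u]

/-- T is bounded by 3(1 + |y|)(1 + s) with s = max(|y|, |t|) - |y|, so T²/(1 + y²) is large only
where the exponential is small. -/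
lemma one_add_div_mul_exp_le (t y : ℝ) :
    (1 + (3 + |t|) ^ 2 * (1 + y ^ 2)⁻¹) * Real.exp (-(Real.pi * (max |y| |t| - |y|))) ≤ 37 := by
  set s := max |y| |t| - |y| with hs
  have hs0 : 0 ≤ s := sub_nonneg.mpr (le_max_left _ _)
  have hts : |t| ≤ |y| + s := by rw [hs]; linarith [le_max_right |y| |t|]
  set T := 3 + |t| with hTdef
  have h1 : T ≤ 3 * (1 + |y|) * (1 + s) := by
    rw [hTdef]; nlinarith [abs_nonneg y, mul_nonneg (abs_nonneg y) hs0]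
  have h2 : T ^ 2 ≤ 36 * (1 + y ^ 2) * Real.exp s := by
    calc T ^ 2 ≤ (3 * (1 + |y|) * (1 + s)) ^ 2 := by gcongr
      _ = 9 * (1 + |y|) ^ 2 * (1 + s) ^ 2 := by ring
      _ ≤ 9 * (2 * (1 + y ^ 2)) * (2 * Real.exp s) := by
          gcongr
          · exact one_add_abs_sq_le y
          · exact one_add_sq_le_two_mul_exp hs0
      _ = _ := by ring
  have h3 : 1 + T ^ 2 * (1 + y ^ 2)⁻¹ ≤ 37 * Real.exp s := by
    have h4 : T ^ 2 * (1 + y ^ 2)⁻¹ ≤ 36 * Real.exp s := by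
      rw [← div_eq_mul_inv, div_le_iff₀ (by positivity)]
      linarith
    linarith [Real.one_le_exp hs0]
  calc _ ≤ 37 * Real.exp s * Real.exp (-s) := by
        gcongr
        nlinarith [Real.pi_gt_three]
    _ = 37 := by rw [mul_assoc, ← Real.exp_add]; simp

lemma abs_add_sq_add_sq_le {k : ℝ} (hk' : 2 ≤ k) (t y : ℝ) :
    |y| + k ^ 2 + t ^ 2 ≤ k ^ 2 * (3 + |t|) ^ 2 * (1 + |y|) := by
  set T := 3 + |t| with hTdef
  have h1 : t ^ 2 + 9 ≤ T ^ 2 := by rw [← sq_abs t, hTdef]; nlinarith [abs_nonneg t]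
  have h2 : 4 ≤ k ^ 2 := by nlinarith
  have h3 : 36 ≤ k ^ 2 * T ^ 2 := by nlinarith [sq_nonneg t]
  have h4 : k ^ 2 + t ^ 2 ≤ k ^ 2 * T ^ 2 := by nlinarith [sq_nonneg t]
  nlinarith [abs_nonneg y]

/-- The spare 2^(-k) between T²/8 and T²/4 absorbs k³. -/
lemma pow_three_mul_pow_le {M : ℝ} {k : ℕ} (hk : 2 ≤ k)
    (hMk : (k : ℝ) ^ 3 * (1 / 2) ^ k ≤ M) {T : ℝ} (hT : 3 ≤ T) :
    (k : ℝ) ^ 3 * (T ^ 2 / 8) ^ (k - 2) * T ^ 2 ≤ M * 4 * 16 * ((T ^ 2 / 4) ^ k / T) := by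
  have hM0 : 0 ≤ M := le_trans (by positivity) hMk
  have e : (T ^ 2 / 8) ^ (k - 2) * T ^ 2 = (1 / 2) ^ k * 4 * 16 * ((T ^ 2 / 4) ^ k / T ^ 2) := by
    obtain ⟨n, rfl⟩ : ∃ n, k = n + 2 := ⟨k - 2, by lia⟩
    rw [Nat.add_sub_cancel, show T ^ 2 / 8 = 1 / 2 * (T ^ 2 / 4) by ring, mul_pow, pow_add,
      pow_add]
    field_simp
    norm_num
  calc _ = ((k : ℝ) ^ 3 * (1 / 2) ^ k) * 4 * 16 * ((T ^ 2 / 4) ^ k / T ^ 2) := by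
        rw [mul_assoc, e]; ring
    _ ≤ M * 4 * 16 * ((T ^ 2 / 4) ^ k / T) := by
        gcongr
        nlinarith

/-- The difference of `sinKernel` on `Re w = 3/2 - k + ε`. -/
lemma exists_norm_sinKernel_sub_edge_le {ε : ℝ} (hε : 0 < ε) (hε' : ε ≤ 1 / 8) :
    ∃ C : ℝ, 0 < C ∧ ∀ k : ℕ, 2 ≤ k → ∀ t y : ℝ,
      ‖sinKernel k t ((3 / 2 - k + ε : ℝ) + y * Complex.I) -
        sinKernel k t ((3 / 2 - k + ε : ℝ) + y * Complex.I - 1)‖ ≤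
        C * (((3 + |t|) ^ 2 / 4) ^ k / (3 + |t|)) * (1 + |y|) ^ (-(5 / 4) : ℝ) := by
  obtain ⟨C, hC, H⟩ := exists_norm_kernel_edge_le hε hε'
  obtain ⟨M, hM, HM⟩ := exists_pow_mul_half_pow_le 3
  refine ⟨C * 5 * 37 * 4 * (M * 4 * 16), by positivity, fun k hk t y => ?_⟩
  have hk' : (2 : ℝ) ≤ k := by exact_mod_cast hk
  set T := 3 + |t| with hTdef
  have hT : 3 ≤ T := by rw [hTdef]; linarith [abs_nonneg t]
  set w : ℂ := (3 / 2 - k + ε : ℝ) + y * Complex.I with hw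
  have hwre : w.re = 3 / 2 - k + ε := by simp [hw]
  have hw1 : w - 1 = (1 / 2 - k + ε : ℝ) + y * Complex.I := by rw [hw]; push_cast; ring
  have hrel := congrArg norm (sinKernel_sub_mul' (k := k) t (w := w) (by rw [hwre]; linarith)
    (by rw [hwre]; linarith))
  rw [norm_mul, norm_neg, norm_mul (sinKernel k t (w - 1))] at hrel
  have hN : ‖(w + k ^ 2 - k - 1 / 2 + t ^ 2 : ℂ)‖ ≤ |y| + k ^ 2 + t ^ 2 :=
    norm_numerator_le t (3 / 2 - k + ε) y (by nlinarith) (by nlinarith)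
  set P := (1 + |y - t|) * (1 + |y + t|) with hP
  have hPy : 1 + |y| ≤ P := one_add_abs_le_mul y t
  have hy : 0 < 1 + |y| := by positivity
  have hP0 : 0 < P := hy.trans_le hPy
  -- The quadratic polynomial splits into two linear factors with real part k - 1 - ε ≥ 3/4 and
  -- imaginary parts -(y ± t).
  have hD : P / 4 ≤ ‖((1 / 2 - w) ^ 2 + t ^ 2 : ℂ)‖ := by
    have hI : ((1 / 2 - w) ^ 2 + t ^ 2 : ℂ) =
        (((k - 1 - ε : ℝ) : ℂ) + (-(y - t) : ℝ) * Complex.I) *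
        (((k - 1 - ε : ℝ) : ℂ) + (-(y + t) : ℝ) * Complex.I) := by
      rw [hw]; push_cast; linear_combination (t : ℂ) ^ 2 * Complex.I_sq
    rw [hI, norm_mul, norm_add_mul_I, norm_add_mul_I]
    have h1 := one_add_abs_half_le (a := k - 1 - ε) (u := -(y - t)) (by linarith)
    have h2 := one_add_abs_half_le (a := k - 1 - ε) (u := -(y + t)) (by linarith)
    rw [abs_neg] at h1 h2
    calc P / 4 = (1 + |y - t|) / 2 * ((1 + |y + t|) / 2) := by rw [hP]; ring
      _ ≤ _ := by gcongr
  set s := max |y| |t| - |y| with hs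
  have hs0 : 0 ≤ s := sub_nonneg.mpr (le_max_left _ _)
  -- Here 1 - 2ε ≥ 3/4 is a genuine gain in y, bought with one factor k; the numerator costs k²
  -- more, which makes the k³ absorbed below.
  have hq : (1 + (y / (2 * k - ε)) ^ 2) ^ (-(1 - 2 * ε) / 2) ≤
      5 * k * (1 + |y|) ^ (-(3 / 4) : ℝ) := by
    refine (one_add_div_sq_rpow_le (by linarith) (by linarith) y).trans ?_
    gcongr
    · calc _ ≤ (2 * (1 + (2 * k - ε))) ^ (1 : ℝ) :=
            Real.rpow_le_rpow_of_exponent_le (by linarith) (by linarith)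
        _ ≤ _ := by rw [Real.rpow_one]; linarith
    · linarith [abs_nonneg y]
    · linarith
  have hrho := one_add_div_mul_exp_le t y
  rw [← hs, ← hTdef] at hrho
  have hK : ‖sinKernel k t (w - 1)‖ ≤ C * (1 + |y|)⁻¹ * (5 * k * (1 + |y|) ^ (-(3 / 4) : ℝ)) *
      (37 * (T ^ 2 / 8) ^ (k - 2)) * P ^ (1 / 2 : ℝ) := by
    rw [sinKernel, norm_mul, hw1]
    have hPe : P ^ (1 / 2 - ε) ≤ P ^ (1 / 2 : ℝ) :=
      Real.rpow_le_rpow_of_exponent_le (by linarith [abs_nonneg y]) (by linarith)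
    calc _ ≤ (C * (1 + |y|)⁻¹ * (1 + (y / (2 * k - ε)) ^ 2) ^ (-(1 - 2 * ε) / 2) *
          ((1 + T ^ 2 * (1 + y ^ 2)⁻¹) * (T ^ 2 / 8) ^ (k - 2)) *
          (P ^ (1 / 2 - ε) * Real.exp (-(Real.pi * max |y| |t|)))) * Real.exp (Real.pi * |y|) := by
          gcongr
          · exact H k hk t y
          · exact norm_sin_le _ y
      _ = C * (1 + |y|)⁻¹ * (1 + (y / (2 * k - ε)) ^ 2) ^ (-(1 - 2 * ε) / 2) *
          (((1 + T ^ 2 * (1 + y ^ 2)⁻¹) * Real.exp (-(Real.pi * s))) * (T ^ 2 / 8) ^ (k - 2)) *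
          P ^ (1 / 2 - ε) := by
          rw [show -(Real.pi * s) = -(Real.pi * max |y| |t|) + Real.pi * |y| by rw [hs]; ring,
            Real.exp_add]
          ring
      _ ≤ _ := by gcongr
  have hnum := abs_add_sq_add_sq_le hk' t y
  rw [← hTdef] at hnum
  have hPP : P ^ (1 / 2 : ℝ) / (P / 4) ≤ 4 * (1 + |y|) ^ (-(1 / 2) : ℝ) := by
    have e : P ^ (1 / 2 : ℝ) / (P / 4) = 4 * P ^ (-(1 / 2) : ℝ) := by
      rw [show (-(1 / 2) : ℝ) = 1 / 2 - 1 by norm_num, Real.rpow_sub_one hP0.ne']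
      field_simp
    rw [e]
    gcongr 4 * ?_
    exact Real.rpow_le_rpow_of_nonpos hy hPy (by norm_num)
  have hypow : (1 + |y|)⁻¹ * (1 + |y|) ^ (-(3 / 4) : ℝ) * (1 + |y|) * (1 + |y|) ^ (-(1 / 2) : ℝ) =
      (1 + |y|) ^ (-(5 / 4) : ℝ) := by
    rw [mul_comm (1 + |y|)⁻¹, inv_mul_cancel_right₀ hy.ne', ← Real.rpow_add hy]
    norm_num
  have hpow := pow_three_mul_pow_le hk (HM k) hT
  have hmain : ‖sinKernel k t w - sinKernel k t (w - 1)‖ ≤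
      (C * (1 + |y|)⁻¹ * (5 * k * (1 + |y|) ^ (-(3 / 4) : ℝ)) *
      (37 * (T ^ 2 / 8) ^ (k - 2)) * P ^ (1 / 2 : ℝ)) * (k ^ 2 * T ^ 2 * (1 + |y|)) / (P / 4) := by
    rw [le_div_iff₀ (by positivity)]
    calc _ ≤ ‖sinKernel k t w - sinKernel k t (w - 1)‖ * ‖((1 / 2 - w) ^ 2 + t ^ 2 : ℂ)‖ := by
          gcongr
      _ = _ := hrel
      _ ≤ _ := by
          gcongr
          exact hN.trans hnum
  calc _ ≤ _ := hmain
    _ = C * 5 * 37 * ((k : ℝ) ^ 3 * (T ^ 2 / 8) ^ (k - 2) * T ^ 2) *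
        ((1 + |y|)⁻¹ * (1 + |y|) ^ (-(3 / 4) : ℝ) * (1 + |y|)) *
        (P ^ (1 / 2 : ℝ) / (P / 4)) := by ring
    _ ≤ C * 5 * 37 * (M * 4 * 16 * ((T ^ 2 / 4) ^ k / T)) *
        ((1 + |y|)⁻¹ * (1 + |y|) ^ (-(3 / 4) : ℝ) * (1 + |y|)) *
        (4 * (1 + |y|) ^ (-(1 / 2) : ℝ)) := by gcongr
    _ = C * 5 * 37 * 4 * (M * 4 * 16) * ((T ^ 2 / 4) ^ k / T) *
        ((1 + |y|)⁻¹ * (1 + |y|) ^ (-(3 / 4) : ℝ) * (1 + |y|) *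
          (1 + |y|) ^ (-(1 / 2) : ℝ)) := by ring
    _ = _ := by rw [hypow]

/-! ### Integration: uniform bounds for I₁ and I₂ -/

lemma integrable_inv_one_add_div_sq {S : ℝ} (hS : 0 < S) :
    Integrable fun y : ℝ => (1 + (y / S) ^ 2)⁻¹ :=
  integrable_inv_one_add_sq.comp_div hS.ne'

lemma integral_inv_one_add_div_sq {S : ℝ} (hS : 0 < S) :
    ∫ y : ℝ, (1 + (y / S) ^ 2)⁻¹ = S * Real.pi := by
  have := Measure.integral_comp_div (fun y : ℝ => (1 + y ^ 2)⁻¹) S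
  rw [this, integral_univ_inv_one_add_sq, abs_of_pos hS, smul_eq_mul]

lemma integrable_one_add_abs_rpow : Integrable fun y : ℝ => (1 + |y|) ^ (-(5 / 4) : ℝ) := by
  have := integrable_one_add_norm (E := ℝ) (μ := volume) (r := 5 / 4) (by norm_num)
  simpa [Real.norm_eq_abs] using this

theorem exists_cosh_mul_norm_I₂_right_le {δ : ℝ} (hδ : 0 < δ) (hδ' : δ ≤ 1 / 4) :
    ∃ C : ℝ, 0 < C ∧ ∀ k : ℕ, 2 ≤ k → ∀ t x : ℝ, 0 < x →
      Real.cosh (Real.pi * t) * ‖I₂ k 0 (t * Complex.I) x‖ ≤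
        C * x ^ (1 / 2 - δ) * (3 + |t|) := by
  obtain ⟨C, hC, H⟩ := exists_cosh_mul_norm_kernel_right_le hδ hδ'
  refine ⟨C * Real.pi, by positivity, fun k hk t x hx => ?_⟩
  have hk' : (2 : ℝ) ≤ k := by exact_mod_cast hk
  have hc := Real.cosh_pos (Real.pi * t)
  have hT : 0 < 3 + |t| := by positivity
  have h := norm_I₂_le hk t hx (σ := 1 / 2 - δ) (by linarith) (by linarith)
    (((integrable_inv_one_add_div_sq hT).const_mul C).div_const (Real.cosh (Real.pi * t)))
    (fun y => by rw [le_div_iff₀' hc]; exact H k hk t y)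
  rw [integral_div, integral_const_mul, integral_inv_one_add_div_sq hT, ← mul_div_assoc,
    le_div_iff₀' hc] at h
  linarith

theorem exists_cosh_mul_norm_I₂_left_le {δ : ℝ} (hδ : 0 < δ) (hδ' : δ ≤ 1 / 4) :
    ∃ C : ℝ, 0 < C ∧ ∀ k : ℕ, 2 ≤ k → ∀ t x : ℝ, 0 < x →
      Real.cosh (Real.pi * t) * ‖I₂ k 0 (t * Complex.I) x‖ ≤
        C * x ^ (-1 / 2 - δ) * (3 + |t|) ^ (1 + 2 * δ) := by
  obtain ⟨C, hC, H⟩ := exists_cosh_mul_norm_kernel_left_le hδ hδ'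
  refine ⟨C * Real.pi, by positivity, fun k hk t x hx => ?_⟩
  have hk' : (2 : ℝ) ≤ k := by exact_mod_cast hk
  have hc := Real.cosh_pos (Real.pi * t)
  have h := norm_I₂_le hk t hx (σ := -1 / 2 - δ) (by linarith) (by linarith)
    ((integrable_inv_one_add_sq.const_mul (C * (3 + |t|) ^ (1 + 2 * δ))).div_const
      (Real.cosh (Real.pi * t)))
    (fun y => by rw [le_div_iff₀' hc]; exact H k hk t y)
  rw [integral_div, integral_const_mul, integral_univ_inv_one_add_sq, ← mul_div_assoc,
    le_div_iff₀' hc] at h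
  linarith

theorem exists_cosh_mul_norm_I₂_edge_le {ε : ℝ} (hε : 0 < ε) (hε' : ε ≤ 1 / 8) :
    ∃ C : ℝ, 0 < C ∧ ∀ k : ℕ, 2 ≤ k → ∀ t x : ℝ, 0 < x →
      Real.cosh (Real.pi * t) * ‖I₂ k 0 (t * Complex.I) x‖ ≤
        C * x ^ (1 / 2 - k + ε) * (((3 + |t|) ^ 2 / 4) ^ k / (3 + |t|)) := by
  obtain ⟨C, hC, H⟩ := exists_cosh_mul_norm_kernel_edge_le hε hε'
  refine ⟨C * Real.pi, by positivity, fun k hk t x hx => ?_⟩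
  have hk' : (2 : ℝ) ≤ k := by exact_mod_cast hk
  have hc := Real.cosh_pos (Real.pi * t)
  have h := norm_I₂_le hk t hx (σ := 1 / 2 - k + ε) (by linarith) (by linarith)
    ((integrable_inv_one_add_sq.const_mul (C * (((3 + |t|) ^ 2 / 4) ^ k / (3 + |t|)))).div_const
      (Real.cosh (Real.pi * t)))
    (fun y => by rw [le_div_iff₀' hc]; exact H k hk t y)
  rw [integral_div, integral_const_mul, integral_univ_inv_one_add_sq, ← mul_div_assoc,
    le_div_iff₀' hc] at h
  linarith

theorem exists_norm_I₁_right_le {δ : ℝ} (hδ : 0 < δ) (hδ' : δ ≤ 1 / 4) :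
    ∃ C : ℝ, 0 < C ∧ ∀ k : ℕ, 2 ≤ k → ∀ t x : ℝ, 0 < x → x ≠ 1 →
      |1 - x| * ‖I₁ k 0 (t * Complex.I) x‖ ≤ C * x ^ (1 / 2 - δ) * (k + (3 + |t|)) := by
  obtain ⟨C, hC, H⟩ := exists_norm_sinKernel_sub_right_le hδ hδ'
  set J := ∫ y : ℝ, (1 + |y|) ^ (-(5 / 4) : ℝ) with hJ
  have hJ0 : 0 ≤ J := integral_nonneg fun y => by positivity
  refine ⟨C * (Real.pi + J), by positivity, fun k hk t x hx hx1 => ?_⟩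
  have hk' : (2 : ℝ) ≤ k := by exact_mod_cast hk
  have hS : 0 < (k : ℝ) + (3 + |t|) := by positivity
  have h := norm_I₁_le hk t hx hx1 (σ := 1 / 2 - δ) (by linarith) (by linarith)
    (((integrable_inv_one_add_div_sq hS).add integrable_one_add_abs_rpow).const_mul C)
    (fun y => H k hk t y)
  simp only [Pi.add_apply] at h
  rw [integral_const_mul, integral_add (integrable_inv_one_add_div_sq hS)
    integrable_one_add_abs_rpow, integral_inv_one_add_div_sq hS, ← hJ] at h
  refine h.trans ?_
  have hS1 : 1 ≤ (k : ℝ) + (3 + |t|) := by linarith [abs_nonneg t]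
  have : (k + (3 + |t|)) * Real.pi + J ≤ (Real.pi + J) * (k + (3 + |t|)) := by nlinarith
  calc _ ≤ x ^ (1 / 2 - δ) * (C * ((Real.pi + J) * (k + (3 + |t|)))) := by gcongr
    _ = _ := by ring

theorem exists_norm_I₁_edge_le {ε : ℝ} (hε : 0 < ε) (hε' : ε ≤ 1 / 8) :
    ∃ C : ℝ, 0 < C ∧ ∀ k : ℕ, 2 ≤ k → ∀ t x : ℝ, 0 < x → x ≠ 1 →
      |1 - x| * ‖I₁ k 0 (t * Complex.I) x‖ ≤
        C * x ^ (3 / 2 - k + ε) * (((3 + |t|) ^ 2 / 4) ^ k / (3 + |t|)) := by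
  obtain ⟨C, hC, H⟩ := exists_norm_sinKernel_sub_edge_le hε hε'
  set J := ∫ y : ℝ, (1 + |y|) ^ (-(5 / 4) : ℝ) with hJ
  have hJ0 : 0 ≤ J := integral_nonneg fun y => by positivity
  refine ⟨C * (1 + J), by positivity, fun k hk t x hx hx1 => ?_⟩
  have hk' : (2 : ℝ) ≤ k := by exact_mod_cast hk
  have h := norm_I₁_le hk t hx hx1 (σ := 3 / 2 - k + ε) (by linarith) (by linarith)
    (integrable_one_add_abs_rpow.const_mul _) (fun y => H k hk t y)
  rw [integral_const_mul, ← hJ] at h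
  refine h.trans ?_
  calc _ = C * J * x ^ (3 / 2 - k + ε) * (((3 + |t|) ^ 2 / 4) ^ k / (3 + |t|)) := by ring
    _ ≤ _ := by
        gcongr
        linarith

/-! ### The divisor bound -/

lemma add_one_le_mul_two_rpow {ε : ℝ} (hε : 0 < ε) (a : ℕ) :
    (a : ℝ) + 1 ≤ (1 + (ε * Real.log 2)⁻¹) * ((2 : ℝ) ^ a) ^ ε := by
  have hl : 0 < ε * Real.log 2 := mul_pos hε (Real.log_pos one_lt_two)
  have e : ((2 : ℝ) ^ a) ^ ε = Real.exp (a * (ε * Real.log 2)) := by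
    rw [← Real.rpow_natCast, ← Real.rpow_mul two_pos.le, Real.rpow_def_of_pos two_pos]
    congr 1; ring
  rw [e]
  have h1 := Real.add_one_le_exp (a * (ε * Real.log 2))
  have h2 : (a : ℝ) ≤ (ε * Real.log 2)⁻¹ * Real.exp (a * (ε * Real.log 2)) := by
    rw [← div_eq_inv_mul, le_div_iff₀ hl]
    linarith
  have h3 : 1 ≤ Real.exp (a * (ε * Real.log 2)) := Real.one_le_exp (by positivity)
  linarith

/-- The divisor bound `d(n) ≪ n ^ ε`. -/
theorem exists_card_divisors_le {ε : ℝ} (hε : 0 < ε) :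
    ∃ C : ℝ, 0 < C ∧ ∀ n : ℕ, n ≠ 0 → (n.divisors.card : ℝ) ≤ C * (n : ℝ) ^ ε := by
  set M : ℝ := 1 + (ε * Real.log 2)⁻¹ with hM
  have hM1 : 1 ≤ M := by
    have := mul_pos hε (Real.log_pos one_lt_two)
    rw [hM]; linarith [inv_pos.mpr this]
  -- Primes p ≥ 2^(1/ε) satisfy p^ε ≥ 2, so a + 1 ≤ 2^a ≤ p^(aε) costs nothing. Each of the fewer
  -- than P smaller primes costs a factor M.
  set P : ℕ := ⌈(2 : ℝ) ^ (1 / ε)⌉₊ with hP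
  refine ⟨M ^ P, by positivity, fun n hn => ?_⟩
  have hfac : ∀ p ∈ n.primeFactors, ((n.factorization p : ℝ) + 1) ≤
      (if p < P then M else 1) * ((p : ℝ) ^ n.factorization p) ^ ε := by
    intro p hp
    have hp2 : (2 : ℝ) ≤ p := by exact_mod_cast (Nat.prime_of_mem_primeFactors hp).two_le
    split_ifs with h
    · refine (add_one_le_mul_two_rpow hε _).trans ?_
      gcongr
    · rw [one_mul]
      have h1 : (2 : ℝ) ≤ (p : ℝ) ^ ε := by
        have : (2 : ℝ) ^ (1 / ε) ≤ p := (Nat.le_ceil _).trans (by exact_mod_cast not_lt.mp h)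
        calc (2 : ℝ) = ((2 : ℝ) ^ (1 / ε)) ^ ε := by
              rw [← Real.rpow_mul two_pos.le, one_div_mul_cancel hε.ne', Real.rpow_one]
          _ ≤ _ := by gcongr
      calc ((n.factorization p : ℝ) + 1) ≤ 2 ^ n.factorization p := by
            exact_mod_cast Nat.lt_two_pow_self
        _ ≤ ((p : ℝ) ^ ε) ^ n.factorization p := by gcongr
        _ = _ := by
            rw [← Real.rpow_natCast, ← Real.rpow_natCast, ← Real.rpow_mul (by positivity),
              ← Real.rpow_mul (by positivity), mul_comm]
  have hprod : (∏ p ∈ n.primeFactors, (p : ℝ) ^ n.factorization p) = n := by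
    exact_mod_cast Nat.prod_factorization_pow_eq_self hn
  rw [Nat.card_divisors hn]
  push_cast
  calc _ ≤ ∏ p ∈ n.primeFactors,
        ((if p < P then M else 1) * ((p : ℝ) ^ n.factorization p) ^ ε) :=
        Finset.prod_le_prod (fun _ _ => by positivity) hfac
    _ = (∏ p ∈ n.primeFactors, if p < P then M else 1) * (n : ℝ) ^ ε := by
        rw [Finset.prod_mul_distrib, Real.finsetProd_rpow _ _ (fun _ _ => by positivity), hprod]
    _ ≤ _ := by
        gcongr
        rw [Finset.prod_ite, Finset.prod_const, Finset.prod_const_one, mul_one]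
        refine pow_le_pow_right₀ hM1 ?_
        calc _ ≤ (Finset.range P).card := Finset.card_le_card fun p hp => by
              simpa using (Finset.mem_filter.mp hp).2
          _ = P := Finset.card_range P

lemma norm_tau_le (t : ℝ) (n : ℕ) : ‖tau (t * Complex.I) n‖ ≤ n.divisors.card := by
  unfold tau
  have hcard : n.divisorsAntidiagonal.card = n.divisors.card := by
    rw [← Nat.map_div_right_divisors, Finset.card_map]
  refine (norm_sum_le _ _).trans ?_
  rw [← hcard]
  refine (Finset.sum_le_card_nsmul _ _ 1 fun p hp => ?_).trans (by simp)
  obtain ⟨h1, h2⟩ := Nat.mem_divisorsAntidiagonal.mp hp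
  have hp1 : 0 < p.1 := Nat.pos_of_ne_zero fun h => h2 (by rw [← h1, h, zero_mul])
  have hp2 : 0 < p.2 := Nat.pos_of_ne_zero fun h => h2 (by rw [← h1, h, mul_zero])
  have : ((p.1 : ℂ) / (p.2 : ℂ)) = ((p.1 / p.2 : ℝ) : ℂ) := by push_cast; rfl
  rw [this, Complex.norm_cpow_eq_rpow_re_of_pos (by positivity)]
  simp

lemma norm_tau_zero_le (n : ℕ) : ‖tau 0 n‖ ≤ n.divisors.card := by
  simpa using norm_tau_le 0 n

/-! ### The terms of the three sums in terms of I₁ and I₂ -/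

lemma norm_hypH_neg (k : ℕ) (v : ℂ) {x : ℝ} (hx : 0 < x) :
    ‖hypH k 0 v (-x⁻¹)‖ = 1 / 2 * x ^ ((k : ℝ) - 1 / 2) * ‖I₂ k 0 v x‖ := by
  unfold hypH
  rw [if_neg (by have := inv_pos.mpr hx; linarith), neg_neg,
    show -1 / -x⁻¹ = x by field_simp, norm_mul, norm_mul,
    Complex.norm_cpow_eq_rpow_re_of_pos (inv_pos.mpr hx), Real.inv_rpow hx.le,
    ← Real.rpow_neg hx.le]
  simp

lemma norm_hypH_pos (k : ℕ) (v : ℂ) {x : ℝ} (hx : 0 < x) :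
    ‖hypH k 0 v x⁻¹‖ = 1 / 2 * x ^ ((k : ℝ) - 1 / 2) * ‖I₁ k 0 v x‖ := by
  unfold hypH
  have hc : ‖(1 / (2 * Complex.cos (Real.pi * ((k : ℂ) - 0))) : ℂ)‖ = 1 / 2 := by
    rw [sub_zero, show (Real.pi * (k : ℂ) : ℂ) = ((k * Real.pi : ℝ) : ℂ) by push_cast; ring,
      ← Complex.ofReal_cos, Real.cos_nat_mul_pi]
    simp
  rw [if_pos (inv_pos.mpr hx), show 1 / x⁻¹ = x by field_simp, norm_mul, norm_mul, hc,
    Complex.norm_cpow_eq_rpow_re_of_pos (inv_pos.mpr hx), Real.inv_rpow hx.le,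
    ← Real.rpow_neg hx.le]
  simp

/-- All k-th powers cancel: r^k a^(-k) (a/r)^(k-1/2) = (a/r)^(-1/2). -/
lemma pow_mul_norm_term_le (k : ℕ) (t : ℝ) (n : ℕ) {a r : ℕ} (ha : 0 < a) (hr : 0 < r) {h : ℂ}
    {J : ℝ} (hJ : 0 ≤ J) (hh : ‖h‖ = 1 / 2 * ((a : ℝ) / r) ^ ((k : ℝ) - 1 / 2) * J) :
    (r : ℝ) ^ k * ‖tau 0 n * tau (t * Complex.I) a / (a : ℂ) ^ k * h‖ ≤
      n.divisors.card * a.divisors.card * (((a : ℝ) / r) ^ (-(1 / 2) : ℝ) * J) := by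
  have ha' : (0 : ℝ) < a := by exact_mod_cast ha
  have hr' : (0 : ℝ) < r := by exact_mod_cast hr
  have h1 := norm_tau_zero_le n
  have h2 := norm_tau_le t a
  rw [norm_mul, norm_div, norm_mul, hh, norm_pow, Complex.norm_natCast]
  have e : (r : ℝ) ^ k / (a : ℝ) ^ k * ((a : ℝ) / r) ^ ((k : ℝ) - 1 / 2) =
      ((a : ℝ) / r) ^ (-(1 / 2) : ℝ) := by
    rw [sub_eq_add_neg, Real.rpow_add (by positivity), Real.rpow_natCast, div_pow]
    field_simp
  calc _ = ‖tau 0 n‖ * ‖tau (t * Complex.I) a‖ * (((r : ℝ) ^ k / (a : ℝ) ^ k *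
        ((a : ℝ) / r) ^ ((k : ℝ) - 1 / 2)) * (1 / 2 * J)) := by ring
    _ ≤ n.divisors.card * a.divisors.card * (((a : ℝ) / r) ^ (-(1 / 2) : ℝ) * J) := by
        rw [e]
        gcongr
        linarith

lemma pow_mul_norm_V₁term_le (k : ℕ) {N r n : ℕ} (t : ℝ) (hr : 1 ≤ r) (hn : 1 + r ≤ n * N) :
    (r : ℝ) ^ k * ‖V₁term k N (t * Complex.I) r n‖ ≤
      n.divisors.card * (n * N - r).divisors.card *
        ((((n * N - r : ℕ) : ℝ) / r) ^ (-(1 / 2) : ℝ) *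
          ‖I₂ k 0 (t * Complex.I) (((n * N - r : ℕ) : ℝ) / r)‖) := by
  have hr' : (0 : ℝ) < r := by exact_mod_cast hr
  have ha : 0 < n * N - r := by lia
  have ha' : (0 : ℝ) < ((n * N - r : ℕ) : ℝ) := by exact_mod_cast ha
  have hcast : ((n * N - r : ℕ) : ℝ) = (n : ℝ) * N - r := by
    rw [Nat.cast_sub (by lia)]; push_cast; ring
  unfold V₁term
  rw [if_pos hn]
  refine pow_mul_norm_term_le k t n ha hr (norm_nonneg _) ?_
  rw [← norm_hypH_neg k _ (by positivity), ← hcast]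
  congr 2
  rw [inv_div, neg_div]

lemma pow_mul_norm_V₃term_le (k : ℕ) {N r n : ℕ} (t : ℝ) (hr : 1 ≤ r) (hn : 1 ≤ n) :
    (r : ℝ) ^ k * ‖V₃term k N (t * Complex.I) r n‖ ≤
      n.divisors.card * (n * N + r).divisors.card *
        ((((n * N + r : ℕ) : ℝ) / r) ^ (-(1 / 2) : ℝ) *
          ‖I₁ k 0 (t * Complex.I) (((n * N + r : ℕ) : ℝ) / r)‖) := by
  have hr' : (0 : ℝ) < r := by exact_mod_cast hr
  have hcast : ((n * N + r : ℕ) : ℝ) = (n : ℝ) * N + r := by push_cast; ring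
  unfold V₃term
  rw [if_pos hn]
  refine pow_mul_norm_term_le k t n (by lia) hr (norm_nonneg _) ?_
  rw [← norm_hypH_pos k _ (by positivity), ← hcast, inv_div]

lemma pow_mul_norm_V₂_term_le (k : ℕ) {N r n : ℕ} (t : ℝ) (hr : 1 ≤ r) (hn : n * N < r) :
    (r : ℝ) ^ k * ‖tau 0 n * tau (t * Complex.I) (r - n * N) / ((r - n * N : ℕ) : ℂ) ^ k *
        hypH k 0 (t * Complex.I) ((r : ℝ) / ((r : ℝ) - n * N))‖ ≤
      n.divisors.card * (r - n * N).divisors.card *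
        ((((r - n * N : ℕ) : ℝ) / r) ^ (-(1 / 2) : ℝ) *
          ‖I₁ k 0 (t * Complex.I) (((r - n * N : ℕ) : ℝ) / r)‖) := by
  have hr' : (0 : ℝ) < r := by exact_mod_cast hr
  have ha : 0 < r - n * N := by lia
  have ha' : (0 : ℝ) < ((r - n * N : ℕ) : ℝ) := by exact_mod_cast ha
  have hcast : ((r - n * N : ℕ) : ℝ) = (r : ℝ) - n * N := by
    rw [Nat.cast_sub (by lia)]; push_cast; ring
  refine pow_mul_norm_term_le k t n ha hr (norm_nonneg _) ?_
  rw [← norm_hypH_pos k _ (by positivity), ← hcast, inv_div]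

/-! ### Term bounds of size (r/(nN))^(1+δ/2) -/

lemma two_mul_rpow_le {u p : ℝ} (hu : 0 ≤ u) (hp : p ≤ 2) : (2 * u) ^ p ≤ 4 * u ^ p := by
  rw [Real.mul_rpow two_pos.le hu]
  gcongr
  calc (2 : ℝ) ^ p ≤ 2 ^ (2 : ℝ) := Real.rpow_le_rpow_of_exponent_le one_le_two hp
    _ = 4 := by norm_num

set_option maxHeartbeats 800000 in
/-- Uniform bound for the terms of `V₁`. -/
lemma exists_V₁term_le {δ : ℝ} (hδ : 0 < δ) (hδ' : δ ≤ 1 / 4) :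
    ∃ C : ℝ, 0 < C ∧ ∀ k N r n : ℕ, ∀ t : ℝ, 2 ≤ k → 1 ≤ N → 1 ≤ r →
      Real.cosh (Real.pi * t) * ((r : ℝ) ^ k * ‖V₁term k N (t * Complex.I) r n‖) ≤
        C * ((r : ℝ) ^ (2 * δ) * (3 + |t|) ^ (2 * δ) * (k + (3 + |t|))) *
          ((r : ℝ) / N / n) ^ (1 + δ / 2) := by
  obtain ⟨C₁, hC₁, H₁⟩ := exists_cosh_mul_norm_I₂_right_le hδ hδ'
  obtain ⟨C₂, hC₂, H₂⟩ := exists_cosh_mul_norm_I₂_left_le hδ hδ'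
  obtain ⟨D, hD, HD⟩ := exists_card_divisors_le (show 0 < δ / 4 by linarith)
  refine ⟨D * D * (8 * C₁ + 4 * C₂), by positivity, fun k N r n t hk hN hr => ?_⟩
  set T := 3 + |t| with hT
  have hT3 : 3 ≤ T := by rw [hT]; linarith [abs_nonneg t]
  have hTk : T ≤ k + T := by linarith [Nat.cast_nonneg (α := ℝ) k]
  by_cases hcond : 1 + r ≤ n * N
  swap
  · rw [V₁term, if_neg hcond, norm_zero, mul_zero, mul_zero]
    positivity
  have hn : 1 ≤ n := by
    rcases Nat.eq_zero_or_pos n with rfl | h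
    · simp at hcond
    · exact h
  have hr' : (1 : ℝ) ≤ r := by exact_mod_cast hr
  have hn' : (1 : ℝ) ≤ n := by exact_mod_cast hn
  have hN' : (1 : ℝ) ≤ N := by exact_mod_cast hN
  set a := n * N - r with ha
  have ha1 : 1 ≤ a := by lia
  have ha' : (1 : ℝ) ≤ a := by exact_mod_cast ha1
  have hcast : (a : ℝ) = n * N - r := by
    rw [ha, Nat.cast_sub (by lia)]; push_cast; ring
  have hnN : (n : ℝ) ≤ n * N := by nlinarith
  have hc := Real.cosh_pos (Real.pi * t)
  set u : ℝ := (r : ℝ) / N / n with hu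
  have hu0 : 0 < u := by positivity
  have hur : (n : ℝ) * N = r / u := by rw [hu]; field_simp
  set x : ℝ := (a : ℝ) / r with hx
  have hx0 : 0 < x := by positivity
  have hterm := pow_mul_norm_V₁term_le k t hr hcond
  rw [← ha, ← hx] at hterm
  have hd1 := HD n (by lia)
  have hd2 := HD a (by lia)
  have hdd : (n.divisors.card : ℝ) * a.divisors.card ≤ D * D * ((n : ℝ) ^ (δ / 4) * a ^ (δ / 4)) := by
    calc _ ≤ (D * (n : ℝ) ^ (δ / 4)) * (D * (a : ℝ) ^ (δ / 4)) := by gcongr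
      _ = _ := by ring
  set J := ‖I₂ k 0 (t * Complex.I) x‖ with hJ
  have hstart : Real.cosh (Real.pi * t) * ((r : ℝ) ^ k * ‖V₁term k N (t * Complex.I) r n‖) ≤
      D * D * ((n : ℝ) ^ (δ / 4) * a ^ (δ / 4)) *
        (x ^ (-(1 / 2) : ℝ) * (Real.cosh (Real.pi * t) * J)) := by
    calc _ ≤ Real.cosh (Real.pi * t) * (n.divisors.card * a.divisors.card *
          (x ^ (-(1 / 2) : ℝ) * J)) := by gcongr
      _ = (n.divisors.card * a.divisors.card) *
          (x ^ (-(1 / 2) : ℝ) * (Real.cosh (Real.pi * t) * J)) := by ring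
      _ ≤ _ := by gcongr
  refine hstart.trans ?_
  -- Here x = 1/u - 1 with u = r/(nN). If nN ≤ 2r, then 2u ≥ 1, so no saving is needed, and the
  -- right line costs only x^(-δ) ≤ r^δ. If nN > 2r, then x ≥ 1/(2u), and the left line gives
  -- x^(-1-δ), hence u^(1+δ), of which u^(δ/2) goes to the divisor functions.
  rcases le_or_gt ((n : ℝ) * N) (2 * r) with hcase | hcase
  · have b1 : (n : ℝ) ^ (δ / 4) * (a : ℝ) ^ (δ / 4) ≤ 2 * (r : ℝ) ^ δ := by
      have hp : (n : ℝ) * a ≤ 2 * r ^ 2 := by nlinarith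
      calc _ = ((n : ℝ) * a) ^ (δ / 4) := (Real.mul_rpow (by positivity) (by positivity)).symm
        _ ≤ (2 * (r : ℝ) ^ 2) ^ (δ / 4) := by gcongr
        _ = 2 ^ (δ / 4) * (r : ℝ) ^ (δ / 2) := by
            rw [Real.mul_rpow (by positivity) (by positivity), ← Real.rpow_natCast,
              ← Real.rpow_mul (by positivity)]
            congr 2; push_cast; ring
        _ ≤ 2 ^ (1 : ℝ) * (r : ℝ) ^ δ := by
            gcongr
            · exact one_le_two
            · linarith
            · linarith
        _ = _ := by rw [Real.rpow_one]
    have b2 : x ^ (-(1 / 2) : ℝ) * (Real.cosh (Real.pi * t) * J) ≤ C₁ * T * (r : ℝ) ^ δ := by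
      have h1 := H₁ k hk t x hx0
      have h2 : x ^ (-δ) ≤ (r : ℝ) ^ δ := by
        have : (r : ℝ)⁻¹ ≤ x := by
          rw [hx, inv_eq_one_div]; gcongr
        calc x ^ (-δ) ≤ ((r : ℝ)⁻¹) ^ (-δ) :=
              Real.rpow_le_rpow_of_nonpos (by positivity) this (by linarith)
          _ = _ := by rw [Real.inv_rpow (by positivity), Real.rpow_neg (by positivity), inv_inv]
      calc _ ≤ x ^ (-(1 / 2) : ℝ) * (C₁ * x ^ (1 / 2 - δ) * T) := by gcongr
        _ = C₁ * T * (x ^ (-(1 / 2) : ℝ) * x ^ (1 / 2 - δ)) := by ring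
        _ = C₁ * T * x ^ (-δ) := by rw [← Real.rpow_add hx0]; ring_nf
        _ ≤ _ := by gcongr
    have b3 : 1 ≤ 4 * u ^ (1 + δ / 2) := by
      refine le_trans ?_ (two_mul_rpow_le hu0.le (by linarith))
      refine Real.one_le_rpow ?_ (by linarith)
      rw [hur, div_le_iff₀ hu0] at hcase
      exact le_of_mul_le_mul_left (by linarith) (show (0 : ℝ) < r by linarith)
    have b4 : T ≤ T ^ (2 * δ) * (k + T) := by
      have : 1 ≤ T ^ (2 * δ) := Real.one_le_rpow (by linarith) (by linarith)
      calc T = 1 * T := (one_mul T).symm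
        _ ≤ _ := by gcongr
    calc _ ≤ D * D * (2 * (r : ℝ) ^ δ) * (C₁ * T * (r : ℝ) ^ δ) := by gcongr
      _ = D * D * (2 * C₁) * ((r : ℝ) ^ (2 * δ) * T) * 1 := by
          rw [two_mul δ, Real.rpow_add (by positivity)]; ring
      _ ≤ D * D * (2 * C₁) * ((r : ℝ) ^ (2 * δ) * (T ^ (2 * δ) * (k + T))) *
          (4 * u ^ (1 + δ / 2)) := by gcongr
      _ = D * D * (8 * C₁) * ((r : ℝ) ^ (2 * δ) * T ^ (2 * δ) * (k + T)) * u ^ (1 + δ / 2) := by ring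
      _ ≤ _ := by gcongr; linarith
  · have b1 : (n : ℝ) ^ (δ / 4) * (a : ℝ) ^ (δ / 4) ≤ (r : ℝ) ^ (2 * δ) * u ^ (-(δ / 2)) := by
      have hp : (n : ℝ) * a ≤ (r / u) ^ 2 := by
        rw [← hur, pow_two]
        gcongr
        linarith
      calc _ = ((n : ℝ) * a) ^ (δ / 4) := (Real.mul_rpow (by positivity) (by positivity)).symm
        _ ≤ ((r / u) ^ 2) ^ (δ / 4) := by gcongr
        _ = (r : ℝ) ^ (δ / 2) * u ^ (-(δ / 2)) := by
            rw [← Real.rpow_natCast, ← Real.rpow_mul (by positivity),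
              Real.div_rpow (by positivity) hu0.le, Real.rpow_neg hu0.le, div_eq_mul_inv]
            norm_num
            ring_nf
        _ ≤ _ := by
            gcongr
            linarith
    have b2 : x ^ (-(1 / 2) : ℝ) * (Real.cosh (Real.pi * t) * J) ≤
        C₂ * T ^ (1 + 2 * δ) * (4 * u ^ (1 + δ)) := by
      have h1 := H₂ k hk t x hx0
      have h2 : x ^ (-1 - δ) ≤ 4 * u ^ (1 + δ) := by
        have : (2 * u)⁻¹ ≤ x := by
          rw [inv_eq_one_div, div_le_iff₀ (by positivity), hx, hcast, hur]
          have : 2 * u < 1 := by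
            rw [hur, lt_div_iff₀ hu0] at hcase
            exact lt_of_mul_lt_mul_left (by linarith) (show (0 : ℝ) ≤ r by linarith)
          have e : (r / u - r) / r * (2 * u) = 2 * (1 - u) := by field_simp
          rw [e]
          linarith
        calc x ^ (-1 - δ) ≤ ((2 * u)⁻¹) ^ (-1 - δ) :=
              Real.rpow_le_rpow_of_nonpos (by positivity) this (by linarith)
          _ = (2 * u) ^ (1 + δ) := by
              rw [Real.inv_rpow (by positivity), ← Real.rpow_neg (by positivity)]
              congr 1; ring
          _ ≤ _ := two_mul_rpow_le hu0.le (by linarith)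
      calc _ ≤ x ^ (-(1 / 2) : ℝ) * (C₂ * x ^ (-1 / 2 - δ) * T ^ (1 + 2 * δ)) := by gcongr
        _ = C₂ * T ^ (1 + 2 * δ) * (x ^ (-(1 / 2) : ℝ) * x ^ (-1 / 2 - δ)) := by ring
        _ = C₂ * T ^ (1 + 2 * δ) * x ^ (-1 - δ) := by rw [← Real.rpow_add hx0]; ring_nf
        _ ≤ _ := by gcongr
    have b4 : T ^ (1 + 2 * δ) ≤ T ^ (2 * δ) * (k + T) := by
      rw [add_comm, Real.rpow_add (by linarith), Real.rpow_one]
      gcongr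
    have b5 : u ^ (-(δ / 2)) * u ^ (1 + δ) = u ^ (1 + δ / 2) := by
      rw [← Real.rpow_add hu0]; congr 1; ring
    calc _ ≤ D * D * ((r : ℝ) ^ (2 * δ) * u ^ (-(δ / 2))) *
          (C₂ * T ^ (1 + 2 * δ) * (4 * u ^ (1 + δ))) := by gcongr
      _ = D * D * (4 * C₂) * ((r : ℝ) ^ (2 * δ) * T ^ (1 + 2 * δ)) *
          (u ^ (-(δ / 2)) * u ^ (1 + δ)) := by ring
      _ ≤ D * D * (4 * C₂) * ((r : ℝ) ^ (2 * δ) * (T ^ (2 * δ) * (k + T))) *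
          u ^ (1 + δ / 2) := by rw [b5]; gcongr
      _ = D * D * (4 * C₂) * ((r : ℝ) ^ (2 * δ) * T ^ (2 * δ) * (k + T)) * u ^ (1 + δ / 2) := by ring
      _ ≤ _ := by gcongr; linarith

/-- Uniform bound for the terms of `V₃`. -/
lemma exists_V₃term_le {δ : ℝ} (hδ : 0 < δ) (hδ' : δ ≤ 1 / 4) :
    ∃ C : ℝ, 0 < C ∧ ∀ k N r n : ℕ, ∀ t : ℝ, 2 ≤ k → 1 ≤ N → 1 ≤ r →
      (r : ℝ) ^ k * ‖V₃term k N (t * Complex.I) r n‖ ≤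
        C * ((r : ℝ) ^ (2 * δ) * (3 + |t|) ^ (2 * δ) * (k + (3 + |t|))) *
          ((r : ℝ) / N / n) ^ (1 + δ / 2) := by
  obtain ⟨C₁, hC₁, H₁⟩ := exists_norm_I₁_right_le hδ hδ'
  obtain ⟨D, hD, HD⟩ := exists_card_divisors_le (show 0 < δ / 4 by linarith)
  refine ⟨D * D * C₁, by positivity, fun k N r n t hk hN hr => ?_⟩
  set T := 3 + |t| with hT
  have hT3 : 3 ≤ T := by rw [hT]; linarith [abs_nonneg t]
  by_cases hn : 1 ≤ n
  swap
  · rw [V₃term, if_neg hn, norm_zero, mul_zero]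
    positivity
  have hr' : (1 : ℝ) ≤ r := by exact_mod_cast hr
  have hn' : (1 : ℝ) ≤ n := by exact_mod_cast hn
  have hN' : (1 : ℝ) ≤ N := by exact_mod_cast hN
  have hterm := pow_mul_norm_V₃term_le k (N := N) t hr hn
  set a := n * N + r with ha
  have hcast : (a : ℝ) = n * N + r := by rw [ha]; push_cast; ring
  have hna : (n : ℝ) ≤ a := by rw [hcast]; nlinarith
  set u : ℝ := (r : ℝ) / N / n with hu
  have hu0 : 0 < u := by positivity
  set x : ℝ := (a : ℝ) / r with hx
  have ha0 : (0 : ℝ) < a := by linarith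
  have hx0 : 0 < x := by positivity
  have hxu : x = 1 + u⁻¹ := by rw [hx, hcast, hu]; field_simp; ring
  have hui : 0 < u⁻¹ := inv_pos.mpr hu0
  have hax : (a : ℝ) = r * x := by rw [hx]; field_simp
  have hd1 := HD n (by lia)
  have hd2 := HD a (by lia)
  have hdd : (n.divisors.card : ℝ) * a.divisors.card ≤ D * D * ((r : ℝ) ^ (2 * δ) * x ^ (δ / 2)) := by
    calc _ ≤ (D * (a : ℝ) ^ (δ / 4)) * (D * (a : ℝ) ^ (δ / 4)) := by
          gcongr
          exact hd1.trans (by gcongr)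
      _ = D * D * ((r : ℝ) ^ (δ / 2) * x ^ (δ / 2)) := by
          rw [← Real.mul_rpow (by positivity) hx0.le, ← hax,
            show δ / 2 = δ / 4 + δ / 4 by ring, Real.rpow_add ha0]
          ring
      _ ≤ _ := by
          gcongr
          linarith
  have h1 := H₁ k hk t x hx0 (by rw [hxu]; linarith)
  set J := ‖I₁ k 0 (t * Complex.I) x‖ with hJ
  have habs : |1 - x| = u⁻¹ := by
    rw [hxu, show 1 - (1 + u⁻¹) = -u⁻¹ by ring, abs_neg, abs_of_pos hui]
  rw [habs, inv_mul_le_iff₀ hu0] at h1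
  -- Half of the available x^(-δ) is spent on the divisor functions; the other half makes the sum
  -- over n converge.
  have hxp : x ^ (-(δ / 2)) ≤ u ^ (δ / 2) := by
    calc x ^ (-(δ / 2)) ≤ (u⁻¹) ^ (-(δ / 2)) :=
          Real.rpow_le_rpow_of_nonpos hui (by rw [hxu]; linarith) (by linarith)
      _ = _ := by rw [Real.inv_rpow hu0.le, Real.rpow_neg hu0.le, inv_inv]
  have hTp : 1 ≤ T ^ (2 * δ) := Real.one_le_rpow (by linarith) (by linarith)
  have hkT : 0 ≤ k + T := by positivity
  calc _ ≤ _ := hterm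
    _ ≤ D * D * ((r : ℝ) ^ (2 * δ) * x ^ (δ / 2)) *
        (x ^ (-(1 / 2) : ℝ) * (u * (C₁ * x ^ (1 / 2 - δ) * (k + T)))) := by gcongr
    _ = D * D * C₁ * ((r : ℝ) ^ (2 * δ) * 1 * (k + T)) *
        (u * (x ^ (δ / 2) * x ^ (-(1 / 2) : ℝ) * x ^ (1 / 2 - δ))) := by ring
    _ = D * D * C₁ * ((r : ℝ) ^ (2 * δ) * 1 * (k + T)) * (u * x ^ (-(δ / 2))) := by
        rw [← Real.rpow_add hx0, ← Real.rpow_add hx0]; ring_nf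
    _ ≤ D * D * C₁ * ((r : ℝ) ^ (2 * δ) * T ^ (2 * δ) * (k + T)) * (u * u ^ (δ / 2)) := by gcongr
    _ = _ := by rw [Real.rpow_add hu0, Real.rpow_one]

/-- Uniform bound for the terms of `V₂`. -/
lemma exists_V₂_term_le {δ : ℝ} (hδ : 0 < δ) (hδ' : δ ≤ 1 / 4) :
    ∃ C : ℝ, 0 < C ∧ ∀ k N r n : ℕ, ∀ t : ℝ, 2 ≤ k → 1 ≤ N → 1 ≤ r → 1 ≤ n → n * N < r →
      (r : ℝ) ^ k * ‖tau 0 n * tau (t * Complex.I) (r - n * N) / ((r - n * N : ℕ) : ℂ) ^ k *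
        hypH k 0 (t * Complex.I) ((r : ℝ) / ((r : ℝ) - n * N))‖ ≤
        C * ((r : ℝ) ^ (2 * δ) * (3 + |t|) ^ (2 * δ) * (k + (3 + |t|))) *
          ((r : ℝ) / N / n) ^ (1 + δ / 2) := by
  obtain ⟨C₁, hC₁, H₁⟩ := exists_norm_I₁_right_le hδ hδ'
  obtain ⟨D, hD, HD⟩ := exists_card_divisors_le (show 0 < δ / 4 by linarith)
  refine ⟨D * D * C₁, by positivity, fun k N r n t hk hN hr hn hnr => ?_⟩
  set T := 3 + |t| with hT
  have hT3 : 3 ≤ T := by rw [hT]; linarith [abs_nonneg t]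
  have hr' : (1 : ℝ) ≤ r := by exact_mod_cast hr
  have hn' : (1 : ℝ) ≤ n := by exact_mod_cast hn
  have hN' : (1 : ℝ) ≤ N := by exact_mod_cast hN
  have hterm := pow_mul_norm_V₂_term_le k t hr hnr
  set a := r - n * N with ha
  have hcast : (a : ℝ) = r - n * N := by
    rw [ha, Nat.cast_sub (by lia)]; push_cast; ring
  have ha1 : 1 ≤ a := by lia
  have ha' : (1 : ℝ) ≤ a := by exact_mod_cast ha1
  have hnr' : (n : ℝ) * N ≤ r := by exact_mod_cast hnr.le
  have hnr2 : (n : ℝ) ≤ r := by nlinarith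
  have har : (a : ℝ) ≤ r := by rw [hcast]; nlinarith
  set u : ℝ := (r : ℝ) / N / n with hu
  have hu0 : 0 < u := by positivity
  have hu1 : 1 ≤ u := by
    rw [hu, div_div, le_div_iff₀ (by positivity)]
    linarith
  set x : ℝ := (a : ℝ) / r with hx
  have hx0 : 0 < x := by positivity
  have hxu : x = 1 - u⁻¹ := by rw [hx, hcast, hu]; field_simp
  have hui : 0 < u⁻¹ := inv_pos.mpr hu0
  have hd1 := HD n (by lia)
  have hd2 := HD a (by lia)
  have hdd : (n.divisors.card : ℝ) * a.divisors.card ≤ D * D * (r : ℝ) ^ δ := by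
    calc _ ≤ (D * (r : ℝ) ^ (δ / 4)) * (D * (r : ℝ) ^ (δ / 4)) := by
          gcongr
          · exact hd1.trans (by gcongr)
          · exact hd2.trans (by gcongr)
      _ = D * D * (r : ℝ) ^ (δ / 2) := by
          rw [show δ / 2 = δ / 4 + δ / 4 by ring, Real.rpow_add (by linarith)]
          ring
      _ ≤ _ := by
          gcongr
          linarith
  have h1 := H₁ k hk t x hx0 (by rw [hxu]; linarith)
  set J := ‖I₁ k 0 (t * Complex.I) x‖ with hJ
  have habs : |1 - x| = u⁻¹ := by
    rw [hxu, show 1 - (1 - u⁻¹) = u⁻¹ by ring, abs_of_pos hui]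
  rw [habs, inv_mul_le_iff₀ hu0] at h1
  have hxp : x ^ (-δ) ≤ (r : ℝ) ^ δ := by
    have : (r : ℝ)⁻¹ ≤ x := by
      rw [hx, inv_eq_one_div]; gcongr
    calc x ^ (-δ) ≤ ((r : ℝ)⁻¹) ^ (-δ) :=
          Real.rpow_le_rpow_of_nonpos (by positivity) this (by linarith)
      _ = _ := by rw [Real.inv_rpow (by positivity), Real.rpow_neg (by positivity), inv_inv]
  have hTp : 1 ≤ T ^ (2 * δ) := Real.one_le_rpow (by linarith) (by linarith)
  have hkT : 0 ≤ k + T := by positivity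
  -- As nN < r gives u ≥ 1, the exponent may be raised to the common shape of the three bounds.
  have hup : u ≤ u ^ (1 + δ / 2) := Real.self_le_rpow_of_one_le hu1 (by linarith)
  calc _ ≤ _ := hterm
    _ ≤ D * D * (r : ℝ) ^ δ *
        (x ^ (-(1 / 2) : ℝ) * (u * (C₁ * x ^ (1 / 2 - δ) * (k + T)))) := by gcongr
    _ = D * D * C₁ * ((r : ℝ) ^ δ * (x ^ (-(1 / 2) : ℝ) * x ^ (1 / 2 - δ)) * 1 * (k + T)) * u := by
        ring
    _ = D * D * C₁ * ((r : ℝ) ^ δ * x ^ (-δ) * 1 * (k + T)) * u := by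
        rw [← Real.rpow_add hx0]; ring_nf
    _ ≤ D * D * C₁ * ((r : ℝ) ^ δ * (r : ℝ) ^ δ * T ^ (2 * δ) * (k + T)) * u ^ (1 + δ / 2) := by
        gcongr
    _ = _ := by rw [two_mul δ, Real.rpow_add (show (0 : ℝ) < r by linarith)]

/-! ### Term bounds for r ≤ l < N -/

/-- Since k ≥ 2, the power (L/n)^k yields L^k n^(-2). The divisor functions and x^ε together cost
(2nN)^(2ε), whose n-part is at most n^(1/2), so n^(-3/2) remains. -/
lemma rpow_mul_rpow_edge_le {ε : ℝ} (hε : 0 < ε) (hε' : ε ≤ 1 / 8) {k n N : ℕ} (hk : 2 ≤ k)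
    (hn : 1 ≤ n) (hN : 1 ≤ N) {x L : ℝ} (hx0 : 0 < x) (hx : x ≤ 2 * (n * N))
    (hL : x⁻¹ ≤ L / n) :
    (2 * ((n : ℝ) * N)) ^ ε * x ^ (-(k : ℝ) + ε) ≤
      2 * (L ^ k * (N : ℝ) ^ (2 * ε) * (1 / (n : ℝ) ^ (3 / 2 : ℝ))) := by
  have hn' : (1 : ℝ) ≤ n := by exact_mod_cast hn
  have hN' : (1 : ℝ) ≤ N := by exact_mod_cast hN
  have hLn : 0 < L / n := (inv_pos.mpr hx0).trans_le hL
  have hL0 : 0 ≤ L := by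
    have := mul_pos hLn (show (0 : ℝ) < n by linarith)
    rw [div_mul_cancel₀ _ (by positivity)] at this
    exact this.le
  have h1 : x ^ (-(k : ℝ) + ε) ≤ L ^ k / (n : ℝ) ^ 2 * (2 * ((n : ℝ) * N)) ^ ε := by
    rw [Real.rpow_add hx0, Real.rpow_neg hx0.le, Real.rpow_natCast, ← inv_pow]
    gcongr
    calc (x⁻¹) ^ k ≤ (L / n) ^ k := by gcongr
      _ = L ^ k / (n : ℝ) ^ k := div_pow _ _ _
      _ ≤ _ := by gcongr
  have h2 : (2 * ((n : ℝ) * N)) ^ ε * (2 * ((n : ℝ) * N)) ^ ε ≤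
      2 * ((n : ℝ) ^ (1 / 2 : ℝ) * (N : ℝ) ^ (2 * ε)) := by
    rw [← Real.rpow_add (by positivity), ← two_mul, Real.mul_rpow (by positivity) (by positivity),
      Real.mul_rpow (by positivity) (by positivity)]
    gcongr
    · calc (2 : ℝ) ^ (2 * ε) ≤ 2 ^ (1 : ℝ) :=
            Real.rpow_le_rpow_of_exponent_le one_le_two (by linarith)
        _ = 2 := Real.rpow_one 2
    · linarith
  have h3 : (n : ℝ) ^ (1 / 2 : ℝ) / (n : ℝ) ^ 2 = 1 / (n : ℝ) ^ (3 / 2 : ℝ) := by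
    rw [← Real.rpow_natCast, ← Real.rpow_sub (by positivity),
      one_div ((n : ℝ) ^ (3 / 2 : ℝ)), ← Real.rpow_neg (by positivity)]
    norm_num
  calc _ ≤ (2 * ((n : ℝ) * N)) ^ ε * (L ^ k / (n : ℝ) ^ 2 * (2 * ((n : ℝ) * N)) ^ ε) := by gcongr
    _ = L ^ k / (n : ℝ) ^ 2 * ((2 * ((n : ℝ) * N)) ^ ε * (2 * ((n : ℝ) * N)) ^ ε) := by ring
    _ ≤ L ^ k / (n : ℝ) ^ 2 * (2 * ((n : ℝ) ^ (1 / 2 : ℝ) * (N : ℝ) ^ (2 * ε))) := by gcongr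
    _ = 2 * (L ^ k * (N : ℝ) ^ (2 * ε) * ((n : ℝ) ^ (1 / 2 : ℝ) / (n : ℝ) ^ 2)) := by ring
    _ = _ := by rw [h3]

lemma card_divisors_mul_le {ε D : ℝ} (hε : 0 < ε) (hD : 0 < D)
    (HD : ∀ n : ℕ, n ≠ 0 → (n.divisors.card : ℝ) ≤ D * (n : ℝ) ^ (ε / 2)) {n a : ℕ} (hn : 1 ≤ n)
    (ha : 1 ≤ a) {B : ℝ} (hnB : (n : ℝ) ≤ B) (haB : (a : ℝ) ≤ B) :
    (n.divisors.card : ℝ) * a.divisors.card ≤ D * D * B ^ ε := by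
  have hB : 0 < B := lt_of_lt_of_le (by exact_mod_cast hn) hnB
  calc _ ≤ (D * B ^ (ε / 2)) * (D * B ^ (ε / 2)) := by
        gcongr
        · exact (HD n (by lia)).trans (by gcongr)
        · exact (HD a (by lia)).trans (by gcongr)
    _ = D * D * (B ^ (ε / 2) * B ^ (ε / 2)) := by ring
    _ = _ := by rw [← Real.rpow_add hB]; ring_nf

/-- The terms of `V₁` for small `r`. -/
lemma exists_V₁term_edge_le {ε : ℝ} (hε : 0 < ε) (hε' : ε ≤ 1 / 8) :
    ∃ C : ℝ, 0 < C ∧ ∀ k N l r n : ℕ, ∀ t : ℝ, 2 ≤ k → 1 ≤ r → r ≤ l → l < N →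
      Real.cosh (Real.pi * t) * ((r : ℝ) ^ k * ‖V₁term k N (t * Complex.I) r n‖) ≤
        C * (((3 + |t|) ^ 2 / 4) ^ k / (3 + |t|) * ((l : ℝ) / (N - l)) ^ k *
          (N : ℝ) ^ (2 * ε)) * (1 / (n : ℝ) ^ (3 / 2 : ℝ)) := by
  obtain ⟨C₁, hC₁, H₁⟩ := exists_cosh_mul_norm_I₂_edge_le hε hε'
  obtain ⟨D, hD, HD⟩ := exists_card_divisors_le (show 0 < ε / 2 by linarith)
  refine ⟨D * D * C₁ * 2, by positivity, fun k N l r n t hk hr hrl hlN => ?_⟩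
  have hrl' : (r : ℝ) ≤ l := by exact_mod_cast hrl
  have hlN' : (l : ℝ) < N := by exact_mod_cast hlN
  have hNl : 0 < (N : ℝ) - l := by linarith
  set Q : ℝ := ((3 + |t|) ^ 2 / 4) ^ k / (3 + |t|) with hQ
  have hQ0 : 0 ≤ Q := by positivity
  by_cases hcond : 1 + r ≤ n * N
  swap
  · rw [V₁term, if_neg hcond, norm_zero, mul_zero, mul_zero]
    positivity
  have hn : 1 ≤ n := by
    rcases Nat.eq_zero_or_pos n with rfl | h
    · simp at hcond
    · exact h
  have hN : 1 ≤ N := by lia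
  have hr' : (1 : ℝ) ≤ r := by exact_mod_cast hr
  have hn' : (1 : ℝ) ≤ n := by exact_mod_cast hn
  have hN' : (1 : ℝ) ≤ N := by exact_mod_cast hN
  have hterm := pow_mul_norm_V₁term_le k t hr hcond
  set a := n * N - r with ha
  have ha1 : 1 ≤ a := by lia
  have ha' : (1 : ℝ) ≤ a := by exact_mod_cast ha1
  have hcast : (a : ℝ) = n * N - r := by
    rw [ha, Nat.cast_sub (by lia)]; push_cast; ring
  have hnN : (n : ℝ) ≤ n * N := le_mul_of_one_le_right (by linarith) hN'
  have hc := Real.cosh_pos (Real.pi * t)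
  set x : ℝ := (a : ℝ) / r with hx
  have hx0 : 0 < x := by positivity
  have hx2 : x ≤ 2 * (n * N) := by
    rw [hx, div_le_iff₀ (by linarith)]
    nlinarith
  -- From r ≤ l ≤ nl one has a = nN - r ≥ n(N - l).
  have hxL : x⁻¹ ≤ (l : ℝ) / (N - l) / n := by
    rw [hx, inv_div, div_div, div_le_div_iff₀ (by linarith) (by positivity), hcast]
    nlinarith [mul_nonneg (mul_nonneg (by linarith : (0 : ℝ) ≤ n) (by linarith : (0 : ℝ) ≤ N))
      (sub_nonneg.mpr hrl'), mul_nonneg (mul_nonneg (by linarith : (0 : ℝ) ≤ l)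
      (by linarith : (0 : ℝ) ≤ r)) (sub_nonneg.mpr hn')]
  have hdd := card_divisors_mul_le hε hD HD hn ha1 (B := 2 * (n * N)) (by linarith) (by linarith)
  have h1 := H₁ k hk t x hx0
  set J := ‖I₂ k 0 (t * Complex.I) x‖ with hJ
  have hk2 := rpow_mul_rpow_edge_le hε hε' hk hn hN hx0 hx2 hxL
  calc _ ≤ Real.cosh (Real.pi * t) * (n.divisors.card * a.divisors.card *
        (x ^ (-(1 / 2) : ℝ) * J)) := by gcongr
    _ = (n.divisors.card * a.divisors.card) *
        (x ^ (-(1 / 2) : ℝ) * (Real.cosh (Real.pi * t) * J)) := by ring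
    _ ≤ (D * D * (2 * ((n : ℝ) * N)) ^ ε) *
        (x ^ (-(1 / 2) : ℝ) * (C₁ * x ^ (1 / 2 - k + ε) * Q)) := by gcongr
    _ = D * D * C₁ * Q * ((2 * ((n : ℝ) * N)) ^ ε *
        (x ^ (-(1 / 2) : ℝ) * x ^ (1 / 2 - k + ε))) := by ring
    _ = D * D * C₁ * Q * ((2 * ((n : ℝ) * N)) ^ ε * x ^ (-(k : ℝ) + ε)) := by
        rw [← Real.rpow_add hx0]; ring_nf
    _ ≤ D * D * C₁ * Q * (2 * (((l : ℝ) / (N - l)) ^ k * (N : ℝ) ^ (2 * ε) *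
        (1 / (n : ℝ) ^ (3 / 2 : ℝ)))) := by gcongr
    _ = _ := by ring

/-- The terms of `V₃` for small `r`. -/
lemma exists_V₃term_edge_le {ε : ℝ} (hε : 0 < ε) (hε' : ε ≤ 1 / 8) :
    ∃ C : ℝ, 0 < C ∧ ∀ k N l r n : ℕ, ∀ t : ℝ, 2 ≤ k → 1 ≤ r → r ≤ l → l < N →
      (r : ℝ) ^ k * ‖V₃term k N (t * Complex.I) r n‖ ≤
        C * (((3 + |t|) ^ 2 / 4) ^ k / (3 + |t|) * ((l : ℝ) / (N - l)) ^ k *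
          (N : ℝ) ^ (2 * ε)) * (1 / (n : ℝ) ^ (3 / 2 : ℝ)) := by
  obtain ⟨C₁, hC₁, H₁⟩ := exists_norm_I₁_edge_le hε hε'
  obtain ⟨D, hD, HD⟩ := exists_card_divisors_le (show 0 < ε / 2 by linarith)
  refine ⟨D * D * C₁ * 4, by positivity, fun k N l r n t hk hr hrl hlN => ?_⟩
  have hrl' : (r : ℝ) ≤ l := by exact_mod_cast hrl
  have hlN' : (l : ℝ) < N := by exact_mod_cast hlN
  have hNl : 0 < (N : ℝ) - l := by linarith
  set Q : ℝ := ((3 + |t|) ^ 2 / 4) ^ k / (3 + |t|) with hQ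
  have hQ0 : 0 ≤ Q := by positivity
  by_cases hn : 1 ≤ n
  swap
  · rw [V₃term, if_neg hn, norm_zero, mul_zero]
    positivity
  have hN : 1 ≤ N := by lia
  have hr' : (1 : ℝ) ≤ r := by exact_mod_cast hr
  have hn' : (1 : ℝ) ≤ n := by exact_mod_cast hn
  have hN' : (1 : ℝ) ≤ N := by exact_mod_cast hN
  have hterm := pow_mul_norm_V₃term_le k (N := N) t hr hn
  set a := n * N + r with ha
  have ha1 : 1 ≤ a := by lia
  have ha' : (1 : ℝ) ≤ a := by exact_mod_cast ha1
  have hcast : (a : ℝ) = n * N + r := by rw [ha]; push_cast; ring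
  have hnN : (n : ℝ) ≤ n * N := le_mul_of_one_le_right (by linarith) hN'
  have hNn : (N : ℝ) ≤ n * N := le_mul_of_one_le_left (by linarith) hn'
  set x : ℝ := (a : ℝ) / r with hx
  have hx0 : 0 < x := by positivity
  have hx2 : x ≤ 2 * (n * N) := by
    rw [hx, div_le_iff₀ (by linarith)]
    nlinarith
  -- Here x = 1 + nN/r and r < N; hence |1 - x| ≥ x/2, and dividing by it lowers the exponent 3/2 -
  -- k + ε to 1/2 - k + ε, as for I₂.
  have hxge : 2 ≤ x := by
    rw [hx, le_div_iff₀ (by linarith)]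
    linarith
  have hxL : x⁻¹ ≤ (l : ℝ) / (N - l) / n := by
    rw [hx, inv_div, div_div, div_le_div_iff₀ (by linarith) (by positivity), hcast]
    nlinarith [mul_nonneg (mul_nonneg (by linarith : (0 : ℝ) ≤ n) (by linarith : (0 : ℝ) ≤ N))
      (sub_nonneg.mpr hrl'), mul_nonneg (mul_nonneg (by linarith : (0 : ℝ) ≤ l)
      (by linarith : (0 : ℝ) ≤ r)) (by linarith : (0 : ℝ) ≤ n)]
  have hdd := card_divisors_mul_le hε hD HD hn ha1 (B := 2 * (n * N)) (by linarith) (by linarith)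
  have h1 := H₁ k hk t x hx0 (by linarith)
  set J := ‖I₁ k 0 (t * Complex.I) x‖ with hJ
  have hJ0 : 0 ≤ J := norm_nonneg _
  have hJx : J ≤ 2 * (C₁ * x ^ (1 / 2 - k + ε) * Q) := by
    rw [abs_sub_comm, abs_of_nonneg (by linarith),
      show (3 / 2 - k + ε : ℝ) = (1 / 2 - k + ε) + 1 by ring, Real.rpow_add_one hx0.ne'] at h1
    have : x * J ≤ x * (2 * (C₁ * x ^ (1 / 2 - k + ε) * Q)) := by nlinarith
    exact le_of_mul_le_mul_left this hx0
  have hk2 := rpow_mul_rpow_edge_le hε hε' hk hn hN hx0 hx2 hxL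
  calc _ ≤ n.divisors.card * a.divisors.card * (x ^ (-(1 / 2) : ℝ) * J) := hterm
    _ ≤ (D * D * (2 * ((n : ℝ) * N)) ^ ε) *
        (x ^ (-(1 / 2) : ℝ) * (2 * (C₁ * x ^ (1 / 2 - k + ε) * Q))) := by gcongr
    _ = D * D * C₁ * Q * 2 * ((2 * ((n : ℝ) * N)) ^ ε *
        (x ^ (-(1 / 2) : ℝ) * x ^ (1 / 2 - k + ε))) := by ring
    _ = D * D * C₁ * Q * 2 * ((2 * ((n : ℝ) * N)) ^ ε * x ^ (-(k : ℝ) + ε)) := by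
        rw [← Real.rpow_add hx0]; ring_nf
    _ ≤ D * D * C₁ * Q * 2 * (2 * (((l : ℝ) / (N - l)) ^ k * (N : ℝ) ^ (2 * ε) *
        (1 / (n : ℝ) ^ (3 / 2 : ℝ)))) := by gcongr
    _ = _ := by ring

/-! ### Summation over n, r, d and the theorem -/

lemma mul_norm_tsum_le {f : ℕ → ℂ} {c A p : ℝ} (hc : 0 < c) (hp : 1 < p)
    (h : ∀ n, c * ‖f n‖ ≤ A * (1 / (n : ℝ) ^ p)) :
    Summable f ∧ c * ‖∑' n, f n‖ ≤ A * ∑' n : ℕ, 1 / (n : ℝ) ^ p := by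
  have hs := Real.summable_one_div_nat_rpow.mpr hp
  have hb : ∀ n, ‖f n‖ ≤ A / c * (1 / (n : ℝ) ^ p) := fun n => by
    rw [div_mul_eq_mul_div, le_div_iff₀' hc]
    exact h n
  have hs2 := hs.mul_left (A / c)
  refine ⟨Summable.of_norm_bounded hs2 hb, ?_⟩
  have := tsum_of_norm_bounded hs2.hasSum hb
  rw [tsum_mul_left, div_mul_eq_mul_div, le_div_iff₀' hc] at this
  exact this

lemma norm_natCast_cpow_sub {r : ℕ} (hr : 1 ≤ r) (k : ℕ) (t : ℝ) :
    ‖(r : ℂ) ^ ((k : ℂ) - t * Complex.I)‖ = (r : ℝ) ^ k := by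
  have hr' : (0 : ℝ) < r := by exact_mod_cast hr
  rw [← Complex.ofReal_natCast r, Complex.norm_cpow_eq_rpow_re_of_pos hr']
  simp

lemma norm_V₁ (k N : ℕ) (t : ℝ) {r : ℕ} (hr : 1 ≤ r) :
    ‖V₁ k N (t * Complex.I) r‖ = Real.cosh (Real.pi * t) * (r : ℝ) ^ k *
      ‖∑' n, V₁term k N (t * Complex.I) r n‖ := by
  unfold V₁
  rw [norm_mul, norm_mul, norm_natCast_cpow_sub hr, ← mul_assoc, Complex.cos_mul_I,
    ← Complex.ofReal_mul, ← Complex.ofReal_cosh, Complex.norm_real,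
    Real.norm_of_nonneg (Real.cosh_pos _).le]

lemma norm_V₃ (k N : ℕ) (t : ℝ) {r : ℕ} (hr : 1 ≤ r) :
    ‖V₃ k N (t * Complex.I) r‖ = (r : ℝ) ^ k * ‖∑' n, V₃term k N (t * Complex.I) r n‖ := by
  unfold V₃
  rw [norm_mul, norm_mul, norm_natCast_cpow_sub hr]
  simp

lemma V₁_V₃_bounds {k N r : ℕ} {t : ℝ} (hr : 1 ≤ r) {A B p : ℝ} (hp : 1 < p)
    (hA : ∀ n, Real.cosh (Real.pi * t) * ((r : ℝ) ^ k * ‖V₁term k N (t * Complex.I) r n‖) ≤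
      A * (1 / (n : ℝ) ^ p))
    (hB : ∀ n, (r : ℝ) ^ k * ‖V₃term k N (t * Complex.I) r n‖ ≤ B * (1 / (n : ℝ) ^ p)) :
    (Summable (V₁term k N (t * Complex.I) r) ∧ Summable (V₃term k N (t * Complex.I) r)) ∧
    ‖V₁ k N (t * Complex.I) r‖ ≤ A * ∑' n : ℕ, 1 / (n : ℝ) ^ p ∧
    ‖V₃ k N (t * Complex.I) r‖ ≤ B * ∑' n : ℕ, 1 / (n : ℝ) ^ p := by
  have hr' : (0 : ℝ) < r := by exact_mod_cast hr
  have hc := Real.cosh_pos (Real.pi * t)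
  have h1 := mul_norm_tsum_le (f := V₁term k N (t * Complex.I) r)
    (c := Real.cosh (Real.pi * t) * (r : ℝ) ^ k) (by positivity) hp
    (fun n => by rw [mul_assoc]; exact hA n)
  have h3 := mul_norm_tsum_le (f := V₃term k N (t * Complex.I) r)
    (c := (r : ℝ) ^ k) (by positivity) hp hB
  rw [norm_V₁ k N t hr, norm_V₃ k N t hr]
  exact ⟨⟨h1.1, h3.1⟩, h1.2, h3.2⟩

lemma norm_V₂_le {k N r : ℕ} {t : ℝ} (hr : 1 ≤ r) (hN : 1 ≤ N) {A p : ℝ} (hA0 : 0 ≤ A)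
    (hp : 1 < p)
    (hA : ∀ n, 1 ≤ n → n * N < r →
      (r : ℝ) ^ k * ‖tau 0 n * tau (t * Complex.I) (r - n * N) / ((r - n * N : ℕ) : ℂ) ^ k *
        hypH k 0 (t * Complex.I) ((r : ℝ) / ((r : ℝ) - n * N))‖ ≤ A * (1 / (n : ℝ) ^ p)) :
    ‖V₂ k N (t * Complex.I) r‖ ≤ A * ∑' n : ℕ, 1 / (n : ℝ) ^ p := by
  unfold V₂
  rw [norm_mul, norm_mul, norm_natCast_cpow_sub hr]
  have h1 : ‖((-1 : ℂ) ^ k)‖ = 1 := by simp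
  rw [h1, one_mul]
  calc _ ≤ (r : ℝ) ^ k * ∑ n ∈ Finset.Icc 1 ((r - 1) / N),
        ‖tau 0 n * tau (t * Complex.I) (r - n * N) / ((r - n * N : ℕ) : ℂ) ^ k *
        hypH k 0 (t * Complex.I) ((r : ℝ) / ((r : ℝ) - n * N))‖ := by
        gcongr
        exact norm_sum_le _ _
    _ ≤ ∑ n ∈ Finset.Icc 1 ((r - 1) / N), A * (1 / (n : ℝ) ^ p) := by
        rw [Finset.mul_sum]
        refine Finset.sum_le_sum fun n hn => hA n (Finset.mem_Icc.mp hn).1 ?_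
        have := (Nat.le_div_iff_mul_le (by lia)).mp (Finset.mem_Icc.mp hn).2
        lia
    _ = A * ∑ n ∈ Finset.Icc 1 ((r - 1) / N), 1 / (n : ℝ) ^ p := by rw [Finset.mul_sum]
    _ ≤ _ := by
        gcongr
        exact (Real.summable_one_div_nat_rpow.mpr hp).sum_le_tsum _ fun n _ => by positivity

lemma norm_V_le {k N l : ℕ} {t B : ℝ} (hl : 1 ≤ l)
    (hB : ∀ r, 1 ≤ r → r ≤ l → ‖V₁ k N (t * Complex.I) r + V₂ k N (t * Complex.I) r +
      V₃ k N (t * Complex.I) r‖ ≤ B) :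
    ‖V k N (t * Complex.I) l‖ ≤
      2 / (l : ℝ) ^ (1 / 2 : ℝ) * (l.divisors.card * l.divisors.card * B) := by
  have hl' : (0 : ℝ) < l := by exact_mod_cast hl
  have hB0 : 0 ≤ B := (norm_nonneg _).trans (hB l hl le_rfl)
  unfold V
  have h1 : ‖(2 * (-1) ^ k / (l : ℂ) ^ ((1 : ℂ) / 2 - t * Complex.I) : ℂ)‖ =
      2 / (l : ℝ) ^ (1 / 2 : ℝ) := by
    rw [norm_div, norm_mul, ← Complex.ofReal_natCast l,
      Complex.norm_cpow_eq_rpow_re_of_pos hl']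
    simp
  rw [norm_mul, h1]
  gcongr
  have hterm : ∀ d ∈ l.divisors, ‖∑ r ∈ d.divisors, (ArithmeticFunction.moebius (d / r) : ℂ) *
      (V₁ k N (t * Complex.I) r + V₂ k N (t * Complex.I) r + V₃ k N (t * Complex.I) r)‖ ≤
      l.divisors.card * B := by
    intro d hd
    have hdl := Nat.dvd_of_mem_divisors hd
    have hsub : d.divisors ⊆ l.divisors := Nat.divisors_subset_of_dvd (by lia) hdl
    calc _ ≤ ∑ r ∈ d.divisors, B := by
          refine (norm_sum_le _ _).trans (Finset.sum_le_sum fun r hr => ?_)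
          have hrl := hsub hr
          have hμ : ‖(ArithmeticFunction.moebius (d / r) : ℂ)‖ ≤ 1 := by
            rw [Complex.norm_intCast]
            exact_mod_cast ArithmeticFunction.abs_moebius_le_one
          rw [norm_mul]
          exact (mul_le_of_le_one_left (norm_nonneg _) hμ).trans
            (hB r (Nat.pos_of_mem_divisors hrl) (Nat.divisor_le hrl))
      _ = d.divisors.card * B := by simp
      _ ≤ _ := by
          gcongr
  calc _ ≤ ∑ d ∈ l.divisors, (l.divisors.card : ℝ) * B :=
        (norm_sum_le _ _).trans (Finset.sum_le_sum hterm)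
    _ = _ := by simp; ring

/-- The bound for `V` that is used for large `l`. -/
theorem exists_norm_V_le {δ : ℝ} (hδ : 0 < δ) (hδ' : δ ≤ 1 / 4) :
    ∃ C : ℝ, 0 < C ∧ ∀ (k N l : ℕ) (t : ℝ), 2 ≤ k → 1 ≤ N → 1 ≤ l →
      ‖V k N (t * Complex.I) l‖ ≤
        C * (((l : ℝ) * (3 + |t|)) ^ (4 * δ) * ((l : ℝ) ^ (1 / 2 : ℝ) * (k + (3 + |t|)) / N)) := by
  obtain ⟨C₁, hC₁, H₁⟩ := exists_V₁term_le hδ hδ'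
  obtain ⟨C₂, hC₂, H₂⟩ := exists_V₂_term_le hδ hδ'
  obtain ⟨C₃, hC₃, H₃⟩ := exists_V₃term_le hδ hδ'
  obtain ⟨D, hD, HD⟩ := exists_card_divisors_le (show 0 < δ / 2 by linarith)
  set Z : ℝ := ∑' n : ℕ, 1 / (n : ℝ) ^ (1 + δ / 2) with hZ
  have hZ0 : 0 ≤ Z := tsum_nonneg fun n => by positivity
  refine ⟨2 * (D * D * ((C₁ + C₂ + C₃) * (Z + 1))), by positivity, fun k N l t hk hN hl => ?_⟩
  set T := 3 + |t| with hT
  have hT3 : 3 ≤ T := by rw [hT]; linarith [abs_nonneg t]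
  have hl' : (1 : ℝ) ≤ l := by exact_mod_cast hl
  have hN' : (1 : ℝ) ≤ N := by exact_mod_cast hN
  have hp : 1 < 1 + δ / 2 := by linarith
  have hB : ∀ r, 1 ≤ r → r ≤ l → ‖V₁ k N (t * Complex.I) r + V₂ k N (t * Complex.I) r +
      V₃ k N (t * Complex.I) r‖ ≤
      (C₁ + C₂ + C₃) * (Z + 1) * ((l : ℝ) ^ (3 * δ) * T ^ (2 * δ) * (k + T) * (l / N)) := by
    intro r hr hrl
    have hr' : (1 : ℝ) ≤ r := by exact_mod_cast hr
    have hrl' : (r : ℝ) ≤ l := by exact_mod_cast hrl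
    set E : ℝ := (r : ℝ) ^ (2 * δ) * T ^ (2 * δ) * (k + T) with hE
    have hE0 : 0 ≤ E := by positivity
    have hsplit : ∀ (C : ℝ) (n : ℕ), C * E * ((r : ℝ) / N / n) ^ (1 + δ / 2) =
        C * (E * ((r : ℝ) / N) ^ (1 + δ / 2)) * (1 / (n : ℝ) ^ (1 + δ / 2)) := by
      intro C n
      rw [Real.div_rpow (by positivity) (by positivity)]; ring
    obtain ⟨-, h1, h3⟩ := V₁_V₃_bounds (k := k) (N := N) (t := t) hr hp
      (fun n => (H₁ k N r n t hk hN hr).trans_eq (hsplit C₁ n))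
      (fun n => (H₃ k N r n t hk hN hr).trans_eq (hsplit C₃ n))
    have h2 := norm_V₂_le (k := k) (N := N) (t := t) hr hN (by positivity) hp
      (fun n hn hnr => (H₂ k N r n t hk hN hr hn hnr).trans_eq (hsplit C₂ n))
    rw [← hZ] at h1 h2 h3
    have hF : E * ((r : ℝ) / N) ^ (1 + δ / 2) ≤
        (l : ℝ) ^ (3 * δ) * T ^ (2 * δ) * (k + T) * (l / N) := by
      -- Exactly one power of 1/N is kept; the surplus (r/N)^(δ/2) is bounded by a small power of l.
      have e1 : ((r : ℝ) / N) ^ (1 + δ / 2) ≤ (l / N) * (l : ℝ) ^ δ := by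
        rw [Real.rpow_add (by positivity), Real.rpow_one]
        gcongr
        calc ((r : ℝ) / N) ^ (δ / 2) ≤ (l : ℝ) ^ (δ / 2) := by
              gcongr
              exact (div_le_self (by linarith) hN').trans hrl'
          _ ≤ _ := Real.rpow_le_rpow_of_exponent_le hl' (by linarith)
      calc _ ≤ ((l : ℝ) ^ (2 * δ) * T ^ (2 * δ) * (k + T)) * ((l / N) * (l : ℝ) ^ δ) := by
            rw [hE]; gcongr
        _ = ((l : ℝ) ^ (2 * δ) * (l : ℝ) ^ δ) * T ^ (2 * δ) * (k + T) * (l / N) := by ring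
        _ = _ := by rw [← Real.rpow_add (by linarith)]; ring_nf
    set F := (l : ℝ) ^ (3 * δ) * T ^ (2 * δ) * (k + T) * (l / N)
    set G := E * ((r : ℝ) / N) ^ (1 + δ / 2)
    have hG0 : 0 ≤ G := by positivity
    calc _ ≤ C₁ * G * Z + C₂ * G * Z + C₃ * G * Z :=
          (norm_add₃_le).trans (add_le_add (add_le_add h1 h2) h3)
      _ = (C₁ + C₂ + C₃) * Z * G := by ring
      _ ≤ (C₁ + C₂ + C₃) * (Z + 1) * F := by gcongr; linarith
  have hV := norm_V_le (k := k) (N := N) hl hB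
  have hd := HD l (by lia)
  have e2 : (l : ℝ) / (l : ℝ) ^ (1 / 2 : ℝ) = (l : ℝ) ^ (1 / 2 : ℝ) := by
    rw [div_eq_iff (by positivity), ← Real.rpow_add (by linarith)]; norm_num
  calc _ ≤ _ := hV
    _ ≤ 2 / (l : ℝ) ^ (1 / 2 : ℝ) * ((D * (l : ℝ) ^ (δ / 2)) * (D * (l : ℝ) ^ (δ / 2)) *
        ((C₁ + C₂ + C₃) * (Z + 1) * ((l : ℝ) ^ (3 * δ) * T ^ (2 * δ) * (k + T) * (l / N)))) := by
        gcongr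
    _ = 2 * (D * D * ((C₁ + C₂ + C₃) * (Z + 1))) *
        (((l : ℝ) ^ (δ / 2) * (l : ℝ) ^ (δ / 2) * (l : ℝ) ^ (3 * δ)) * T ^ (2 * δ) *
        ((l / (l : ℝ) ^ (1 / 2 : ℝ)) * (k + T) / N)) := by ring
    _ = 2 * (D * D * ((C₁ + C₂ + C₃) * (Z + 1))) *
        ((l : ℝ) ^ (4 * δ) * T ^ (2 * δ) * ((l : ℝ) ^ (1 / 2 : ℝ) * (k + T) / N)) := by
        rw [e2, ← Real.rpow_add (by linarith), ← Real.rpow_add (by linarith)]; ring_nf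
    _ ≤ 2 * (D * D * ((C₁ + C₂ + C₃) * (Z + 1))) *
        ((l : ℝ) ^ (4 * δ) * T ^ (4 * δ) * ((l : ℝ) ^ (1 / 2 : ℝ) * (k + T) / N)) := by
        gcongr
        · linarith
        · linarith
    _ = _ := by rw [Real.mul_rpow (by linarith) (by linarith)]

/-- The bound for `V` that is used for small `l`. -/
theorem exists_norm_V_edge_le {ε : ℝ} (hε : 0 < ε) (hε' : ε ≤ 1 / 8) :
    ∃ C : ℝ, 0 < C ∧ ∀ (k N l : ℕ) (t : ℝ), 2 ≤ k → 1 ≤ l → l < N →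
      ‖V k N (t * Complex.I) l‖ ≤
        C * (((l : ℝ) * (3 + |t|) ^ 2 / (4 * ((N : ℝ) - l))) ^ k *
          ((N : ℝ) ^ (3 * ε) / ((l : ℝ) ^ (1 / 2 : ℝ) * (3 + |t|)))) := by
  obtain ⟨C₁, hC₁, H₁⟩ := exists_V₁term_edge_le hε hε'
  obtain ⟨C₃, hC₃, H₃⟩ := exists_V₃term_edge_le hε hε'
  obtain ⟨D, hD, HD⟩ := exists_card_divisors_le (show 0 < ε / 2 by linarith)
  set Z : ℝ := ∑' n : ℕ, 1 / (n : ℝ) ^ (3 / 2 : ℝ) with hZ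
  have hZ0 : 0 ≤ Z := tsum_nonneg fun n => by positivity
  refine ⟨2 * (D * D * ((C₁ + C₃) * (Z + 1))), by positivity, fun k N l t hk hl hlN => ?_⟩
  set T := 3 + |t| with hT
  have hT3 : 3 ≤ T := by rw [hT]; linarith [abs_nonneg t]
  have hl' : (1 : ℝ) ≤ l := by exact_mod_cast hl
  have hlN' : (l : ℝ) < N := by exact_mod_cast hlN
  have hNl : 0 < (N : ℝ) - l := by linarith
  set G : ℝ := (T ^ 2 / 4) ^ k / T * ((l : ℝ) / (N - l)) ^ k * (N : ℝ) ^ (2 * ε) with hG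
  have hG0 : 0 ≤ G := by positivity
  have hB : ∀ r, 1 ≤ r → r ≤ l → ‖V₁ k N (t * Complex.I) r + V₂ k N (t * Complex.I) r +
      V₃ k N (t * Complex.I) r‖ ≤ (C₁ + C₃) * (Z + 1) * G := by
    intro r hr hrl
    obtain ⟨-, h1, h3⟩ := V₁_V₃_bounds (k := k) (N := N) (t := t) hr (by norm_num)
      (fun n => H₁ k N l r n t hk hr hrl hlN) (fun n => H₃ k N l r n t hk hr hrl hlN)
    rw [← hZ, ← hG] at h1 h3
    -- Since r ≤ l < N, the range 1 ≤ n ≤ (r - 1)/N is empty.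
    have h2 : V₂ k N (t * Complex.I) r = 0 := by
      unfold V₂
      rw [Nat.div_eq_of_lt (by lia : r - 1 < N)]
      simp
    rw [h2, add_zero]
    calc _ ≤ C₁ * G * Z + C₃ * G * Z := (norm_add_le _ _).trans (add_le_add h1 h3)
      _ = (C₁ + C₃) * Z * G := by ring
      _ ≤ _ := by gcongr; linarith
  have hV := norm_V_le (k := k) (N := N) hl hB
  have hd : (l.divisors.card : ℝ) ≤ D * (N : ℝ) ^ (ε / 2) :=
    (HD l (by lia)).trans (by gcongr)
  have e1 : ((l : ℝ) * T ^ 2 / (4 * ((N : ℝ) - l))) ^ k =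
      (T ^ 2 / 4) ^ k * ((l : ℝ) / (N - l)) ^ k := by
    rw [← mul_pow]; congr 1; field_simp
  have e2 : (N : ℝ) ^ (3 * ε) = (N : ℝ) ^ (ε / 2) * (N : ℝ) ^ (ε / 2) * (N : ℝ) ^ (2 * ε) := by
    rw [← Real.rpow_add (by linarith), ← Real.rpow_add (by linarith)]; ring_nf
  calc _ ≤ _ := hV
    _ ≤ 2 / (l : ℝ) ^ (1 / 2 : ℝ) * ((D * (N : ℝ) ^ (ε / 2)) * (D * (N : ℝ) ^ (ε / 2)) *
        ((C₁ + C₃) * (Z + 1) * G)) := by gcongr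
    _ = _ := by rw [e1, e2, hG]; field_simp

end SecondMoment

theorem mainTheorem5 :
    (∀ (k N r : ℕ) (t : ℝ), 2 ≤ k → 1 ≤ N → 1 ≤ r →
      Summable (SecondMoment.V₁term k N (t * Complex.I) r) ∧
      Summable (SecondMoment.V₃term k N (t * Complex.I) r)) ∧
    ∀ ε : ℝ, 0 < ε → ∃ C : ℝ, 0 < C ∧
      ∀ (k N l : ℕ) (t T : ℝ), 2 ≤ k → 1 ≤ N → 1 ≤ l → T = 3 + |t| →
        ((N : ℝ) / (1 + T ^ 2) ≤ (l : ℝ) →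
          ‖SecondMoment.V k N (t * Complex.I) l‖ ≤
            C * (((l : ℝ) * k * T ^ 2) ^ ε * ((l : ℝ) ^ (1 / 2 : ℝ) * (k + T) / N))) ∧
        ((l : ℝ) < (N : ℝ) / (1 + T ^ 2) →
          ‖SecondMoment.V k N (t * Complex.I) l‖ ≤
            C * (((l : ℝ) * T ^ 2 / (4 * ((N : ℝ) - l))) ^ k *
              ((N : ℝ) ^ ε / ((l : ℝ) ^ (1 / 2 : ℝ) * T)))) := by
  constructor
  · intro k N r t hk hN hr
    obtain ⟨C₁, hC₁, H₁⟩ := SecondMoment.exists_V₁term_le (δ := 1 / 4) (by norm_num) (by norm_num)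
    obtain ⟨C₃, hC₃, H₃⟩ := SecondMoment.exists_V₃term_le (δ := 1 / 4) (by norm_num) (by norm_num)
    have hsplit : ∀ (C : ℝ) (n : ℕ), C * ((r : ℝ) / N / n) ^ (1 + 1 / 4 / 2 : ℝ) =
        C * ((r : ℝ) / N) ^ (1 + 1 / 4 / 2 : ℝ) * (1 / (n : ℝ) ^ (1 + 1 / 4 / 2 : ℝ)) := by
      intro C n
      rw [Real.div_rpow (by positivity) (by positivity)]; ring
    exact (SecondMoment.V₁_V₃_bounds (k := k) (N := N) (t := t) hr (by norm_num)
      (fun n => (H₁ k N r n t hk hN hr).trans_eq (hsplit _ n))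
      (fun n => (H₃ k N r n t hk hN hr).trans_eq (hsplit _ n))).1
  · intro ε hε
    -- The condition 4δ ≤ ε covers both the exponent 4δ of lT for large l and the exponent 3δ of N
    -- for small l; 1/8 is the limit of validity at the left edge.
    set δ := min (ε / 4) (1 / 8) with hδ
    have hδ0 : 0 < δ := lt_min (by linarith) (by norm_num)
    have hδ8 : δ ≤ 1 / 8 := min_le_right _ _
    have hδε : 4 * δ ≤ ε := by linarith [min_le_left (ε / 4) (1 / 8)]
    obtain ⟨C₁, hC₁, H₁⟩ := SecondMoment.exists_norm_V_le hδ0 (by linarith)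
    obtain ⟨C₂, hC₂, H₂⟩ := SecondMoment.exists_norm_V_edge_le hδ0 hδ8
    refine ⟨max C₁ C₂, lt_max_of_lt_left hC₁, ?_⟩
    rintro k N l t T hk hN hl rfl
    have hl' : (1 : ℝ) ≤ l := by exact_mod_cast hl
    have hN' : (1 : ℝ) ≤ N := by exact_mod_cast hN
    have hk' : (2 : ℝ) ≤ k := by exact_mod_cast hk
    set T := 3 + |t| with hT
    have hT3 : 3 ≤ T := by rw [hT]; linarith [abs_nonneg t]
    constructor
    · intro _
      refine (H₁ k N l t hk hN hl).trans ?_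
      have hbase : (l : ℝ) * T ≤ l * k * T ^ 2 := by
        rw [mul_assoc]
        gcongr
        nlinarith
      have hlT : 1 ≤ (l : ℝ) * T := by nlinarith
      gcongr
      · exact le_max_left _ _
      · calc ((l : ℝ) * T) ^ (4 * δ) ≤ ((l : ℝ) * T) ^ ε :=
              Real.rpow_le_rpow_of_exponent_le hlT hδε
          _ ≤ _ := by gcongr
    · intro hlN
      have hlN2 : (l : ℝ) < N := by
        refine hlN.trans_le (div_le_self (by linarith) ?_)
        nlinarith
      have hNl : 0 < (N : ℝ) - l := by linarith
      refine (H₂ k N l t hk hl (by exact_mod_cast hlN2)).trans ?_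
      gcongr
      · exact le_max_right _ _
      · linarith
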